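/- **Setting.** Let $\sigma,w$ be weights (locally finite non-negative Borel measures) on $\mathbb R$. Let $\mathcal D$ be a dyadic grid: a nonempty family of bounded intervals $[a,b)$, any two nested or disjoint, such that for each $I\in\mathcal D$ the members of $\mathcal D$ of length $|I|$ partition $\mathbb R$, the two halves (children) $I_-,I_+$ of $I$ are in $\mathcal D$, and $I$ is a child of a member of $\mathcal D$. Assume that $\sigma$ and $w$ do not charge the endpoints of intervals of $\mathcal D$. For $0<\alpha<\beta<\infty$ put $H_\sigma f(x)=\int_{\alpha<|x-y|<\beta}\frac{f(y)}{x-y}\,\sigma(dy)$ (the truncation is suppressed in the notation), $\langle u,v\rangle_w=\int uv\,dw$, $\|f\|_\sigma=\|f\|_{L^2(\sigma)}$, $\mathbb E^\sigma_I f=\sigma(I)^{-1}\int_I f\,d\sigma$ (and $0$ if $\sigma(I)=0$), and identify intervals with their indicator functions. Set $\Delta^\sigma_I f=\langle f,h^\sigma_I\rangle_\sigma h^\sigma_I$, where $h_I^\sigma=\sqrt{\tfrac{\sigma(I_-)\sigma(I_+)}{\sigma(I)}}\bigl(\tfrac{I_-}{\sigma(I_-)}-\tfrac{I_+}{\sigma(I_+)}\bigr)$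 is the Haar function (zero if a half of $I$ has no $\sigma$-mass). Fix $0<\epsilon<\frac12$ and an integer $r\ge2$. An interval $J\in\mathcal D$ is *good* if $\operatorname{dist}(J,\partial I_\pm)\ge|J|^{\epsilon}|I|^{1-\epsilon}$ for both children $I_\pm$ of every $I\in\mathcal D$ with $|I|\ge2^{r+1}|J|$. A function $f\in L^2(\sigma)$ is *good* if $f=P^\sigma_{\rm good}f:=\sum_{I\in\mathcal D\text{ good}}\Delta^\sigma_I f$ in $L^2(\sigma)$, and likewise for $w$. Write $J\Subset I$ if $I,J\in\mathcal D$, $J\subset I$ and $|J|\le2^{-r}|I|$, and let $I_J$ be the child of $I$ containing $J$. Define $B(f,\varphi)=\langle H_\sigma f,\varphi\rangle_w$, $$B_\Subset(f,\varphi)=\sum_{I\in\mathcal D}\ \sum_{J:\,J\Subset I}\mathbb E^\sigma_{I_J}(\Delta^\sigma_I f)\,\langle H_\sigma I_J,\Delta^w_J\varphi\rangle_w,\qquad B_\Supset(f,\varphi)=\sum_{J\in\mathcal D}\ \sum_{I:\,I\Subset J}\mathbb E^w_{J_I}(\Delta^w_J\varphi)\,\langle H_\sigma\Delta^\sigma_I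 f,J_I\rangle_w .$$ Let $\mathbf A_2=\sup_{x\in\mathbb R,\,t>0}\mathsf Pw(x,t)\,\mathsf P\sigma(x,t)$, with $\mathsf P$ the Poisson extension to the upper half plane; $\mathbf H^2=\sup\sigma(I)^{-1}\int_I|H_\sigma I|^2\,dw$, the supremum being over all intervals $I=[a,b)$ and all truncations, and $\mathbf H_*$ the same constant with $\sigma$ and $w$ exchanged. For a given truncation let $\mathbf W$ be the best constant in $|\langle H_\sigma I,J\rangle_w|\le\mathbf W\,\sigma(I)^{1/2}w(J)^{1/2}$ over intervals $I,J$ of the form $[a,b)$ with $2^{-r}|J|\le|I|\le2^r|J|$. **Theorem.** There is a constant $C=C(\epsilon,r)$ such that, for all $\mathcal D,\sigma,w$ as above with $\mathbf A_2,\mathbf H,\mathbf H_*<\infty$, the following hold. 1. For every truncation and all good $f\in L^2(\sigma)$ and $\varphi\in L^2(w)$, the integral defining $B(f,\varphi)$ and the iterated sums defining $B_\Subset(f,\varphi)$, $B_\Supset(f,\varphi)$ converge absolutely (the inner sums for each outer index, and then the outer sum), and $$\bigl|B(f,\varphi)-\{B_\Subset(f,\varphi)+B_\Supset(f,\varphi)\}\bigr|\le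 C\,(\sqrt{\mathbf A_2}+\mathbf W)\,\|f\|_\sigma\|\varphi\|_w .$$ 2. Consequently, there is $K<\infty$ with $|B(f,\varphi)|\le K\|f\|_\sigma\|\varphi\|_w$ for all truncations and all good $f,\varphi$ if and only if there is $K'<\infty$ with $|B_\Subset(f,\varphi)+B_\Supset(f,\varphi)|\le K'\|f\|_\sigma\|\varphi\|_w$ for all truncations and all good $f,\varphi$. -/

import Mathlib

open MeasureTheory Filter Topology
open scoped ENNReal NNReal

noncomputable section

namespace TwoWeight

/-- A bounded non-degenerate interval of the real line, represented as `[left, right)`. -/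
@[ext] structure Itv where
  left : ℝ
  right : ℝ
  lt : left < right

namespace Itv

/-- The underlying set of points. -/
def toSet (I : Itv) : Set ℝ := Set.Ico I.left I.right

/-- The length `|I|`. -/
def len (I : Itv) : ℝ := I.right - I.left

/-- The midpoint. -/
def mid (I : Itv) : ℝ := (I.left + I.right) / 2

/-- The left half `I₋`. -/
def minus (I : Itv) : Itv where
  left := I.left
  right := I.mid
  lt := by have := I.lt; unfold mid; linarith

/-- The right half `I₊`. -/
def plus (I : Itv) : Itv where
  left := I.mid
  right := I.right
  lt := by have := I.lt; unfold mid; linarith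

/-- The indicator function of `I`. -/
def ind (I : Itv) : ℝ → ℝ := I.toSet.indicator (fun _ => 1)

open Classical in
/-- `I_J`: the child of `I` that contains `J` (used for `J` contained in one of the two halves). -/
def childAt (I J : Itv) : Itv := if J.toSet ⊆ I.minus.toSet then I.minus else I.plus

/-- `J ⋐ I`: `J ⊆ I` and `|J| ≤ 2 ^ (-r) |I|`. -/
def Inside (r : ℕ) (J I : Itv) : Prop := J.toSet ⊆ I.toSet ∧ 2 ^ r * J.len ≤ I.len

end Itv

/-- Dyadic grids: nested families of intervals, in which the members of any occurring length
partition the line, closed under passing to the two halves and to the dyadic parent. -/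
structure IsDyadicGrid (D : Set Itv) : Prop where
  nonempty : D.Nonempty
  nested : ∀ I ∈ D, ∀ J ∈ D,
    Disjoint I.toSet J.toSet ∨ I.toSet ⊆ J.toSet ∨ J.toSet ⊆ I.toSet
  partition : ∀ I ∈ D, ∀ x : ℝ, ∃! I' : Itv, I' ∈ D ∧ I'.len = I.len ∧ x ∈ I'.toSet
  minus_mem : ∀ I ∈ D, I.minus ∈ D
  plus_mem : ∀ I ∈ D, I.plus ∈ D
  parent : ∀ I ∈ D, ∃ I' ∈ D, I = I'.minus ∨ I = I'.plus

/-- No endpoint of an interval of the grid carries positive mass. -/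
def NoEndpointMass (D : Set Itv) (σ : Measure ℝ) : Prop :=
  ∀ I ∈ D, σ {I.left} = 0 ∧ σ {I.right} = 0

/-- `J` is `(ε, r)`-good in the grid `D`: its distance to the boundary of either child of `I` is at
least `|J| ^ ε |I| ^ (1 - ε)` whenever `I ∈ D` has length at least `2 ^ (r + 1) |J|`. The boundary
points of the children of `I` are the endpoints and the midpoint of `I`. -/
def IsGood (D : Set Itv) (ε : ℝ) (r : ℕ) (J : Itv) : Prop :=
  ∀ I ∈ D, 2 ^ (r + 1) * J.len ≤ I.len →
    ∀ p ∈ ({I.left, I.mid, I.right} : Set ℝ), ∀ x ∈ J.toSet,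
      J.len ^ ε * I.len ^ (1 - ε) ≤ |x - p|

/-- The truncated Hilbert transform of `f σ`, with sharp truncation `α < |x - y| < β`. -/
def hilbert (α β : ℝ) (σ : Measure ℝ) (f : ℝ → ℝ) (x : ℝ) : ℝ :=
  ∫ y in {y : ℝ | α < |x - y| ∧ |x - y| < β}, f y / (x - y) ∂σ

/-- The pairing `⟨u, v⟩_w`. -/
def pair (w : Measure ℝ) (u v : ℝ → ℝ) : ℝ := ∫ x, u x * v x ∂w

/-- The Poisson extension of `σ` at the point `(x, t)` of the upper half plane. -/
def poisson (σ : Measure ℝ) (x t : ℝ) : ℝ≥0∞ :=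
  ∫⁻ y, ENNReal.ofReal (t / (Real.pi * (t ^ 2 + (x - y) ^ 2))) ∂σ

/-- The constant `A₂`. -/
def A2 (σ w : Measure ℝ) : ℝ≥0∞ :=
  ⨆ (x : ℝ) (t : ℝ) (_ : 0 < t), poisson w x t * poisson σ x t

/-- The square of the interval testing constant, uniformly in the truncation. (When `σ(I) = 0`
the integral vanishes and the quotient is `0`.) Exchanging the weights gives the dual constant. -/
def testingSq (σ w : Measure ℝ) : ℝ≥0∞ :=
  ⨆ (α : ℝ) (β : ℝ) (_ : 0 < α) (_ : α < β) (I : Itv),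
    (σ I.toSet)⁻¹ * ∫⁻ x in I.toSet, ENNReal.ofReal (hilbert α β σ I.ind x ^ 2) ∂w

/-- The weak-boundedness constant `W` of the truncation `(α, β)`: the best constant in
`|⟨H_σ 1_I, 1_J⟩_w| ≤ W σ(I)^{1/2} w(J)^{1/2}`, over `I`, `J` with
`2 ^ (-r) |J| ≤ |I| ≤ 2 ^ r |J|`. -/
def weakBdd (r : ℕ) (α β : ℝ) (σ w : Measure ℝ) : ℝ≥0∞ :=
  sInf {W : ℝ≥0∞ | ∀ I J : Itv, J.len ≤ 2 ^ r * I.len → I.len ≤ 2 ^ r * J.len →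
    ENNReal.ofReal |pair w (hilbert α β σ I.ind) J.ind| ≤
      W * (σ I.toSet) ^ (1 / 2 : ℝ) * (w J.toSet) ^ (1 / 2 : ℝ)}

/-- The Haar function `h_I^σ` (it is `0` if one of the halves of `I` has no mass). -/
def haar (σ : Measure ℝ) (I : Itv) (x : ℝ) : ℝ :=
  √(σ.real I.minus.toSet * σ.real I.plus.toSet / σ.real I.toSet) *
    (I.minus.ind x / σ.real I.minus.toSet - I.plus.ind x / σ.real I.plus.toSet)

/-- The martingale difference `Δ_I^σ f = ⟨f, h_I^σ⟩_σ h_I^σ`. -/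
def mdiff (σ : Measure ℝ) (I : Itv) (f : ℝ → ℝ) (x : ℝ) : ℝ :=
  pair σ f (haar σ I) * haar σ I x

/-- `f ∈ L²(σ)` and `f = ∑ Δ_I^σ f`, the sum over the good `I ∈ D`, unconditionally in `L²(σ)`. -/
def IsGoodFun (D : Set Itv) (ε : ℝ) (r : ℕ) (σ : Measure ℝ) (f : ℝ → ℝ) : Prop :=
  MemLp f 2 σ ∧
  Tendsto (fun F : Finset {I : Itv // I ∈ D ∧ IsGood D ε r I} =>
    eLpNorm (fun x => f x - ∑ I ∈ F, mdiff σ I.1 f x) 2 σ) atTop (𝓝 0)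

/-- The full form `B(f, φ) = ⟨H_σ f, φ⟩_w`. -/
def formB (α β : ℝ) (σ w : Measure ℝ) (f φ : ℝ → ℝ) : ℝ := pair w (hilbert α β σ f) φ

/-- The summand of `B_⋐`: `E^σ_{I_J} (Δ_I^σ f) · ⟨H_σ 1_{I_J}, Δ_J^w φ⟩_w`. -/
def belowTerm (α β : ℝ) (σ w : Measure ℝ) (f φ : ℝ → ℝ) (I J : Itv) : ℝ :=
  (⨍ x in (I.childAt J).toSet, mdiff σ I f x ∂σ) *
    pair w (hilbert α β σ (I.childAt J).ind) (mdiff w J φ)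

/-- The summand of `B_⋑`: `E^w_{J_I} (Δ_J^w φ) · ⟨H_σ Δ_I^σ f, 1_{J_I}⟩_w`. -/
def aboveTerm (α β : ℝ) (σ w : Measure ℝ) (f φ : ℝ → ℝ) (J I : Itv) : ℝ :=
  (⨍ x in (J.childAt I).toSet, mdiff w J φ x ∂w) *
    pair w (hilbert α β σ (mdiff σ I f)) (J.childAt I).ind

/-- The iterated sum `∑_{I ∈ D} ∑_{J ∈ D, J ⋐ I} t I J`. -/
def insideSum (D : Set Itv) (r : ℕ) (t : Itv → Itv → ℝ) : ℝ :=
  ∑' I : {I : Itv // I ∈ D}, ∑' J : {J : Itv // J ∈ D ∧ J.Inside r I.1}, t I.1 J.1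

/-- The iterated sum `∑_{I ∈ D} ∑_{J ∈ D, J ⋐ I} t I J` converges: the inner sums and the outer sum
are summable. -/
def InsideSummable (D : Set Itv) (r : ℕ) (t : Itv → Itv → ℝ) : Prop :=
  (∀ I ∈ D, Summable fun J : {J : Itv // J ∈ D ∧ J.Inside r I} => t I J.1) ∧
  Summable fun I : {I : Itv // I ∈ D} =>
    ∑' J : {J : Itv // J ∈ D ∧ J.Inside r I.1}, t I.1 J.1

/-- The form `B_⋐(f, φ)`. -/
def formBelow (D : Set Itv) (r : ℕ) (α β : ℝ) (σ w : Measure ℝ) (f φ : ℝ → ℝ) : ℝ :=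
  insideSum D r (belowTerm α β σ w f φ)

/-- The dual form `B_⋑(f, φ)`. -/
def formAbove (D : Set Itv) (r : ℕ) (α β : ℝ) (σ w : Measure ℝ) (f φ : ℝ → ℝ) : ℝ :=
  insideSum D r (aboveTerm α β σ w f φ)

/-- A family of forms, indexed by the truncations, is bounded on good functions, uniformly in the
truncation. -/
def UnifBounded (D : Set Itv) (ε : ℝ) (r : ℕ) (σ w : Measure ℝ)
    (B : ℝ → ℝ → (ℝ → ℝ) → (ℝ → ℝ) → ℝ) : Prop :=
  ∃ K : ℝ≥0, ∀ α β : ℝ, 0 < α → α < β → ∀ f φ : ℝ → ℝ,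
    IsGoodFun D ε r σ f → IsGoodFun D ε r w φ →
    ENNReal.ofReal |B α β f φ| ≤ K * eLpNorm f 2 σ * eLpNorm φ 2 w

end TwoWeight

end

/-!
# The bilinear form of the truncated Hilbert transform in two weight `L²`

On finite sums of Haar differences `u I = Δ_I f`, `v J = Δ_J φ` over good intervals, the difference
between `B(f, φ)` and the two sums over nested pairs is a sum of residues: `residue` is the form on
the pair `(u I, v J)`, without the inside term if one interval lies deep inside the other. It has
to be bounded by `√A₂ + W` times the `ℓ²` norms of the two families, which are `L²` norms by
orthogonality.

*Near pairs* (comparable lengths, distance less than the larger length). Haar differences are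
constant on children, so `W` bounds each residue, and an interval has boundedly many near ones:
Schur's test gives `abs_sum_residue_near_le`.

*Far pairs.* The sharp truncation is too rough for the cancellation of `v J`. It is split as
`smoothKernel + outerKernel + innerKernel` (`sharpKernel_eq`): a Lipschitz truncation of `1 / t`,
and the two jumps at `β` and `α`.

For the smooth kernel, let `J` be the shorter interval. A far pair is separated by at least
`|J| ^ ε * |I| ^ (1 - ε)` by goodness, once the inside term has removed the child of `I` around
`J`. The mean zero of `v J` then gains `(|J| / |I|) ^ (1 - 2 * ε)` over the Poisson kernel at height
`|I|` (`abs_residue_far_le`). Up to constants the Poisson kernel is dominated by its convolution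
with itself at the same height, so Cauchy--Schwarz bounds its form by `√A₂` (`abs_bform_le`). The
intervals of a generation are disjoint, hence the sum over all pairs with a given ratio of lengths
is one such form, and the gain makes the ratios summable (`sum_ratio_rpow_mul_bform_pk_le`).

A jump at `a` is a `LocalKernel`: of size at most `1 / a` and of range `a`. Such a kernel has no
cancellation to exploit and no need for it. It is dominated by a Poisson kernel, so its whole form
is bounded by `√A₂`; and so are both of its inside sums (`abs_sum_inside_le`). If `I` is not longer
than about `a`, the size of the kernel is small compared to `1 / |I|`, which is summable over the
ancestors of `J`. If `I` is longer, goodness or the neighbours of an interval of length about `a`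
reduce the sum over `I` to averages of `∑ u I`, which the Carleson embedding theorem
(`carleson_embedding`) handles as a paraproduct. So the far part is estimated as everything minus
the near part (`LocalKernel.abs_sum_residue_far_le`), and altogether one gets
`abs_sum_residue_sharp_le`.

*Convergence.* For a fixed truncation the sharp kernel itself is a multiple of a local kernel of
range `β` (`localKernel_sharp`). So the finite inside sums are bounded in terms of the `ℓ²` norms
even after arbitrary changes of sign, with a constant that depends on the truncation, and that
forces absolute convergence of the iterated sums (`summable_of_bilinear_bound`). The uniform
estimate passes to the limit (`forms_of_isGoodFun`).

*The equivalence.* The forms differ by `C (√A₂ + W)`, and `W` is bounded uniformly in the truncation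
(`weakBdd_le`): the part of `J` inside `I` is a case of testing, and the parts outside `I` are
intervals disjoint from `I`, where a Hardy inequality bounds the form by `√A₂`
(`lintegral_inv_abs_le`).
-/

namespace TwoWeight

/-! ### The Poisson kernel and the `A₂` condition -/

/-- The kernel `t / (t² + u²)`: the Poisson kernel of the half plane without its factor `1 / π`. -/
noncomputable def pk (t u : ℝ) : ℝ := t / (t ^ 2 + u ^ 2)

lemma pk_nonneg {t : ℝ} (ht : 0 < t) (u : ℝ) : 0 ≤ pk t u := by unfold pk; positivity

@[fun_prop] lemma measurable_pk (t : ℝ) : Measurable (pk t) := by unfold pk; fun_prop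

lemma pk_neg (t u : ℝ) : pk t (-u) = pk t u := by unfold pk; ring

lemma inv_le_two_mul_pk {t u : ℝ} (ht : 0 < t) (hu : |u| ≤ t) : 1 / t ≤ 2 * pk t u := by
  have : u ^ 2 ≤ t ^ 2 := by rw [← sq_abs u]; gcongr
  unfold pk
  rw [← mul_div_assoc, div_le_div_iff₀ ht (by positivity)]
  nlinarith

lemma integral_pk {t : ℝ} (ht : 0 < t) : ∫⁻ z, ENNReal.ofReal (pk t z) = ENNReal.ofReal Real.pi := by
  have h1 : ∀ z, pk t z = t⁻¹ * (1 + (z / t) ^ 2)⁻¹ := by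
    intro z; unfold pk; field_simp
  rw [← ofReal_integral_eq_lintegral_ofReal]
  · congr 1
    simp_rw [h1]
    rw [integral_const_mul, Measure.integral_comp_div (fun z => (1 + z ^ 2)⁻¹) t,
      integral_univ_inv_one_add_sq, abs_of_pos ht, smul_eq_mul]
    field_simp
  · have : Integrable (fun z : ℝ => t⁻¹ * (1 + (z / t) ^ 2)⁻¹) :=
      (integrable_inv_one_add_sq.comp_div ht.ne').const_mul _
    exact this.congr (Eventually.of_forall fun z => (h1 z).symm)
  · exact Eventually.of_forall fun z => pk_nonneg ht z

/-- Up to a constant, the Poisson kernel is dominated by its convolution with itself at the same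
height. -/
lemma pk_le_convolution {t : ℝ} (ht : 0 < t) (x y : ℝ) :
    ENNReal.ofReal (pk t (x - y)) ≤
      3 * ∫⁻ z, ENNReal.ofReal (pk t (x - z)) * ENNReal.ofReal (pk t (z - y)) := by
  have key : ∀ z ∈ Set.Icc (x - t) (x + t), ENNReal.ofReal (pk t (x - y) / (6 * t)) ≤
      ENNReal.ofReal (pk t (x - z)) * ENNReal.ofReal (pk t (z - y)) := by
    intro z hz
    rw [← ENNReal.ofReal_mul (pk_nonneg ht _)]
    apply ENNReal.ofReal_le_ofReal
    have h1 : 1 / (2 * t) ≤ pk t (x - z) := by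
      have := inv_le_two_mul_pk (u := x - z) ht (by rw [abs_le]; constructor <;> linarith [hz.1, hz.2])
      have h2 : 1 / (2 * t) = 1 / t / 2 := by field_simp
      rw [h2]; linarith
    have h2 : pk t (x - y) / 3 ≤ pk t (z - y) := by
      unfold pk
      rw [div_div]
      apply div_le_div_of_nonneg_left ht.le (by positivity)
      have : (z - x) ^ 2 ≤ t ^ 2 := by
        apply sq_le_sq' <;> linarith [hz.1, hz.2]
      nlinarith [sq_nonneg ((z - x) - (x - y))]
    calc pk t (x - y) / (6 * t) = 1 / (2 * t) * (pk t (x - y) / 3) := by field_simp; ring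
      _ ≤ _ := by
        apply mul_le_mul h1 h2 (by have := pk_nonneg ht (x - y); positivity) (pk_nonneg ht _)
  calc ENNReal.ofReal (pk t (x - y))
      = 3 * ∫⁻ z in Set.Icc (x - t) (x + t), ENNReal.ofReal (pk t (x - y) / (6 * t)) := by
        rw [setLIntegral_const, Real.volume_Icc, ← ENNReal.ofReal_mul (by
          have := pk_nonneg ht (x - y); positivity)]
        rw [show (3 : ℝ≥0∞) = ENNReal.ofReal 3 by norm_num, ← ENNReal.ofReal_mul (by norm_num)]
        congr 1
        field_simp
        ring
    _ ≤ 3 * ∫⁻ z in Set.Icc (x - t) (x + t),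
          ENNReal.ofReal (pk t (x - z)) * ENNReal.ofReal (pk t (z - y)) := by
        gcongr 3 * ?_
        exact setLIntegral_mono (by fun_prop) key
    _ ≤ _ := by gcongr 3 * ?_; exact setLIntegral_le_lintegral _ _

lemma lintegral_mul_le_sqrt_mul_sqrt {α : Type*} [MeasurableSpace α] (μ : Measure α)
    {f g : α → ℝ≥0∞} (hf : AEMeasurable f μ) (hg : AEMeasurable g μ) :
    ∫⁻ a, f a * g a ∂μ ≤ (∫⁻ a, f a ^ 2 ∂μ) ^ (1 / 2 : ℝ) * (∫⁻ a, g a ^ 2 ∂μ) ^ (1 / 2 : ℝ) := by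
  have := ENNReal.lintegral_mul_le_Lp_mul_Lq μ Real.HolderConjugate.two_two hf hg
  simpa using this

lemma sq_rpow_half (a : ℝ≥0∞) : (a ^ (1 / 2 : ℝ)) ^ 2 = a := by
  rw [← ENNReal.rpow_natCast, ← ENNReal.rpow_mul]; norm_num

/-- Cauchy-Schwarz for the Poisson extension of `G σ`. -/
lemma lintegral_pk_mul_le (σ : Measure ℝ) {G : ℝ → ℝ≥0∞} (hG : Measurable G)
    (t z : ℝ) : ∫⁻ y, ENNReal.ofReal (pk t (z - y)) * G y ∂σ ≤
      (∫⁻ y, ENNReal.ofReal (pk t (z - y)) ∂σ) ^ (1 / 2 : ℝ) *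
      (∫⁻ y, ENNReal.ofReal (pk t (z - y)) * G y ^ 2 ∂σ) ^ (1 / 2 : ℝ) := by
  set p : ℝ → ℝ≥0∞ := fun y => ENNReal.ofReal (pk t (z - y))
  have hp : Measurable p := by fun_prop
  have := lintegral_mul_le_sqrt_mul_sqrt σ (f := fun y => p y ^ (1 / 2 : ℝ))
    (g := fun y => p y ^ (1 / 2 : ℝ) * G y) (by fun_prop) (by fun_prop)
  simp_rw [mul_pow, sq_rpow_half, ← mul_assoc, ← sq, sq_rpow_half] at this
  exact this

lemma lintegral_pk_eq_poisson (σ : Measure ℝ) (t z : ℝ) :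
    ∫⁻ y, ENNReal.ofReal (pk t (z - y)) ∂σ = ENNReal.ofReal Real.pi * poisson σ z t := by
  unfold poisson
  rw [← lintegral_const_mul _ (by fun_prop)]
  congr 1; ext y
  rw [← ENNReal.ofReal_mul Real.pi_pos.le]
  congr 1
  unfold pk
  have := Real.pi_pos
  field_simp

lemma poisson_mul_le_A2 (σ w : Measure ℝ) {t : ℝ} (ht : 0 < t) (z : ℝ) :
    poisson w z t * poisson σ z t ≤ A2 σ w := by
  unfold A2
  exact le_iSup_of_le z (le_iSup_of_le t (le_iSup_of_le ht le_rfl))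

lemma lintegral_pk_mul_lintegral_pk_le (σ w : Measure ℝ) {t : ℝ} (ht : 0 < t) (z : ℝ) :
    (∫⁻ y, ENNReal.ofReal (pk t (z - y)) ∂σ) * (∫⁻ y, ENNReal.ofReal (pk t (z - y)) ∂w) ≤
      ENNReal.ofReal Real.pi ^ 2 * A2 σ w := by
  rw [lintegral_pk_eq_poisson, lintegral_pk_eq_poisson]
  calc _ = ENNReal.ofReal Real.pi ^ 2 * (poisson w z t * poisson σ z t) := by ring
    _ ≤ _ := by gcongr; exact poisson_mul_le_A2 σ w ht z

lemma lintegral_lintegral_pk_mul (σ : Measure ℝ) [SFinite σ] {G : ℝ → ℝ≥0∞} (hG : Measurable G)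
    {t : ℝ} (ht : 0 < t) :
    ∫⁻ z, ∫⁻ y, ENNReal.ofReal (pk t (z - y)) * G y ∂σ = ENNReal.ofReal Real.pi * ∫⁻ y, G y ∂σ := by
  rw [lintegral_lintegral_swap (by fun_prop), ← lintegral_const_mul _ hG]
  congr 1; ext y
  rw [lintegral_mul_const _ (by fun_prop),
    lintegral_sub_right_eq_self (fun z => ENNReal.ofReal (pk t z)) y, integral_pk ht]

/-- The Poisson kernel is replaced by its convolution with itself; then Cauchy--Schwarz on `σ` and
on `w` produces the product of the two Poisson extensions at the middle point `z`, hence `√A₂`, and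
the integral over `z` removes the remaining kernels. -/
lemma lintegral_pk_form_le_of_measurable (σ w : Measure ℝ) [SFinite σ] [SFinite w]
    {G H : ℝ → ℝ≥0∞} (hG : Measurable G) (hH : Measurable H) {t : ℝ} (ht : 0 < t) :
    ∫⁻ x, ∫⁻ y, ENNReal.ofReal (pk t (x - y)) * (G y * H x) ∂σ ∂w ≤
      (3 * ENNReal.ofReal Real.pi ^ 2) * A2 σ w ^ (1 / 2 : ℝ) *
        ((∫⁻ y, G y ^ 2 ∂σ) ^ (1 / 2 : ℝ) * (∫⁻ x, H x ^ 2 ∂w) ^ (1 / 2 : ℝ)) := by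
  set p : ℝ → ℝ≥0∞ := fun u => ENNReal.ofReal (pk t u) with hp_def
  have hp : Measurable p := by fun_prop
  have p_neg : ∀ u v, p (u - v) = p (v - u) := by
    intro u v; simp only [hp_def]; rw [← pk_neg, neg_sub]
  set U : ℝ → ℝ≥0∞ := fun z => ∫⁻ y, p (z - y) * G y ∂σ
  set V : ℝ → ℝ≥0∞ := fun z => ∫⁻ x, p (z - x) * H x ∂w
  set U2 : ℝ → ℝ≥0∞ := fun z => ∫⁻ y, p (z - y) * G y ^ 2 ∂σ
  set V2 : ℝ → ℝ≥0∞ := fun z => ∫⁻ x, p (z - x) * H x ^ 2 ∂w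
  have hU : Measurable U := Measurable.lintegral_prod_right' (f := fun q : ℝ × ℝ =>
    p (q.1 - q.2) * G q.2) (by fun_prop)
  have hU2 : Measurable U2 := Measurable.lintegral_prod_right' (f := fun q : ℝ × ℝ =>
    p (q.1 - q.2) * G q.2 ^ 2) (by fun_prop)
  have hV2 : Measurable V2 := Measurable.lintegral_prod_right' (f := fun q : ℝ × ℝ =>
    p (q.1 - q.2) * H q.2 ^ 2) (by fun_prop)
  have e1 : ∀ x, ∫⁻ y, p (x - y) * (G y * H x) ∂σ ≤ 3 * ∫⁻ z, p (x - z) * H x * U z := by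
    intro x
    calc ∫⁻ y, p (x - y) * (G y * H x) ∂σ
        ≤ ∫⁻ y, (∫⁻ z, 3 * (p (x - z) * H x * (p (z - y) * G y))) ∂σ := by
          apply lintegral_mono
          intro y
          calc p (x - y) * (G y * H x) ≤ (3 * ∫⁻ z, p (x - z) * p (z - y)) * (G y * H x) := by
                gcongr; exact pk_le_convolution ht x y
            _ = ∫⁻ z, 3 * (p (x - z) * H x * (p (z - y) * G y)) := by
                rw [mul_assoc, ← lintegral_mul_const _ (by fun_prop),
                  ← lintegral_const_mul _ (by fun_prop)]
                congr 1; ext z; ring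
      _ = ∫⁻ z, ∫⁻ y, 3 * (p (x - z) * H x * (p (z - y) * G y)) ∂σ :=
          lintegral_lintegral_swap (by fun_prop)
      _ = 3 * ∫⁻ z, p (x - z) * H x * U z := by
          rw [← lintegral_const_mul _ (by fun_prop)]
          congr 1; ext z
          rw [lintegral_const_mul _ (by fun_prop), lintegral_const_mul _ (by fun_prop)]
  have e2 : ∀ z, U z * V z ≤ (ENNReal.ofReal Real.pi * A2 σ w ^ (1 / 2 : ℝ)) *
      (U2 z ^ (1 / 2 : ℝ) * V2 z ^ (1 / 2 : ℝ)) := by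
    intro z
    have h1 := lintegral_pk_mul_le σ hG t z
    have h2 := lintegral_pk_mul_le w hH t z
    have h3 := ENNReal.rpow_le_rpow (lintegral_pk_mul_lintegral_pk_le σ w ht z)
      (z := (1 / 2 : ℝ)) (by norm_num)
    rw [ENNReal.mul_rpow_of_nonneg _ _ (by norm_num), ENNReal.mul_rpow_of_nonneg _ _ (by norm_num),
      ← ENNReal.rpow_natCast, ← ENNReal.rpow_mul] at h3
    norm_num at h3
    calc U z * V z ≤ _ := mul_le_mul' h1 h2
      _ = (∫⁻ y, p (z - y) ∂σ) ^ (1 / 2 : ℝ) * (∫⁻ y, p (z - y) ∂w) ^ (1 / 2 : ℝ) *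
          (U2 z ^ (1 / 2 : ℝ) * V2 z ^ (1 / 2 : ℝ)) := by
        simp only [U2, V2, p]; ring
      _ ≤ _ := by gcongr
  calc ∫⁻ x, ∫⁻ y, p (x - y) * (G y * H x) ∂σ ∂w
      ≤ ∫⁻ x, (∫⁻ z, 3 * (p (x - z) * H x * U z)) ∂w := by
        apply lintegral_mono
        intro x
        exact (e1 x).trans_eq (lintegral_const_mul _ (by fun_prop)).symm
    _ = ∫⁻ z, ∫⁻ x, 3 * (p (x - z) * H x * U z) ∂w := lintegral_lintegral_swap (by fun_prop)
    _ = ∫⁻ z, 3 * (U z * V z) := by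
        congr 1; ext z
        rw [lintegral_const_mul _ (by fun_prop), lintegral_mul_const _ (by fun_prop)]
        simp_rw [p_neg _ z]
        rw [mul_comm (U z)]
    _ ≤ ∫⁻ z, 3 * (ENNReal.ofReal Real.pi * A2 σ w ^ (1 / 2 : ℝ)) *
        (U2 z ^ (1 / 2 : ℝ) * V2 z ^ (1 / 2 : ℝ)) := by
        apply lintegral_mono
        intro z
        beta_reduce
        rw [mul_assoc 3]
        exact mul_le_mul_right (e2 z) 3
    _ = 3 * (ENNReal.ofReal Real.pi * A2 σ w ^ (1 / 2 : ℝ)) *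
        ∫⁻ z, (U2 z ^ (1 / 2 : ℝ) * V2 z ^ (1 / 2 : ℝ)) := lintegral_const_mul _ (by fun_prop)
    _ ≤ 3 * (ENNReal.ofReal Real.pi * A2 σ w ^ (1 / 2 : ℝ)) *
        ((∫⁻ z, U2 z) ^ (1 / 2 : ℝ) * (∫⁻ z, V2 z) ^ (1 / 2 : ℝ)) := by
        gcongr
        have := lintegral_mul_le_sqrt_mul_sqrt volume (f := fun z => U2 z ^ (1 / 2 : ℝ))
          (g := fun z => V2 z ^ (1 / 2 : ℝ)) (by fun_prop) (by fun_prop)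
        simpa only [sq_rpow_half] using this
    _ = _ := by
        rw [lintegral_lintegral_pk_mul σ (by fun_prop) ht, lintegral_lintegral_pk_mul w (by fun_prop) ht,
          ENNReal.mul_rpow_of_nonneg _ _ (by norm_num), ENNReal.mul_rpow_of_nonneg _ _ (by norm_num)]
        have : ENNReal.ofReal Real.pi ^ (1 / 2 : ℝ) * ENNReal.ofReal Real.pi ^ (1 / 2 : ℝ) =
          ENNReal.ofReal Real.pi := by rw [← sq, sq_rpow_half]
        calc _ = 3 * (ENNReal.ofReal Real.pi * A2 σ w ^ (1 / 2 : ℝ)) *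
            ((ENNReal.ofReal Real.pi ^ (1 / 2 : ℝ) * ENNReal.ofReal Real.pi ^ (1 / 2 : ℝ)) *
             ((∫⁻ y, G y ^ 2 ∂σ) ^ (1 / 2 : ℝ) * (∫⁻ x, H x ^ 2 ∂w) ^ (1 / 2 : ℝ))) := by ring
          _ = _ := by rw [this]; ring

/-- At every height `t`, the positive operator with the Poisson kernel is bounded from `L²(σ)` to
`L²(w)` with norm at most a constant times the square root of `A₂`. -/
lemma lintegral_pk_form_le (σ w : Measure ℝ) [SFinite σ] [SFinite w]
    {G H : ℝ → ℝ≥0∞} (hG : AEMeasurable G σ) (hH : AEMeasurable H w) {t : ℝ} (ht : 0 < t) :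
    ∫⁻ x, ∫⁻ y, ENNReal.ofReal (pk t (x - y)) * (G y * H x) ∂σ ∂w ≤
      30 * A2 σ w ^ (1 / 2 : ℝ) *
        ((∫⁻ y, G y ^ 2 ∂σ) ^ (1 / 2 : ℝ) * (∫⁻ x, H x ^ 2 ∂w) ^ (1 / 2 : ℝ)) := by
  have h := lintegral_pk_form_le_of_measurable σ w hG.measurable_mk hH.measurable_mk ht
  have eG : ∫⁻ y, hG.mk G y ^ 2 ∂σ = ∫⁻ y, G y ^ 2 ∂σ :=
    lintegral_congr_ae (hG.ae_eq_mk.mono fun y hy => by simp only [hy])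
  have eH : ∫⁻ y, hH.mk H y ^ 2 ∂w = ∫⁻ y, H y ^ 2 ∂w :=
    lintegral_congr_ae (hH.ae_eq_mk.mono fun y hy => by simp only [hy])
  rw [eG, eH] at h
  have hpi : (3 * ENNReal.ofReal Real.pi ^ 2) ≤ 30 := by
    rw [← ENNReal.ofReal_pow Real.pi_pos.le, show (3 : ℝ≥0∞) = ENNReal.ofReal 3 by norm_num,
      ← ENNReal.ofReal_mul (by norm_num), show (30 : ℝ≥0∞) = ENNReal.ofReal 30 by norm_num]
    apply ENNReal.ofReal_le_ofReal
    nlinarith [Real.pi_lt_d2, Real.pi_pos]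
  calc _ = ∫⁻ x, ∫⁻ y, ENNReal.ofReal (pk t (x - y)) * (hG.mk G y * hH.mk H x) ∂σ ∂w := by
        refine lintegral_congr_ae (hH.ae_eq_mk.mono fun x hx => ?_)
        refine lintegral_congr_ae (hG.ae_eq_mk.mono fun y hy => ?_)
        simp only [hx, hy]
    _ ≤ _ := h
    _ ≤ _ := by gcongr

/-! ### Bilinear forms with kernels -/

/-- The bilinear form `∬ k(x, y) g(y) h(x) dσ(y) dw(x)`, as an integral over the product. -/
noncomputable def bform (k : ℝ → ℝ → ℝ) (σ w : Measure ℝ) (g h : ℝ → ℝ) : ℝ :=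
  ∫ z, k z.1 z.2 * (g z.2 * h z.1) ∂(w.prod σ)

/-- The `L²(μ)` norm as a real number, meaningful for square integrable functions. -/
noncomputable def l2 (μ : Measure ℝ) (g : ℝ → ℝ) : ℝ := √(∫ x, g x ^ 2 ∂μ)

lemma l2_nonneg (μ : Measure ℝ) (g : ℝ → ℝ) : 0 ≤ l2 μ g := Real.sqrt_nonneg _

lemma l2_sq (μ : Measure ℝ) (g : ℝ → ℝ) : l2 μ g ^ 2 = ∫ x, g x ^ 2 ∂μ :=
  Real.sq_sqrt (integral_nonneg fun _ => sq_nonneg _)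

lemma l2_abs (μ : Measure ℝ) (g : ℝ → ℝ) : l2 μ (fun x => |g x|) = l2 μ g := by
  simp [l2]

lemma lintegral_enorm_sq_eq {μ : Measure ℝ} {g : ℝ → ℝ} (hg : MemLp g 2 μ) :
    (∫⁻ x, ‖g x‖ₑ ^ 2 ∂μ) ^ (1 / 2 : ℝ) = ENNReal.ofReal (l2 μ g) := by
  have h1 : ∫⁻ x, ‖g x‖ₑ ^ 2 ∂μ = ENNReal.ofReal (∫ x, g x ^ 2 ∂μ) := by
    rw [ofReal_integral_eq_lintegral_ofReal hg.integrable_sq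
      (Eventually.of_forall fun x => sq_nonneg _)]
    congr 1; ext x
    rw [← ofReal_norm, ← ENNReal.ofReal_pow (norm_nonneg _), Real.norm_eq_abs, sq_abs]
  rw [h1, l2, Real.sqrt_eq_rpow, ENNReal.ofReal_rpow_of_nonneg
    (integral_nonneg fun _ => sq_nonneg _) (by norm_num)]

lemma eLpNorm_two_eq {μ : Measure ℝ} {g : ℝ → ℝ} (hg : MemLp g 2 μ) :
    eLpNorm g 2 μ = ENNReal.ofReal (l2 μ g) := by
  rw [← lintegral_enorm_sq_eq hg, eLpNorm_eq_lintegral_rpow_enorm_toReal (by norm_num) (by norm_num)]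
  simp

/-- The square root of `A₂` as a real number. -/
noncomputable def rootA2 (σ w : Measure ℝ) : ℝ := (A2 σ w ^ (1 / 2 : ℝ)).toReal

lemma rootA2_nonneg (σ w : Measure ℝ) : 0 ≤ rootA2 σ w := ENNReal.toReal_nonneg

lemma A2_comm (σ w : Measure ℝ) : A2 σ w = A2 w σ := by
  unfold A2; simp_rw [mul_comm (poisson w _ _)]

lemma rootA2_comm (σ w : Measure ℝ) : rootA2 σ w = rootA2 w σ := by
  unfold rootA2; rw [A2_comm]

lemma ofReal_rootA2 {σ w : Measure ℝ} (hA : A2 σ w ≠ ∞) :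
    ENNReal.ofReal (rootA2 σ w) = A2 σ w ^ (1 / 2 : ℝ) :=
  ENNReal.ofReal_toReal (ENNReal.rpow_ne_top_of_nonneg (by norm_num) hA)

lemma aestronglyMeasurable_form {σ w : Measure ℝ} [SFinite σ] {k : ℝ → ℝ → ℝ}
    (hk : Measurable (Function.uncurry k))
    {g h : ℝ → ℝ} (hg : AEStronglyMeasurable g σ) (hh : AEStronglyMeasurable h w) :
    AEStronglyMeasurable (fun z : ℝ × ℝ => k z.1 z.2 * (g z.2 * h z.1)) (w.prod σ) :=
  hk.aestronglyMeasurable.mul (hg.comp_snd.mul hh.comp_fst)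

variable {σ w : Measure ℝ} [IsLocallyFiniteMeasure σ] [IsLocallyFiniteMeasure w]

lemma lintegral_form_le (hA : A2 σ w ≠ ∞) {k : ℝ → ℝ → ℝ}
    (hk : Measurable (Function.uncurry k)) {g h : ℝ → ℝ} (hg : MemLp g 2 σ) (hh : MemLp h 2 w)
    {M t : ℝ} (hM : 0 ≤ M) (ht : 0 < t)
    (hb : ∀ x y, g y ≠ 0 → h x ≠ 0 → |k x y| ≤ M * pk t (x - y)) :
    ∫⁻ z, ‖k z.1 z.2 * (g z.2 * h z.1)‖ₑ ∂(w.prod σ) ≤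
      ENNReal.ofReal (M * (30 * rootA2 σ w) * (l2 σ g * l2 w h)) := by
  rw [lintegral_prod _ (aestronglyMeasurable_form hk hg.1 hh.1).enorm]
  have h1 := lintegral_pk_form_le σ w hg.1.enorm hh.1.enorm ht
  rw [lintegral_enorm_sq_eq hg, lintegral_enorm_sq_eq hh, ← ofReal_rootA2 hA] at h1
  calc _ ≤ ∫⁻ x, ∫⁻ y, ENNReal.ofReal M *
        (ENNReal.ofReal (pk t (x - y)) * (‖g y‖ₑ * ‖h x‖ₑ)) ∂σ ∂w := by
        apply lintegral_mono
        intro x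
        apply lintegral_mono
        intro y
        simp only
        rw [enorm_mul, enorm_mul, ← mul_assoc (ENNReal.ofReal M), ← ENNReal.ofReal_mul hM]
        by_cases h0 : g y = 0
        · simp [h0]
        by_cases h0' : h x = 0
        · simp [h0']
        gcongr
        rw [Real.enorm_eq_ofReal_abs]
        exact ENNReal.ofReal_le_ofReal (hb x y h0 h0')
    _ = ENNReal.ofReal M *
        ∫⁻ x, ∫⁻ y, (ENNReal.ofReal (pk t (x - y)) * (‖g y‖ₑ * ‖h x‖ₑ)) ∂σ ∂w := by
        rw [← lintegral_const_mul' _ _ ENNReal.ofReal_ne_top]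
        congr 1; ext x
        rw [← lintegral_const_mul' _ _ ENNReal.ofReal_ne_top]
    _ ≤ ENNReal.ofReal M * (30 * ENNReal.ofReal (rootA2 σ w) *
        (ENNReal.ofReal (l2 σ g) * ENNReal.ofReal (l2 w h))) := by gcongr
    _ = _ := by
      rw [show (30 : ℝ≥0∞) = ENNReal.ofReal 30 by norm_num, ← ENNReal.ofReal_mul (by norm_num),
        ← ENNReal.ofReal_mul (l2_nonneg _ _), ← ENNReal.ofReal_mul (by
          have := rootA2_nonneg σ w; positivity), ← ENNReal.ofReal_mul hM]
      ring_nf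

/-- A kernel dominated by a Poisson kernel has an absolutely convergent form. -/
lemma integrable_form (hA : A2 σ w ≠ ∞) {k : ℝ → ℝ → ℝ}
    (hk : Measurable (Function.uncurry k)) {g h : ℝ → ℝ} (hg : MemLp g 2 σ) (hh : MemLp h 2 w)
    {M t : ℝ} (hM : 0 ≤ M) (ht : 0 < t)
    (hb : ∀ x y, g y ≠ 0 → h x ≠ 0 → |k x y| ≤ M * pk t (x - y)) :
    Integrable (fun z : ℝ × ℝ => k z.1 z.2 * (g z.2 * h z.1)) (w.prod σ) :=
  ⟨aestronglyMeasurable_form hk hg.1 hh.1,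
    (lintegral_form_le hA hk hg hh hM ht hb).trans_lt ENNReal.ofReal_lt_top⟩

/-- A kernel dominated by a Poisson kernel has a form bounded by the square root of `A₂`. The
domination is only needed where the two functions do not vanish. -/
lemma abs_bform_le (hA : A2 σ w ≠ ∞) {k : ℝ → ℝ → ℝ}
    (hk : Measurable (Function.uncurry k)) {g h : ℝ → ℝ} (hg : MemLp g 2 σ) (hh : MemLp h 2 w)
    {M t : ℝ} (hM : 0 ≤ M) (ht : 0 < t)
    (hb : ∀ x y, g y ≠ 0 → h x ≠ 0 → |k x y| ≤ M * pk t (x - y)) :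
    |bform k σ w g h| ≤ M * (30 * rootA2 σ w) * (l2 σ g * l2 w h) := by
  have h1 := lintegral_form_le hA hk hg hh hM ht hb
  have h2 := enorm_integral_le_lintegral_enorm (μ := w.prod σ)
    (fun z : ℝ × ℝ => k z.1 z.2 * (g z.2 * h z.1))
  have h3 := h2.trans h1
  rw [Real.enorm_eq_ofReal_abs] at h3
  exact (ENNReal.ofReal_le_ofReal_iff (by
    have := rootA2_nonneg σ w; have := l2_nonneg σ g; have := l2_nonneg w h; positivity)).1 h3

/-! ### Intervals and dyadic grids -/

namespace Itv

instance : Nonempty Itv := ⟨⟨0, 1, one_pos⟩⟩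

lemma len_pos (I : Itv) : 0 < I.len := by have := I.lt; unfold len; linarith

lemma left_mem (I : Itv) : I.left ∈ I.toSet := ⟨le_rfl, I.lt⟩

lemma minus_len (I : Itv) : I.minus.len = I.len / 2 := by simp only [len, minus, mid]; ring

lemma plus_len (I : Itv) : I.plus.len = I.len / 2 := by simp only [len, plus, mid]; ring

lemma subset_iff {I J : Itv} : I.toSet ⊆ J.toSet ↔ J.left ≤ I.left ∧ I.right ≤ J.right :=
  Set.Ico_subset_Ico_iff I.lt

lemma minus_subset (I : Itv) : I.minus.toSet ⊆ I.toSet := by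
  rw [subset_iff]; have := I.lt; simp only [minus, mid]; constructor <;> linarith

lemma plus_subset (I : Itv) : I.plus.toSet ⊆ I.toSet := by
  rw [subset_iff]; have := I.lt; simp only [plus, mid]; constructor <;> linarith

lemma disjoint_minus_plus (I : Itv) : Disjoint I.minus.toSet I.plus.toSet :=
  Set.disjoint_left.2 fun _ hx hx' => absurd hx.2 (not_lt.2 hx'.1)

lemma minus_union_plus (I : Itv) : I.minus.toSet ∪ I.plus.toSet = I.toSet := by
  exact Set.Ico_union_Ico_eq_Ico I.minus.lt.le I.plus.lt.le

lemma len_le_of_subset {I J : Itv} (h : I.toSet ⊆ J.toSet) : I.len ≤ J.len := by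
  rw [subset_iff] at h; unfold len; linarith

lemma eq_of_subset_of_len_le {I J : Itv} (h : I.toSet ⊆ J.toSet) (hl : J.len ≤ I.len) : I = J := by
  rw [subset_iff] at h; unfold len at hl
  ext <;> linarith

lemma measurableSet_toSet (I : Itv) : MeasurableSet I.toSet := measurableSet_Ico

@[fun_prop] lemma measurable_ind (I : Itv) : Measurable I.ind :=
  measurable_const.indicator I.measurableSet_toSet

lemma ind_of_mem {I : Itv} {x : ℝ} (h : x ∈ I.toSet) : I.ind x = 1 := Set.indicator_of_mem h _

lemma ind_of_notMem {I : Itv} {x : ℝ} (h : x ∉ I.toSet) : I.ind x = 0 :=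
  Set.indicator_of_notMem h _

lemma measure_lt_top (I : Itv) (μ : Measure ℝ) [IsLocallyFiniteMeasure μ] : μ I.toSet < ∞ :=
  measure_Ico_lt_top

lemma childAt_eq_or (I J : Itv) : I.childAt J = I.minus ∨ I.childAt J = I.plus := by
  unfold childAt; split_ifs <;> simp

lemma childAt_len (I J : Itv) : (I.childAt J).len = I.len / 2 := by
  rcases I.childAt_eq_or J with h | h <;> rw [h]
  exacts [I.minus_len, I.plus_len]

lemma childAt_subset (I J : Itv) : (I.childAt J).toSet ⊆ I.toSet := by
  rcases I.childAt_eq_or J with h | h <;> rw [h]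
  exacts [I.minus_subset, I.plus_subset]

/-- A child containing a point of an interval `J` is the child at `J`, once `J` is known to lie in
one of the two children. -/
lemma childAt_eq {I J K : Itv} (hK : K = I.minus ∨ K = I.plus) (h : J.toSet ⊆ K.toSet) :
    I.childAt J = K := by
  unfold childAt
  rcases hK with rfl | rfl
  · rw [if_pos h]
  · rw [if_neg]
    intro h'
    exact Set.disjoint_left.1 I.disjoint_minus_plus (h' J.left_mem) (h J.left_mem)

lemma endpoints_childAt_mem (I J : Itv) :
    (I.childAt J).left ∈ ({I.left, I.mid, I.right} : Set ℝ) ∧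
    (I.childAt J).right ∈ ({I.left, I.mid, I.right} : Set ℝ) := by
  rcases I.childAt_eq_or J with h | h <;> rw [h] <;> simp [minus, plus]

lemma le_abs_sub_of_notMem {K : Itv} {x y c : ℝ} (hx : x ∈ K.toSet) (hy : y ∉ K.toSet)
    (hl : c ≤ |x - K.left|) (hr : c ≤ |x - K.right|) : c ≤ |x - y| := by
  have h1 := hx.1
  have h2 := hx.2
  rw [abs_of_nonneg (by linarith)] at hl
  rw [abs_of_nonpos (by linarith)] at hr
  rcases lt_or_ge y K.left with h | h
  · rw [abs_of_nonneg] <;> linarith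
  · have h3 : K.right ≤ y := by
      by_contra h'
      exact hy ⟨h, not_le.1 h'⟩
    rw [abs_of_nonpos] <;> linarith

lemma le_abs_sub_of_notMem' {K : Itv} {x y c : ℝ} (hx : x ∉ K.toSet) (hy : y ∈ K.toSet)
    (hl : c ≤ |x - K.left|) (hr : c ≤ |x - K.right|) : c ≤ |x - y| := by
  have h1 := hy.1
  have h2 := hy.2
  rcases lt_or_ge x K.left with h | h
  · rw [abs_of_nonpos (by linarith)] at hl ⊢; linarith
  · have h3 : K.right ≤ x := by
      by_contra h'
      exact hx ⟨h, not_le.1 h'⟩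
    rw [abs_of_nonneg (by linarith)] at hr ⊢; linarith

end Itv

open Itv

/-- A numbering of the generations of a grid: intervals of level `n` have length `2 ^ n * ℓ`, and
every level is inhabited. -/
structure IsLevel (D : Set Itv) (ℓ : ℝ) (lev : Itv → ℤ) : Prop where
  pos : 0 < ℓ
  len_eq : ∀ I ∈ D, I.len = 2 ^ lev I * ℓ
  exists_len : ∀ m : ℤ, ∃ I ∈ D, I.len = 2 ^ m * ℓ

section Grid

variable {D : Set Itv} (hD : IsDyadicGrid D)
include hD

lemma IsDyadicGrid.subset_or_disjoint {I J : Itv} (hI : I ∈ D) (hJ : J ∈ D) (h : J.len ≤ I.len) :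
    J.toSet ⊆ I.toSet ∨ Disjoint J.toSet I.toSet := by
  rcases hD.nested I hI J hJ with h1 | h1 | h1
  · exact Or.inr h1.symm
  · left; rw [eq_of_subset_of_len_le h1 h]
  · exact Or.inl h1

lemma IsDyadicGrid.subset_of_mem {I J : Itv} (hI : I ∈ D) (hJ : J ∈ D) (h : J.len ≤ I.len) {x : ℝ}
    (hxI : x ∈ I.toSet) (hxJ : x ∈ J.toSet) : J.toSet ⊆ I.toSet :=
  (hD.subset_or_disjoint hI hJ h).resolve_right fun h' => Set.disjoint_left.1 h' hxJ hxI

lemma IsDyadicGrid.eq_of_mem {I J : Itv} (hI : I ∈ D) (hJ : J ∈ D) (h : J.len = I.len) {x : ℝ}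
    (hxI : x ∈ I.toSet) (hxJ : x ∈ J.toSet) : J = I :=
  eq_of_subset_of_len_le (hD.subset_of_mem hI hJ h.le hxI hxJ) h.ge

lemma IsDyadicGrid.subset_child {I J : Itv} (hI : I ∈ D) (hJ : J ∈ D) (h : J.toSet ⊆ I.toSet)
    (hl : J.len < I.len) : J.toSet ⊆ I.minus.toSet ∨ J.toSet ⊆ I.plus.toSet := by
  have hu := I.minus_union_plus
  have hsub : J.toSet ⊆ I.minus.toSet ∪ I.plus.toSet := hu ▸ h
  rcases hD.nested _ (hD.minus_mem I hI) J hJ with h1 | h1 | h1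
  · right
    intro x hx
    exact (hsub hx).resolve_left fun h' => Set.disjoint_left.1 h1 h' hx
  · rcases hD.nested _ (hD.plus_mem I hI) J hJ with h2 | h2 | h2
    · left
      intro x hx
      exact (hsub hx).resolve_right fun h' => Set.disjoint_left.1 h2 h' hx
    · exfalso
      have : I.toSet ⊆ J.toSet := hu ▸ Set.union_subset h1 h2
      exact absurd (len_le_of_subset this) (not_le.2 hl)
    · exact Or.inr h2
  · exact Or.inl h1

lemma IsDyadicGrid.subset_childAt {I J : Itv} (hI : I ∈ D) (hJ : J ∈ D) (h : J.toSet ⊆ I.toSet)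
    (hl : J.len < I.len) : J.toSet ⊆ (I.childAt J).toSet := by
  rcases hD.subset_child hI hJ h hl with h1 | h1
  · rwa [childAt_eq (Or.inl rfl) h1]
  · rwa [childAt_eq (Or.inr rfl) h1]

lemma IsDyadicGrid.childAt_mem {I : Itv} (hI : I ∈ D) (J : Itv) : I.childAt J ∈ D := by
  rcases I.childAt_eq_or J with h | h <;> rw [h]
  exacts [hD.minus_mem I hI, hD.plus_mem I hI]

lemma IsDyadicGrid.exists_parent {I : Itv} (hI : I ∈ D) :
    ∃ I' ∈ D, (I = I'.minus ∨ I = I'.plus) ∧ I'.len = 2 * I.len := by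
  obtain ⟨I', h1, h2⟩ := hD.parent I hI
  refine ⟨I', h1, h2, ?_⟩
  rcases h2 with rfl | rfl
  · rw [minus_len]; ring
  · rw [plus_len]; ring

lemma IsDyadicGrid.exists_descendant {I : Itv} (hI : I ∈ D) (n : ℕ) :
    ∃ K ∈ D, K.len = I.len / 2 ^ n := by
  induction n with
  | zero => exact ⟨I, hI, by simp⟩
  | succ n ih =>
    obtain ⟨K, h1, h2⟩ := ih
    exact ⟨K.minus, hD.minus_mem K h1, by rw [minus_len, h2, pow_succ]; field_simp⟩

lemma IsDyadicGrid.exists_ancestor {I : Itv} (hI : I ∈ D) (n : ℕ) :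
    ∃ K ∈ D, K.len = I.len * 2 ^ n := by
  induction n with
  | zero => exact ⟨I, hI, by simp⟩
  | succ n ih =>
    obtain ⟨K, h1, h2⟩ := ih
    obtain ⟨K', h3, -, h4⟩ := hD.exists_parent h1
    exact ⟨K', h3, by rw [h4, h2]; ring⟩

lemma IsDyadicGrid.exists_zpow {I : Itv} (hI : I ∈ D) (m : ℤ) :
    ∃ K ∈ D, K.len = 2 ^ m * I.len := by
  rcases Int.le_total 0 m with h | h
  · lift m to ℕ using h
    obtain ⟨K, h1, h2⟩ := hD.exists_ancestor hI m
    exact ⟨K, h1, by rw [h2, zpow_natCast, mul_comm]⟩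
  · obtain ⟨n, rfl⟩ := Int.exists_eq_neg_ofNat h
    obtain ⟨K, h1, h2⟩ := hD.exists_descendant hI n
    exact ⟨K, h1, by rw [h2, zpow_neg, zpow_natCast, div_eq_inv_mul]⟩

/-- The grid interval of a given occurring length through a given point. -/
lemma IsDyadicGrid.exists_mem {I : Itv} (hI : I ∈ D) (x : ℝ) :
    ∃ K ∈ D, K.len = I.len ∧ x ∈ K.toSet := by
  obtain ⟨K, ⟨h1, h2, h3⟩, -⟩ := hD.partition I hI x
  exact ⟨K, h1, h2, h3⟩

lemma IsDyadicGrid.exists_right_neighbour {I : Itv} (hI : I ∈ D) :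
    ∃ R ∈ D, R.len = I.len ∧ R.left = I.right := by
  obtain ⟨R, h1, h2, h3⟩ := hD.exists_mem hI I.right
  refine ⟨R, h1, h2, le_antisymm h3.1 ?_⟩
  by_contra h
  push Not at h
  -- otherwise `R` and `I` share the point `max R.left I.left`
  have hm : max R.left I.left ∈ I.toSet := ⟨le_max_right _ _, max_lt h I.lt⟩
  have hm' : max R.left I.left ∈ R.toSet :=
    ⟨le_max_left _ _, (max_lt h I.lt).trans h3.2⟩
  have := hD.eq_of_mem hI h1 h2 hm hm'
  subst this
  exact lt_irrefl _ h3.2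

lemma IsDyadicGrid.exists_left_neighbour {I : Itv} (hI : I ∈ D) :
    ∃ L ∈ D, L.len = I.len ∧ L.right = I.left := by
  obtain ⟨L, h1, h2, h3⟩ := hD.exists_mem hI (I.left - I.len)
  obtain ⟨R, h4, h5, h6⟩ := hD.exists_right_neighbour h1
  have hpos := I.len_pos
  have hL : L.right ≤ I.left := by
    by_contra h
    push Not at h
    have := hD.eq_of_mem hI h1 h2 I.left_mem ⟨by linarith [h3.1], h⟩
    subst this
    linarith [h3.1]
  have hRI : R = I := by
    refine hD.eq_of_mem hI h4 (h5.trans h2) I.left_mem ⟨h6 ▸ hL, ?_⟩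
    have : R.right = R.left + L.len := by rw [← h5]; unfold len; ring
    rw [this, h6, h2]
    linarith [h3.2]
  exact ⟨L, h1, h2, by rw [← h6, hRI]⟩

lemma IsDyadicGrid.len_eq_of_lt_two_mul {I J : Itv} (hI : I ∈ D) (hJ : J ∈ D)
    (h1 : I.len ≤ J.len) (h2 : J.len < 2 * I.len) : J.len = I.len := by
  by_contra hne
  have hlt : I.len < J.len := lt_of_le_of_ne h1 (Ne.symm hne)
  obtain ⟨A, hA, hAl, hAm⟩ := hD.exists_mem hI J.left
  have hAJ : A.toSet ⊆ J.toSet := hD.subset_of_mem hJ hA (by rw [hAl]; exact h1) J.left_mem hAm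
  have hA0 : A.left = J.left := le_antisymm hAm.1 (subset_iff.1 hAJ).1
  obtain ⟨R, hR, hRl, hRm⟩ := hD.exists_right_neighbour hA
  have hRJ : R.toSet ⊆ J.toSet := by
    refine hD.subset_of_mem hJ hR (by rw [hRl, hAl]; exact h1) (x := R.left) ⟨?_, ?_⟩ R.left_mem
    · rw [hRm, ← hA0]; exact A.lt.le
    · rw [hRm]; unfold len at *; linarith
  have := (subset_iff.1 hRJ).2
  unfold len at *; linarith

/-- Grid intervals whose lengths differ by a factor less than `2` are equally long, so every length
in the grid is a power of `2` times that of a fixed interval. -/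
lemma IsDyadicGrid.exists_isLevel : ∃ ℓ lev, IsLevel D ℓ lev := by
  obtain ⟨I₀, h0⟩ := hD.nonempty
  have key : ∀ I ∈ D, ∃ m : ℤ, I.len = 2 ^ m * I₀.len := by
    intro I hI
    obtain ⟨m, hm⟩ := exists_mem_Ico_zpow (x := I.len / I₀.len) (y := (2 : ℝ))
      (div_pos I.len_pos I₀.len_pos) (by norm_num)
    obtain ⟨K, hK, hKl⟩ := hD.exists_zpow h0 m
    have hp := I₀.len_pos
    refine ⟨m, ?_⟩
    rw [← hKl]
    apply hD.len_eq_of_lt_two_mul hK hI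
    · rw [hKl]; exact (le_div_iff₀ hp).1 hm.1
    · rw [hKl, ← mul_assoc, ← zpow_one_add₀ (by norm_num), add_comm]
      exact (div_lt_iff₀ hp).1 hm.2
  choose! lev hlev using key
  exact ⟨I₀.len, lev, I₀.len_pos, hlev, fun m => hD.exists_zpow h0 m⟩

end Grid

section Level

variable {D : Set Itv} {ℓ : ℝ} {lev : Itv → ℤ} (hL : IsLevel D ℓ lev)
include hL

lemma IsLevel.pow_mul_len_le_iff {I J : Itv} (hI : I ∈ D) (hJ : J ∈ D) (n : ℕ) :
    2 ^ n * J.len ≤ I.len ↔ lev J + n ≤ lev I := by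
  rw [hL.len_eq I hI, hL.len_eq J hJ, ← mul_assoc, mul_le_mul_iff_left₀ hL.pos,
    ← zpow_natCast, ← zpow_add₀ (by norm_num), zpow_le_zpow_iff_right₀ (by norm_num), add_comm]

lemma IsLevel.len_le_pow_mul_iff {I J : Itv} (hI : I ∈ D) (hJ : J ∈ D) (n : ℕ) :
    J.len ≤ 2 ^ n * I.len ↔ lev J ≤ lev I + n := by
  rw [hL.len_eq I hI, hL.len_eq J hJ, ← mul_assoc, mul_le_mul_iff_left₀ hL.pos,
    ← zpow_natCast, ← zpow_add₀ (by norm_num), zpow_le_zpow_iff_right₀ (by norm_num), add_comm]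

lemma IsLevel.len_le_iff {I J : Itv} (hI : I ∈ D) (hJ : J ∈ D) :
    J.len ≤ I.len ↔ lev J ≤ lev I := by
  simpa using hL.pow_mul_len_le_iff hI hJ 0

lemma IsLevel.len_lt_iff {I J : Itv} (hI : I ∈ D) (hJ : J ∈ D) :
    J.len < I.len ↔ lev J < lev I := by
  rw [← not_le, ← not_le, hL.len_le_iff hJ hI]

lemma IsLevel.len_eq_iff {I J : Itv} (hI : I ∈ D) (hJ : J ∈ D) :
    J.len = I.len ↔ lev J = lev I := by
  rw [le_antisymm_iff, le_antisymm_iff, hL.len_le_iff hI hJ, hL.len_le_iff hJ hI]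

lemma IsLevel.two_mul_len_le {I J : Itv} (hI : I ∈ D) (hJ : J ∈ D) (h : J.len < I.len) :
    2 * J.len ≤ I.len := by
  have h1 := (hL.len_lt_iff hI hJ).1 h
  have := (hL.pow_mul_len_le_iff hI hJ 1).2 (by push_cast; omega)
  simpa using this

lemma IsLevel.pow_succ_mul_len_le {I J : Itv} (hI : I ∈ D) (hJ : J ∈ D) {n : ℕ}
    (h : 2 ^ n * J.len < I.len) : 2 ^ (n + 1) * J.len ≤ I.len := by
  rw [hL.pow_mul_len_le_iff hI hJ]
  have : ¬ lev I ≤ lev J + n := by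
    rw [← hL.len_le_pow_mul_iff hJ hI]; exact not_le.2 h
  push_cast; omega

lemma IsLevel.lev_minus (hD : IsDyadicGrid D) {I : Itv} (hI : I ∈ D) :
    lev I.minus = lev I - 1 := by
  have h := I.minus_len
  rw [hL.len_eq _ (hD.minus_mem I hI), hL.len_eq I hI] at h
  have h2 : (2 : ℝ) ^ lev I.minus = 2 ^ (lev I - 1) := by
    rw [zpow_sub_one₀ (by norm_num)]
    have := hL.pos
    field_simp at h ⊢
    linarith
  exact zpow_right_injective₀ (by norm_num) (by norm_num) h2

lemma IsLevel.lev_plus (hD : IsDyadicGrid D) {I : Itv} (hI : I ∈ D) :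
    lev I.plus = lev I - 1 := by
  rw [← hL.lev_minus hD hI, ← hL.len_eq_iff (hD.minus_mem I hI) (hD.plus_mem I hI), I.plus_len,
    I.minus_len]

/-- A geometric series: lengths in a chain of grid intervals. -/
lemma IsLevel.sum_len_le (hD : IsDyadicGrid D) {x q : ℝ} (hq : 0 ≤ q) (S : Finset Itv)
    (hS : ∀ I ∈ S, I ∈ D ∧ x ∈ I.toSet ∧ I.len ≤ q) : ∑ I ∈ S, I.len ≤ 2 * q := by
  classical
  induction hn : S.card generalizing S q with
  | zero => rw [Finset.card_eq_zero.1 hn]; simpa using hq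
  | succ n ih =>
    have hne : S.Nonempty := by rw [← Finset.card_pos]; omega
    obtain ⟨I, hIS, hmax⟩ := S.exists_max_image Itv.len hne
    rw [← Finset.add_sum_erase S _ hIS]
    have := ih (q := I.len / 2) (by have := I.len_pos; positivity) (S.erase I) ?_
      (by rw [Finset.card_erase_of_mem hIS]; omega)
    · linarith [(hS I hIS).2.2]
    · intro K hK
      obtain ⟨hKI, hKS⟩ := Finset.mem_erase.1 hK
      refine ⟨(hS K hKS).1, (hS K hKS).2.1, ?_⟩
      have hlt : K.len < I.len := lt_of_le_of_ne (hmax K hKS) fun h => hKI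
        (hD.eq_of_mem (hS I hIS).1 (hS K hKS).1 h (hS I hIS).2.1 (hS K hKS).2.1)
      have := hL.two_mul_len_le (hS I hIS).1 (hS K hKS).1 hlt
      linarith

end Level

/-- Counting disjoint intervals of equal length by Lebesgue measure. -/
lemma IsDyadicGrid.card_mul_le {D : Set Itv} (hD : IsDyadicGrid D) {c p q : ℝ} (hpq : p ≤ q)
    (S : Finset Itv) (hS : ∀ I ∈ S, I ∈ D ∧ I.len = c ∧ p ≤ I.left ∧ I.right ≤ q) :
    (S.card : ℝ) * c ≤ q - p := by
  have hdisj : (S : Set Itv).PairwiseDisjoint Itv.toSet := by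
    intro I hI J hJ hne
    refine Set.disjoint_left.2 fun x hx hx' => hne ?_
    exact hD.eq_of_mem (hS J hJ).1 (hS I hI).1 ((hS I hI).2.1.trans (hS J hJ).2.1.symm) hx' hx
  have h1 := measure_biUnion_finset (μ := volume) hdisj fun I _ => I.measurableSet_toSet
  have h2 : volume (⋃ I ∈ S, I.toSet) ≤ volume (Set.Ico p q) := by
    apply measure_mono
    refine Set.iUnion₂_subset fun I hI => ?_
    exact Set.Ico_subset_Ico (hS I hI).2.2.1 (hS I hI).2.2.2
  have h3 : ∀ I ∈ S, volume I.toSet = ENNReal.ofReal c := by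
    intro I hI
    rw [← (hS I hI).2.1]
    exact Real.volume_Ico
  rw [h1, Finset.sum_congr rfl h3, Finset.sum_const, Real.volume_Ico, nsmul_eq_mul,
    ← ENNReal.ofReal_natCast, ← ENNReal.ofReal_mul (by positivity)] at h2
  exact (ENNReal.ofReal_le_ofReal_iff (by linarith)).1 h2

section Good

variable {D : Set Itv} (hD : IsDyadicGrid D) {ε : ℝ} {r : ℕ}
include hD

/-- A good interval is far from the disjoint grid intervals that are much longer. This is goodness
with respect to the parent of the longer interval. -/
lemma IsGood.le_abs_sub_of_disjoint (hε : ε < 1) {I J : Itv} (hI : I ∈ D)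
    (hg : IsGood D ε r J) (hl : 2 ^ r * J.len ≤ I.len) (hdisj : Disjoint J.toSet I.toSet)
    {x y : ℝ} (hx : x ∈ J.toSet) (hy : y ∈ I.toSet) :
    J.len ^ ε * I.len ^ (1 - ε) ≤ |x - y| := by
  obtain ⟨P, hP, hIP, hPl⟩ := hD.exists_parent hI
  have h1 := hg P hP (by rw [hPl, pow_succ]; linarith)
  have hx' : x ∉ I.toSet := fun h => Set.disjoint_left.1 hdisj hx h
  have hpos := I.len_pos
  have h2 : J.len ^ ε * I.len ^ (1 - ε) ≤ J.len ^ ε * P.len ^ (1 - ε) := by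
    have := J.len_pos
    gcongr
    · rw [hPl]; linarith
  have h3 : I.left ∈ ({P.left, P.mid, P.right} : Set ℝ) ∧
      I.right ∈ ({P.left, P.mid, P.right} : Set ℝ) := by
    rcases hIP with rfl | rfl <;> simp [minus, plus]
  exact le_abs_sub_of_notMem' hx' hy (h2.trans (h1 _ h3.1 x hx)) (h2.trans (h1 _ h3.2 x hx))

/-- A good interval lies deep inside the children of its much longer ancestors. -/
lemma IsGood.le_abs_sub_of_subset {I J : Itv} (hI : I ∈ D) (hJ : J ∈ D)
    (hg : IsGood D ε r J) (hl : 2 ^ (r + 1) * J.len ≤ I.len) (hsub : J.toSet ⊆ I.toSet)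
    {x y : ℝ} (hx : x ∈ J.toSet) (hy : y ∉ (I.childAt J).toSet) :
    J.len ^ ε * I.len ^ (1 - ε) ≤ |x - y| := by
  have h1 := hg I hI hl
  have hlt : J.len < I.len := by
    have := J.len_pos
    have h2 : (2 : ℝ) ≤ 2 ^ (r + 1) := by
      rw [pow_succ]; have := one_le_pow₀ (M₀ := ℝ) (a := 2) (n := r) (by norm_num); linarith
    nlinarith
  have hx' := hD.subset_childAt hI hJ hsub hlt hx
  have h3 := I.endpoints_childAt_mem J
  exact le_abs_sub_of_notMem hx' hy (h1 _ h3.1 x hx) (h1 _ h3.2 x hx)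

end Good

/-! ### Linearity of the bilinear forms -/

/-- A measurable kernel that is dominated by a multiple of the Poisson kernel at height `t`. -/
structure PoissonDominated (k : ℝ → ℝ → ℝ) (M t : ℝ) : Prop where
  meas : Measurable (Function.uncurry k)
  nonneg : 0 ≤ M
  pos : 0 < t
  bound : ∀ x y, |k x y| ≤ M * pk t (x - y)

lemma PoissonDominated.flip {k : ℝ → ℝ → ℝ} {M t : ℝ} (hk : PoissonDominated k M t) :
    PoissonDominated (fun x y => k y x) M t :=
  ⟨hk.meas.comp measurable_swap, hk.nonneg, hk.pos, fun x y => by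
    have := hk.bound y x
    rwa [← pk_neg, neg_sub] at this⟩

lemma bform_flip (k : ℝ → ℝ → ℝ) (σ w : Measure ℝ) [SFinite σ] [SFinite w] (g h : ℝ → ℝ) :
    bform (fun x y => k y x) w σ h g = bform k σ w g h := by
  unfold bform
  rw [← integral_prod_swap]
  congr 1; ext z
  simp only [Prod.fst_swap, Prod.snd_swap]
  ring

lemma bform_const_mul_left (k : ℝ → ℝ → ℝ) (σ w : Measure ℝ) (c : ℝ) (g h : ℝ → ℝ) :
    bform k σ w (fun y => c * g y) h = c * bform k σ w g h := by
  unfold bform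
  rw [← integral_const_mul]
  congr 1; ext z; ring

lemma bform_const_mul_right (k : ℝ → ℝ → ℝ) (σ w : Measure ℝ) (c : ℝ) (g h : ℝ → ℝ) :
    bform k σ w g (fun y => c * h y) = c * bform k σ w g h := by
  unfold bform
  rw [← integral_const_mul]
  congr 1; ext z; ring

lemma bform_congr {k k' : ℝ → ℝ → ℝ} {σ w : Measure ℝ} {g g' h h' : ℝ → ℝ}
    (H : ∀ x y, k x y * (g y * h x) = k' x y * (g' y * h' x)) :
    bform k σ w g h = bform k' σ w g' h' := by
  unfold bform
  congr 1; ext z; exact H _ _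

section Linear

variable {σ w : Measure ℝ} [IsLocallyFiniteMeasure σ] [IsLocallyFiniteMeasure w]
  {k : ℝ → ℝ → ℝ} {M t : ℝ}

lemma PoissonDominated.integrable (hA : A2 σ w ≠ ∞) (hk : PoissonDominated k M t) {g h : ℝ → ℝ}
    (hg : MemLp g 2 σ) (hh : MemLp h 2 w) :
    Integrable (fun z : ℝ × ℝ => k z.1 z.2 * (g z.2 * h z.1)) (w.prod σ) :=
  integrable_form hA hk.meas hg hh hk.nonneg hk.pos fun x y _ _ => hk.bound x y

lemma PoissonDominated.abs_bform_le (hA : A2 σ w ≠ ∞) (hk : PoissonDominated k M t) {g h : ℝ → ℝ}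
    (hg : MemLp g 2 σ) (hh : MemLp h 2 w) :
    |bform k σ w g h| ≤ M * (30 * rootA2 σ w) * (l2 σ g * l2 w h) :=
  TwoWeight.abs_bform_le hA hk.meas hg hh hk.nonneg hk.pos fun x y _ _ => hk.bound x y

lemma PoissonDominated.bform_sum_left {ι : Type*} (hA : A2 σ w ≠ ∞) (hk : PoissonDominated k M t)
    (S : Finset ι) {g : ι → ℝ → ℝ} {h : ℝ → ℝ} (hg : ∀ i ∈ S, MemLp (g i) 2 σ) (hh : MemLp h 2 w) :
    bform k σ w (fun y => ∑ i ∈ S, g i y) h = ∑ i ∈ S, bform k σ w (g i) h := by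
  unfold bform
  rw [← integral_finsetSum _ fun i hi => hk.integrable hA (hg i hi) hh]
  congr 1; ext z
  rw [Finset.sum_mul, Finset.mul_sum]

lemma PoissonDominated.bform_sum_right {ι : Type*} (hA : A2 σ w ≠ ∞) (hk : PoissonDominated k M t)
    (S : Finset ι) {g : ℝ → ℝ} {h : ι → ℝ → ℝ} (hg : MemLp g 2 σ) (hh : ∀ i ∈ S, MemLp (h i) 2 w) :
    bform k σ w g (fun y => ∑ i ∈ S, h i y) = ∑ i ∈ S, bform k σ w g (h i) := by
  unfold bform
  rw [← integral_finsetSum _ fun i hi => hk.integrable hA hg (hh i hi)]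
  congr 1; ext z
  rw [Finset.mul_sum, Finset.mul_sum]

lemma PoissonDominated.bform_add_left (hA : A2 σ w ≠ ∞) (hk : PoissonDominated k M t)
    {g g' h : ℝ → ℝ} (hg : MemLp g 2 σ) (hg' : MemLp g' 2 σ) (hh : MemLp h 2 w) :
    bform k σ w (fun y => g y + g' y) h = bform k σ w g h + bform k σ w g' h := by
  unfold bform
  rw [← integral_add (hk.integrable hA hg hh) (hk.integrable hA hg' hh)]
  congr 1; ext z; ring

lemma PoissonDominated.bform_sub_left (hA : A2 σ w ≠ ∞) (hk : PoissonDominated k M t)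
    {g g' h : ℝ → ℝ} (hg : MemLp g 2 σ) (hg' : MemLp g' 2 σ) (hh : MemLp h 2 w) :
    bform k σ w (fun y => g y - g' y) h = bform k σ w g h - bform k σ w g' h := by
  unfold bform
  rw [← integral_sub (hk.integrable hA hg hh) (hk.integrable hA hg' hh)]
  congr 1; ext z; ring

lemma PoissonDominated.bform_sub_right (hA : A2 σ w ≠ ∞) (hk : PoissonDominated k M t)
    {g h h' : ℝ → ℝ} (hg : MemLp g 2 σ) (hh : MemLp h 2 w) (hh' : MemLp h' 2 w) :
    bform k σ w g (fun y => h y - h' y) = bform k σ w g h - bform k σ w g h' := by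
  unfold bform
  rw [← integral_sub (hk.integrable hA hg hh) (hk.integrable hA hg hh')]
  congr 1; ext z; ring

lemma bform_add_kernel (hA : A2 σ w ≠ ∞) (hk : PoissonDominated k M t) {k' : ℝ → ℝ → ℝ}
    {M' t' : ℝ} (hk' : PoissonDominated k' M' t')
    {g h : ℝ → ℝ} (hg : MemLp g 2 σ) (hh : MemLp h 2 w) :
    bform (fun x y => k x y + k' x y) σ w g h = bform k σ w g h + bform k' σ w g h := by
  unfold bform
  rw [← integral_add (hk.integrable hA hg hh) (hk'.integrable hA hg hh)]
  congr 1; ext z; ring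

end Linear

/-! ### Haar differences -/

section L2

variable {μ : Measure ℝ}

lemma l2_const_mul (c : ℝ) (g : ℝ → ℝ) : l2 μ (fun x => c * g x) = |c| * l2 μ g := by
  unfold l2
  simp_rw [mul_pow]
  rw [integral_const_mul, Real.sqrt_mul (sq_nonneg c), Real.sqrt_sq_eq_abs]

lemma integral_ind_sq (I : Itv) : ∫ x, I.ind x ^ 2 ∂μ = μ.real I.toSet := by
  have : ∀ x, I.ind x ^ 2 = I.toSet.indicator 1 x := by
    intro x
    by_cases h : x ∈ I.toSet
    · simp [ind_of_mem h, h]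
    · simp [ind_of_notMem h, h]
  simp_rw [this]
  rw [integral_indicator_one I.measurableSet_toSet]

lemma integral_ind (I : Itv) : ∫ x, I.ind x ∂μ = μ.real I.toSet :=
  integral_indicator_one I.measurableSet_toSet

lemma l2_ind (I : Itv) : l2 μ I.ind = √(μ.real I.toSet) := by rw [l2, integral_ind_sq]

lemma memLp_mul_ind {g : ℝ → ℝ} (hg : MemLp g 2 μ) (I : Itv) :
    MemLp (fun x => g x * I.ind x) 2 μ := by
  refine hg.mono (hg.1.mul I.measurable_ind.aestronglyMeasurable) (Eventually.of_forall fun x => ?_)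
  by_cases h : x ∈ I.toSet
  · simp [ind_of_mem h]
  · simp [ind_of_notMem h]

lemma memLp_ind [IsLocallyFiniteMeasure μ] (I : Itv) : MemLp I.ind 2 μ :=
  memLp_indicator_const 2 I.measurableSet_toSet 1 (Or.inr (I.measure_lt_top μ).ne)

end L2

/-- The average of `g` over the interval `K`, equal to `0` if `K` has no mass. -/
noncomputable def av (σ : Measure ℝ) (g : ℝ → ℝ) (K : Itv) : ℝ := ⨍ x in K.toSet, g x ∂σ

/-- `g` is a multiple of the Haar function of `I`: constant on the two halves, of mean zero, and
zero on a half without mass. -/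
def HaarStep (σ : Measure ℝ) (I : Itv) (g : ℝ → ℝ) : Prop :=
  ∃ a b : ℝ, (∀ x, g x = a * I.minus.ind x + b * I.plus.ind x) ∧
    a * σ.real I.minus.toSet + b * σ.real I.plus.toSet = 0 ∧
    (σ.real I.minus.toSet = 0 → a = 0) ∧ (σ.real I.plus.toSet = 0 → b = 0)

lemma average_const_on {σ : Measure ℝ} [IsLocallyFiniteMeasure σ] {g : ℝ → ℝ} {K : Itv} {a : ℝ}
    (h : ∀ x ∈ K.toSet, g x = a) (h0 : σ.real K.toSet = 0 → a = 0) : av σ g K = a := by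
  unfold av
  rw [setAverage_eq, setIntegral_congr_fun K.measurableSet_toSet h, setIntegral_const]
  by_cases hσ : σ.real K.toSet = 0
  · rw [h0 hσ]; simp
  · simp only [smul_eq_mul]; field_simp

section HaarStep

variable {σ : Measure ℝ} {I : Itv} {g : ℝ → ℝ}

lemma HaarStep.const_mul (hg : HaarStep σ I g) (c : ℝ) : HaarStep σ I (fun x => c * g x) := by
  obtain ⟨a, b, h1, h2, h3, h4⟩ := hg
  refine ⟨c * a, c * b, fun x => by simp only [h1]; ring, ?_, fun h => by rw [h3 h, mul_zero],
    fun h => by rw [h4 h, mul_zero]⟩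
  linear_combination c * h2

lemma HaarStep.eq_zero_of_notMem (hg : HaarStep σ I g) {x : ℝ} (hx : x ∉ I.toSet) : g x = 0 := by
  obtain ⟨a, b, h1, -⟩ := hg
  rw [h1, ind_of_notMem fun h => hx (I.minus_subset h),
    ind_of_notMem fun h => hx (I.plus_subset h)]
  ring

variable [IsLocallyFiniteMeasure σ]

/-- The value of a Haar difference on a child is its average there. -/
lemma HaarStep.eq_av (hg : HaarStep σ I g) {K : Itv} (hK : K = I.minus ∨ K = I.plus) {x : ℝ}
    (hx : x ∈ K.toSet) : g x = av σ g K := by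
  obtain ⟨a, b, h1, h2, h3, h4⟩ := hg
  have hm : ∀ x ∈ I.minus.toSet, g x = a := by
    intro x hx
    rw [h1, ind_of_mem hx, ind_of_notMem (Set.disjoint_left.1 I.disjoint_minus_plus hx)]; ring
  have hp : ∀ x ∈ I.plus.toSet, g x = b := by
    intro x hx
    rw [h1, ind_of_mem hx, ind_of_notMem (Set.disjoint_right.1 I.disjoint_minus_plus hx)]; ring
  rcases hK with rfl | rfl
  · rw [average_const_on hm h3, hm x hx]
  · rw [average_const_on hp h4, hp x hx]

lemma HaarStep.apply_eq (hg : HaarStep σ I g) (x : ℝ) :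
    g x = av σ g I.minus * I.minus.ind x + av σ g I.plus * I.plus.ind x := by
  by_cases h1 : x ∈ I.minus.toSet
  · rw [hg.eq_av (Or.inl rfl) h1, ind_of_mem h1,
      ind_of_notMem (Set.disjoint_left.1 I.disjoint_minus_plus h1)]; ring
  by_cases h2 : x ∈ I.plus.toSet
  · rw [hg.eq_av (Or.inr rfl) h2, ind_of_mem h2,
      ind_of_notMem (Set.disjoint_right.1 I.disjoint_minus_plus h2)]; ring
  rw [hg.eq_zero_of_notMem, ind_of_notMem h1, ind_of_notMem h2]
  · ring
  · rw [← I.minus_union_plus]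
    rintro (h | h)
    exacts [h1 h, h2 h]

lemma HaarStep.memLp (hg : HaarStep σ I g) : MemLp g 2 σ := by
  rw [funext hg.apply_eq]
  exact ((memLp_ind I.minus).const_mul _).add ((memLp_ind I.plus).const_mul _)

lemma integrable_ind (I : Itv) : Integrable I.ind σ :=
  (integrable_indicator_iff I.measurableSet_toSet).2 (integrableOn_const (I.measure_lt_top σ).ne)

lemma HaarStep.balance (hg : HaarStep σ I g) :
    av σ g I.minus * σ.real I.minus.toSet + av σ g I.plus * σ.real I.plus.toSet = 0 := by
  obtain ⟨a, b, h1, h2, h3, h4⟩ := hg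
  rw [average_const_on (a := a) _ h3, average_const_on (a := b) _ h4, h2]
  · intro x hx
    rw [h1, ind_of_mem hx, ind_of_notMem (Set.disjoint_right.1 I.disjoint_minus_plus hx)]; ring
  · intro x hx
    rw [h1, ind_of_mem hx, ind_of_notMem (Set.disjoint_left.1 I.disjoint_minus_plus hx)]; ring

lemma HaarStep.integral_eq_zero (hg : HaarStep σ I g) : ∫ x, g x ∂σ = 0 := by
  simp_rw [hg.apply_eq]
  rw [integral_add ((integrable_ind _).const_mul _) ((integrable_ind _).const_mul _),
    integral_const_mul, integral_const_mul, integral_ind, integral_ind]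
  exact hg.balance

lemma HaarStep.integrable (hg : HaarStep σ I g) : Integrable g σ := by
  rw [funext hg.apply_eq]
  exact ((integrable_ind _).const_mul _).add ((integrable_ind _).const_mul _)

lemma HaarStep.l2_sq_eq (hg : HaarStep σ I g) :
    l2 σ g ^ 2 = av σ g I.minus ^ 2 * σ.real I.minus.toSet +
      av σ g I.plus ^ 2 * σ.real I.plus.toSet := by
  rw [l2_sq]
  have : ∀ x, g x ^ 2 = av σ g I.minus ^ 2 * I.minus.ind x ^ 2 +
      av σ g I.plus ^ 2 * I.plus.ind x ^ 2 := by
    intro x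
    have h0 : I.minus.ind x * I.plus.ind x = 0 := by
      by_cases h1 : x ∈ I.minus.toSet
      · rw [ind_of_notMem (Set.disjoint_left.1 I.disjoint_minus_plus h1), mul_zero]
      · rw [ind_of_notMem h1, zero_mul]
    rw [hg.apply_eq x]
    linear_combination 2 * av σ g I.minus * av σ g I.plus * h0
  simp_rw [this]
  rw [integral_add ((memLp_ind _).integrable_sq.const_mul _)
    ((memLp_ind _).integrable_sq.const_mul _),
    integral_const_mul, integral_const_mul, integral_ind_sq, integral_ind_sq]

/-- The contribution of one child to the norm of a Haar difference. -/
lemma HaarStep.abs_av_mul_sqrt_le (hg : HaarStep σ I g) {K : Itv}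
    (hK : K = I.minus ∨ K = I.plus) : |av σ g K| * √(σ.real K.toSet) ≤ l2 σ g := by
  apply le_of_sq_le_sq _ (l2_nonneg _ _)
  rw [mul_pow, sq_abs, Real.sq_sqrt measureReal_nonneg, hg.l2_sq_eq]
  have h1 : 0 ≤ av σ g I.minus ^ 2 * σ.real I.minus.toSet := by positivity
  have h2 : 0 ≤ av σ g I.plus ^ 2 * σ.real I.plus.toSet := by positivity
  rcases hK with rfl | rfl <;> linarith

variable {D : Set Itv} (hD : IsDyadicGrid D)
include hD

lemma HaarStep.integral_mul_eq_zero_of_le (hg : HaarStep σ I g) {J : Itv} {h : ℝ → ℝ}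
    (hh : HaarStep σ J h) (hI : I ∈ D) (hJ : J ∈ D) (hne : I ≠ J) (hle : J.len ≤ I.len) :
    ∫ x, g x * h x ∂σ = 0 := by
  rcases hD.subset_or_disjoint hI hJ hle with hs | hd
  · have hlt : J.len < I.len := lt_of_not_ge fun h' => hne (eq_of_subset_of_len_le hs h').symm
    have hc := hD.subset_childAt hI hJ hs hlt
    have : ∀ x, g x * h x = av σ g (I.childAt J) * h x := by
      intro x
      by_cases hx : x ∈ J.toSet
      · rw [hg.eq_av (I.childAt_eq_or J) (hc hx)]
      · rw [hh.eq_zero_of_notMem hx]; ring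
    simp_rw [this]
    rw [integral_const_mul, hh.integral_eq_zero, mul_zero]
  · have : ∀ x, g x * h x = 0 := by
      intro x
      by_cases hx : x ∈ J.toSet
      · rw [hg.eq_zero_of_notMem (Set.disjoint_left.1 hd hx), zero_mul]
      · rw [hh.eq_zero_of_notMem hx, mul_zero]
    simp [this]

/-- Haar differences of distinct grid intervals are orthogonal. -/
lemma HaarStep.integral_mul_eq_zero (hg : HaarStep σ I g) {J : Itv} {h : ℝ → ℝ}
    (hh : HaarStep σ J h) (hI : I ∈ D) (hJ : J ∈ D) (hne : I ≠ J) :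
    ∫ x, g x * h x ∂σ = 0 := by
  rcases le_total J.len I.len with hle | hle
  · exact hg.integral_mul_eq_zero_of_le hD hh hI hJ hne hle
  · simp_rw [mul_comm (g _)]
    exact hh.integral_mul_eq_zero_of_le hD hg hJ hI hne.symm hle

/-- Pythagoras for Haar differences. -/
lemma l2_sum_sq {F : Finset Itv} {u : Itv → ℝ → ℝ} (hF : ∀ I ∈ F, I ∈ D)
    (hu : ∀ I ∈ F, HaarStep σ I (u I)) :
    l2 σ (fun x => ∑ I ∈ F, u I x) ^ 2 = ∑ I ∈ F, l2 σ (u I) ^ 2 := by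
  rw [l2_sq]
  have h1 : ∀ x, (∑ I ∈ F, u I x) ^ 2 = ∑ I ∈ F, ∑ J ∈ F, u I x * u J x := by
    intro x; rw [sq, Finset.sum_mul_sum]
  simp_rw [h1]
  have hint : ∀ I ∈ F, ∀ J ∈ F, Integrable (fun x => u I x * u J x) σ := fun I hI J hJ =>
    (hu I hI).memLp.integrable_mul (hu J hJ).memLp
  rw [integral_finsetSum _ fun I hI => integrable_finsetSum _ fun J hJ => hint I hI J hJ]
  refine Finset.sum_congr rfl fun I hI => ?_
  rw [integral_finsetSum _ fun J hJ => hint I hI J hJ, Finset.sum_eq_single I, l2_sq]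
  · simp_rw [sq]
  · intro J hJ hne
    exact (hu I hI).integral_mul_eq_zero hD (hu J hJ) (hF I hI) (hF J hJ) hne.symm
  · exact fun h => absurd hI h

omit hD in
lemma memLp_sum {F : Finset Itv} {u : Itv → ℝ → ℝ}
    (hu : ∀ I ∈ F, HaarStep σ I (u I)) : MemLp (fun x => ∑ I ∈ F, u I x) 2 σ :=
  memLp_finsetSum _ fun I hI => (hu I hI).memLp

/-- The average over `K` of a sum of Haar differences only sees the differences of the intervals
strictly containing `K`. -/
lemma av_sum {F : Finset Itv} {u : Itv → ℝ → ℝ} (hF : ∀ I ∈ F, I ∈ D)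
    (hu : ∀ I ∈ F, HaarStep σ I (u I)) {K : Itv} (hK : K ∈ D) (hσ : σ.real K.toSet ≠ 0)
    [DecidablePred fun I : Itv => K.toSet ⊆ I.toSet ∧ K.len < I.len] :
    av σ (fun x => ∑ I ∈ F, u I x) K =
      ∑ I ∈ F with K.toSet ⊆ I.toSet ∧ K.len < I.len, av σ (u I) (I.childAt K) := by
  unfold av
  rw [setAverage_eq, integral_finsetSum _ fun I hI => (hu I hI).integrable.integrableOn,
    Finset.smul_sum, Finset.sum_filter]
  refine Finset.sum_congr rfl fun I hI => ?_
  split_ifs with h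
  · have hc := hD.subset_childAt (hF I hI) hK h.1 h.2
    have h1 : ∀ x ∈ K.toSet, u I x = av σ (u I) (I.childAt K) := fun x hx =>
      (hu I hI).eq_av (I.childAt_eq_or K) (hc hx)
    rw [setIntegral_congr_fun K.measurableSet_toSet h1, setIntegral_const, smul_eq_mul,
      smul_eq_mul, inv_mul_cancel_left₀ hσ]
    rfl
  · have : ∫ x in K.toSet, u I x ∂σ = 0 := by
      rcases le_or_gt I.len K.len with hl | hl
      · rcases hD.subset_or_disjoint hK (hF I hI) hl with hs | hd
        · rw [setIntegral_eq_integral_of_forall_compl_eq_zero, (hu I hI).integral_eq_zero]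
          exact fun x hx => (hu I hI).eq_zero_of_notMem fun h' => hx (hs h')
        · rw [setIntegral_congr_fun K.measurableSet_toSet (g := fun _ => 0), integral_zero]
          exact fun x hx => (hu I hI).eq_zero_of_notMem (Set.disjoint_right.1 hd hx)
      · rcases hD.subset_or_disjoint (hF I hI) hK hl.le with hs | hd
        · exact absurd ⟨hs, hl⟩ h
        · rw [setIntegral_congr_fun K.measurableSet_toSet (g := fun _ => 0), integral_zero]
          exact fun x hx => (hu I hI).eq_zero_of_notMem (Set.disjoint_left.1 hd hx)
    rw [this, smul_zero]

end HaarStep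

/-- The Haar function is constant on the children and has mean zero. If a child has no mass, it
vanishes identically. -/
lemma haarStep_haar (σ : Measure ℝ) [IsLocallyFiniteMeasure σ] (I : Itv) :
    HaarStep σ I (haar σ I) := by
  set m := σ.real I.minus.toSet with hm
  set p := σ.real I.plus.toSet with hp
  set c := √(m * p / σ.real I.toSet) with hc
  refine ⟨c / m, -(c / p), fun x => ?_, ?_, fun h => ?_, fun h => ?_⟩
  · unfold haar
    rw [← hm, ← hp, ← hc]; ring
  · rw [← hm, ← hp]
    by_cases h1 : m = 0
    · simp [hc, h1]
    by_cases h2 : p = 0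
    · simp [hc, h2]
    field_simp
    ring
  · rw [← hm] at h; simp [h]
  · rw [← hp] at h; simp [h]

lemma haarStep_mdiff (σ : Measure ℝ) [IsLocallyFiniteMeasure σ] (I : Itv) (f : ℝ → ℝ) :
    HaarStep σ I (mdiff σ I f) :=
  (haarStep_haar σ I).const_mul _

/-- The Haar function is normalized, or zero. -/
lemma l2_haar_eq_one_or_eq_zero (σ : Measure ℝ) [IsLocallyFiniteMeasure σ] (I : Itv) :
    l2 σ (haar σ I) = 1 ∨ ∀ x, haar σ I x = 0 := by
  have hI : σ.real I.toSet = σ.real I.minus.toSet + σ.real I.plus.toSet := by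
    rw [← I.minus_union_plus]
    exact measureReal_union I.disjoint_minus_plus I.plus.measurableSet_toSet
      (I.minus.measure_lt_top σ).ne (I.plus.measure_lt_top σ).ne
  by_cases h1 : σ.real I.minus.toSet = 0
  · right; intro x; simp [haar, h1]
  by_cases h2 : σ.real I.plus.toSet = 0
  · right; intro x; simp [haar, h2]
  left
  have hm : 0 < σ.real I.minus.toSet := lt_of_le_of_ne measureReal_nonneg (Ne.symm h1)
  have hp : 0 < σ.real I.plus.toSet := lt_of_le_of_ne measureReal_nonneg (Ne.symm h2)
  rw [← pow_eq_one_iff_of_nonneg (l2_nonneg _ _) two_ne_zero, (haarStep_haar σ I).l2_sq_eq]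
  have e1 : av σ (haar σ I) I.minus = √(σ.real I.minus.toSet * σ.real I.plus.toSet /
      σ.real I.toSet) / σ.real I.minus.toSet := by
    refine average_const_on (fun x hx => ?_) fun h => absurd h h1
    unfold haar
    rw [ind_of_mem hx, ind_of_notMem (Set.disjoint_left.1 I.disjoint_minus_plus hx)]; ring
  have e2 : av σ (haar σ I) I.plus = -(√(σ.real I.minus.toSet * σ.real I.plus.toSet /
      σ.real I.toSet) / σ.real I.plus.toSet) := by
    refine average_const_on (fun x hx => ?_) fun h => absurd h h2
    unfold haar
    rw [ind_of_mem hx, ind_of_notMem (Set.disjoint_right.1 I.disjoint_minus_plus hx)]; ring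
  rw [e1, e2, neg_sq, div_pow, div_pow, Real.sq_sqrt (by positivity), hI]
  field_simp
  ring

/-! ### The Carleson embedding theorem -/

lemma sq_add_div_add_le {x₁ x₂ s₁ s₂ : ℝ} (h₁ : 0 ≤ s₁) (h₂ : 0 ≤ s₂) (hx₁ : s₁ = 0 → x₁ = 0)
    (hx₂ : s₂ = 0 → x₂ = 0) : (x₁ + x₂) ^ 2 / (s₁ + s₂) ≤ x₁ ^ 2 / s₁ + x₂ ^ 2 / s₂ := by
  rcases h₁.eq_or_lt with h | h
  · rw [hx₁ h.symm, ← h]; simp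
  rcases h₂.eq_or_lt with h' | h'
  · rw [hx₂ h'.symm, ← h']; simp
  rw [div_add_div _ _ h.ne' h'.ne', div_le_div_iff₀ (by positivity) (by positivity)]
  have := mul_nonneg (mul_nonneg h.le h'.le) (sq_nonneg (x₁ * s₂ - x₂ * s₁))
  have h2 := sq_nonneg (x₁ * s₂ - x₂ * s₁)
  nlinarith

/-- The Bellman function inequality `4 (X - x² / (s + A))` behind the Carleson embedding theorem:
`s` is the mass, `x` the integral, `X` the integral of the square, `A` the Carleson sum. -/
lemma bellman_step {s₁ s₂ A₁ A₂ a x₁ x₂ X₁ X₂ T₁ T₂ : ℝ} (hs₁ : 0 ≤ s₁) (hs₂ : 0 ≤ s₂)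
    (hA₁ : 0 ≤ A₁) (hA₂ : 0 ≤ A₂) (ha : 0 ≤ a) (h₁ : A₁ ≤ s₁) (h₂ : A₂ ≤ s₂)
    (h : a + (A₁ + A₂) ≤ s₁ + s₂) (hx₁ : s₁ = 0 → x₁ = 0) (hx₂ : s₂ = 0 → x₂ = 0)
    (hT₁ : T₁ ≤ 4 * (X₁ - x₁ ^ 2 / (s₁ + A₁))) (hT₂ : T₂ ≤ 4 * (X₂ - x₂ ^ 2 / (s₂ + A₂))) :
    a * ((x₁ + x₂) / (s₁ + s₂)) ^ 2 + (T₁ + T₂) ≤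
      4 * (X₁ + X₂ - (x₁ + x₂) ^ 2 / (s₁ + s₂ + (a + (A₁ + A₂)))) := by
  have hconv := sq_add_div_add_le (x₁ := x₁) (x₂ := x₂) (add_nonneg hs₁ hA₁) (add_nonneg hs₂ hA₂)
    (fun h => hx₁ (by linarith)) (fun h => hx₂ (by linarith))
  have key : a * ((x₁ + x₂) / (s₁ + s₂)) ^ 2 ≤ 4 * ((x₁ + x₂) ^ 2 / (s₁ + A₁ + (s₂ + A₂)) -
      (x₁ + x₂) ^ 2 / (s₁ + s₂ + (a + (A₁ + A₂)))) := by
    rcases (add_nonneg hs₁ hs₂).eq_or_lt with h0 | h0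
    · rw [hx₁ (by linarith), hx₂ (by linarith)]; simp
    set s := s₁ + s₂
    set B := A₁ + A₂
    have hB : 0 ≤ B := add_nonneg hA₁ hA₂
    rw [show s₁ + A₁ + (s₂ + A₂) = s + B by simp only [s, B]; ring]
    have e : (x₁ + x₂) ^ 2 / (s + B) - (x₁ + x₂) ^ 2 / (s + (a + B)) =
        (x₁ + x₂) ^ 2 * (a / ((s + B) * (s + (a + B)))) := by
      field_simp; ring
    rw [e, div_pow]
    have : a / (s ^ 2) ≤ 4 * (a / ((s + B) * (s + (a + B)))) := by
      rw [← mul_div_assoc, div_le_div_iff₀ (by positivity) (by positivity)]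
      have : (s + B) * (s + (a + B)) ≤ 4 * s ^ 2 := by nlinarith
      nlinarith
    calc a * ((x₁ + x₂) ^ 2 / s ^ 2) = (x₁ + x₂) ^ 2 * (a / s ^ 2) := by ring
      _ ≤ (x₁ + x₂) ^ 2 * (4 * (a / ((s + B) * (s + (a + B))))) := by gcongr
      _ = _ := by ring
  linarith

section Carleson

lemma setIntegral_children {σ : Measure ℝ} {g : ℝ → ℝ} (I : Itv) (hg : IntegrableOn g I.toSet σ) :
    ∫ x in I.toSet, g x ∂σ = ∫ x in I.minus.toSet, g x ∂σ + ∫ x in I.plus.toSet, g x ∂σ := by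
  rw [← setIntegral_union I.disjoint_minus_plus I.plus.measurableSet_toSet
    (hg.mono_set I.minus_subset) (hg.mono_set I.plus_subset), I.minus_union_plus]

variable {D : Set Itv} {ℓ : ℝ} {lev : Itv → ℤ} {σ : Measure ℝ} [IsLocallyFiniteMeasure σ]

lemma setIntegral_eq_zero_of_real {μ : Measure ℝ} [IsLocallyFiniteMeasure μ] {K : Itv} (g : ℝ → ℝ)
    (h : μ.real K.toSet = 0) : ∫ x in K.toSet, g x ∂μ = 0 := by
  rw [measureReal_eq_zero_iff (K.measure_lt_top μ).ne] at h
  exact setIntegral_measure_zero g h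

lemma measureReal_children (I : Itv) :
    σ.real I.toSet = σ.real I.minus.toSet + σ.real I.plus.toSet := by
  rw [← I.minus_union_plus]
  exact measureReal_union I.disjoint_minus_plus I.plus.measurableSet_toSet
    (I.minus.measure_lt_top σ).ne (I.plus.measure_lt_top σ).ne

lemma integrableOn_of_memLp {g : ℝ → ℝ} (hg : MemLp g 2 σ) (I : Itv) : IntegrableOn g I.toSet σ := by
  have : IsFiniteMeasure (σ.restrict I.toSet) :=
    ⟨by rw [Measure.restrict_apply_univ]; exact I.measure_lt_top σ⟩
  exact (hg.restrict I.toSet).integrable (by norm_num)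

lemma sq_setIntegral_le {g : ℝ → ℝ} (hg : MemLp g 2 σ) (I : Itv) :
    (∫ x in I.toSet, g x ∂σ) ^ 2 ≤ σ.real I.toSet * ∫ x in I.toSet, g x ^ 2 ∂σ := by
  -- the quadratic polynomial `∫ (g - c)²` in `c` is nonnegative
  have h1 : ∀ c : ℝ, 0 ≤ σ.real I.toSet * (c * c) + (-2 * ∫ x in I.toSet, g x ∂σ) * c +
      ∫ x in I.toSet, g x ^ 2 ∂σ := by
    intro c
    have h2 : 0 ≤ ∫ x in I.toSet, (g x - c) ^ 2 ∂σ := integral_nonneg fun _ => sq_nonneg _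
    have h3 : ∫ x in I.toSet, (g x - c) ^ 2 ∂σ =
        ∫ x in I.toSet, (g x ^ 2 + ((-2 * c) * g x + c ^ 2)) ∂σ := by
      congr 1; ext x; ring
    have hc : IntegrableOn (fun _ : ℝ => c ^ 2) I.toSet σ :=
      integrableOn_const (I.measure_lt_top σ).ne
    have hi := (integrableOn_of_memLp hg I)
    have hsum : Integrable (fun x => (-2 * c) * g x + c ^ 2) (σ.restrict I.toSet) :=
      (Integrable.const_mul hi (-2 * c)).add hc
    rw [h3, integral_add hg.integrable_sq.integrableOn hsum,
      integral_add (Integrable.const_mul hi (-2 * c)) hc, integral_const_mul,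
      setIntegral_const, smul_eq_mul] at h2
    linarith
  have := discrim_le_zero h1
  unfold discrim at this
  linarith

lemma setIntegral_sq_sub_nonneg {g : ℝ → ℝ} (hg : MemLp g 2 σ) (I : Itv) {A : ℝ} (hA : 0 ≤ A) :
    0 ≤ ∫ x in I.toSet, g x ^ 2 ∂σ - (∫ x in I.toSet, g x ∂σ) ^ 2 / (σ.real I.toSet + A) := by
  have h0 : 0 ≤ ∫ x in I.toSet, g x ^ 2 ∂σ := integral_nonneg fun _ => sq_nonneg _
  have h1 := sq_setIntegral_le hg I
  have h2 : 0 ≤ σ.real I.toSet := measureReal_nonneg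
  rw [sub_nonneg]
  apply div_le_of_le_mul₀ (by positivity) h0
  nlinarith

/-- The induction on generations for the Carleson embedding theorem. -/
lemma carleson_tree (hD : IsDyadicGrid D) (hL : IsLevel D ℓ lev) {g : ℝ → ℝ} (hg : MemLp g 2 σ)
    {ι : Type*} (Q : Finset ι) (κ : ι → Itv) (hκ : ∀ i ∈ Q, κ i ∈ D) (b : ι → ℝ)
    (hb : ∀ i ∈ Q, 0 ≤ b i)
    [∀ L : Itv, DecidablePred fun i => (κ i).toSet ⊆ L.toSet]
    (hC : ∀ L ∈ D, ∑ i ∈ Q with (κ i).toSet ⊆ L.toSet, b i ≤ σ.real L.toSet)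
    (n : ℕ) (L : Itv) (hLD : L ∈ D) (hn : ∀ i ∈ Q, lev L < lev (κ i) + n) :
    ∑ i ∈ Q with (κ i).toSet ⊆ L.toSet, b i * av σ g (κ i) ^ 2 ≤
      4 * (∫ x in L.toSet, g x ^ 2 ∂σ - (∫ x in L.toSet, g x ∂σ) ^ 2 /
        (σ.real L.toSet + ∑ i ∈ Q with (κ i).toSet ⊆ L.toSet, b i)) := by
  classical
  have hA0 : ∀ L : Itv, 0 ≤ ∑ i ∈ Q with (κ i).toSet ⊆ L.toSet, b i := fun L =>
    Finset.sum_nonneg fun i hi => hb i (Finset.mem_filter.1 hi).1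
  induction n generalizing L with
  | zero =>
    have hempty : Q.filter (fun i => (κ i).toSet ⊆ L.toSet) = ∅ := by
      refine Finset.filter_eq_empty_iff.2 fun i hi hs => ?_
      have h1 := hn i hi
      have h2 := (hL.len_le_iff hLD (hκ i hi)).1 (len_le_of_subset hs)
      push_cast at h1; omega
    have h1 := setIntegral_sq_sub_nonneg hg L (hA0 L)
    rw [hempty] at h1 ⊢
    simp only [Finset.sum_empty] at h1 ⊢
    linarith
  | succ n ih =>
    have hm := hD.minus_mem L hLD
    have hp := hD.plus_mem L hLD
    have split : ∀ φ : ι → ℝ, ∑ i ∈ Q with (κ i).toSet ⊆ L.toSet, φ i =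
        ∑ i ∈ Q with κ i = L, φ i + (∑ i ∈ Q with (κ i).toSet ⊆ L.minus.toSet, φ i +
          ∑ i ∈ Q with (κ i).toSet ⊆ L.plus.toSet, φ i) := by
      intro φ
      simp only [Finset.sum_filter]
      rw [← Finset.sum_add_distrib, ← Finset.sum_add_distrib]
      refine Finset.sum_congr rfl fun i hi => ?_
      have hpos := L.len_pos
      have e1 : κ i = L → ¬ (κ i).toSet ⊆ L.minus.toSet := fun h h' => by
        have := len_le_of_subset h'; rw [minus_len, h] at this; linarith
      have e2 : κ i = L → ¬ (κ i).toSet ⊆ L.plus.toSet := fun h h' => by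
        have := len_le_of_subset h'; rw [plus_len, h] at this; linarith
      have e3 : (κ i).toSet ⊆ L.minus.toSet → ¬ (κ i).toSet ⊆ L.plus.toSet := fun h h' =>
        Set.disjoint_left.1 L.disjoint_minus_plus (h (κ i).left_mem) (h' (κ i).left_mem)
      have e4 : (κ i).toSet ⊆ L.toSet ↔ κ i = L ∨ (κ i).toSet ⊆ L.minus.toSet ∨
          (κ i).toSet ⊆ L.plus.toSet := by
        constructor
        · intro h
          by_cases hlt : (κ i).len < L.len
          · exact Or.inr (hD.subset_child hLD (hκ i hi) h hlt)
          · exact Or.inl (eq_of_subset_of_len_le h (not_lt.1 hlt))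
        · rintro (h | h | h)
          · rw [h]
          · exact h.trans L.minus_subset
          · exact h.trans L.plus_subset
      by_cases c1 : κ i = L
      · rw [if_pos (e4.2 (Or.inl c1)), if_pos c1, if_neg (e1 c1), if_neg (e2 c1)]; ring
      by_cases c2 : (κ i).toSet ⊆ L.minus.toSet
      · rw [if_pos (e4.2 (Or.inr (Or.inl c2))), if_neg c1, if_pos c2, if_neg (e3 c2)]; ring
      by_cases c3 : (κ i).toSet ⊆ L.plus.toSet
      · rw [if_pos (e4.2 (Or.inr (Or.inr c3))), if_neg c1, if_neg c2, if_pos c3]; ring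
      rw [if_neg fun h => (e4.1 h).elim c1 fun h => h.elim c2 c3, if_neg c1, if_neg c2, if_neg c3]
      ring
    have top : ∑ i ∈ Q with κ i = L, b i * av σ g (κ i) ^ 2 =
        (∑ i ∈ Q with κ i = L, b i) * av σ g L ^ 2 := by
      rw [Finset.sum_mul]
      refine Finset.sum_congr rfl fun i hi => ?_
      rw [(Finset.mem_filter.1 hi).2]
    have hav : av σ g L = (∫ x in L.toSet, g x ∂σ) / σ.real L.toSet := by
      unfold av; rw [setAverage_eq, smul_eq_mul, div_eq_inv_mul]
    have hCL := hC L hLD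
    rw [split] at hCL
    rw [split, split b, top, hav, setIntegral_children L (integrableOn_of_memLp hg L),
      setIntegral_children L hg.integrable_sq.integrableOn, measureReal_children L]
    rw [measureReal_children L] at hCL
    refine bellman_step measureReal_nonneg measureReal_nonneg (hA0 _) (hA0 _)
      (Finset.sum_nonneg fun i hi => hb i (Finset.mem_filter.1 hi).1) (hC _ hm) (hC _ hp) hCL
      (setIntegral_eq_zero_of_real g) (setIntegral_eq_zero_of_real g)
      (ih _ hm fun i hi => ?_) (ih _ hp fun i hi => ?_)
    · have := hn i hi
      rw [hL.lev_minus hD hLD]; push_cast at this; omega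
    · have := hn i hi
      rw [hL.lev_plus hD hLD]; push_cast at this; omega

/-- The dyadic Carleson embedding theorem, for coefficients with an arbitrary finite index set. -/
theorem carleson_embedding (hD : IsDyadicGrid D) (hL : IsLevel D ℓ lev) {g : ℝ → ℝ}
    (hg : MemLp g 2 σ) {ι : Type*} (Q : Finset ι) (κ : ι → Itv) (hκ : ∀ i ∈ Q, κ i ∈ D)
    (b : ι → ℝ) (hb : ∀ i ∈ Q, 0 ≤ b i) {c : ℝ} (hc : 0 ≤ c)
    [∀ L : Itv, DecidablePred fun i => (κ i).toSet ⊆ L.toSet]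
    (hC : ∀ L ∈ D, ∑ i ∈ Q with (κ i).toSet ⊆ L.toSet, b i ≤ c * σ.real L.toSet) :
    ∑ i ∈ Q, b i * av σ g (κ i) ^ 2 ≤ 4 * c * l2 σ g ^ 2 := by
  classical
  rcases hc.eq_or_lt with rfl | hc
  · have hz : ∀ i ∈ Q, b i = 0 := by
      intro i hi
      have h1 := hC (κ i) (hκ i hi)
      have h2 : b i ≤ ∑ j ∈ Q with (κ j).toSet ⊆ (κ i).toSet, b j :=
        Finset.single_le_sum (f := b) (fun j hj => hb j (Finset.mem_filter.1 hj).1)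
          (Finset.mem_filter.2 ⟨hi, subset_rfl⟩)
      linarith [hb i hi]
    rw [Finset.sum_eq_zero fun i hi => by rw [hz i hi, zero_mul]]
    simp
  rcases Q.eq_empty_or_nonempty with rfl | hQ
  · simp only [Finset.sum_empty]; positivity
  -- pass to the intervals of a generation above all the `κ i`
  obtain ⟨i₀, hi₀, hmax⟩ := Q.exists_max_image (fun i => lev (κ i)) hQ
  obtain ⟨j₀, hj₀, hmin⟩ := Q.exists_min_image (fun i => lev (κ i)) hQ
  set m := lev (κ i₀)
  have hanc : ∀ i ∈ Q, ∃ L ∈ D, L.len = (κ i₀).len ∧ (κ i).toSet ⊆ L.toSet := by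
    intro i hi
    obtain ⟨L, h1, h2, h3⟩ := hD.exists_mem (hκ i₀ hi₀) (κ i).left
    refine ⟨L, h1, h2, hD.subset_of_mem h1 (hκ i hi) ?_ h3 (κ i).left_mem⟩
    rw [h2, hL.len_le_iff (hκ i₀ hi₀) (hκ i hi)]
    exact hmax i hi
  choose! anc hancD hancl hancs using hanc
  set b' : ι → ℝ := fun i => b i / c
  have htree : ∀ i ∈ Q, ∑ j ∈ Q with anc j = anc i, b' j * av σ g (κ j) ^ 2 ≤
      4 * ∫ x in (anc i).toSet, g x ^ 2 ∂σ := by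
    intro i hi
    have h1 := carleson_tree hD hL hg Q κ hκ b' (fun j hj => div_nonneg (hb j hj) hc.le)
      (fun L hLD => by
        simp only [b']
        rw [← Finset.sum_div, div_le_iff₀ hc, mul_comm]
        exact hC L hLD) (Int.toNat (m - lev (κ j₀)) + 1) (anc i) (hancD i hi) (fun j hj => by
        have e1 : lev (anc i) = m := (hL.len_eq_iff (hκ i₀ hi₀) (hancD i hi)).1 (hancl i hi)
        have e2 := hmin j hj
        push_cast
        omega)
    have h2 : ∑ j ∈ Q with anc j = anc i, b' j * av σ g (κ j) ^ 2 ≤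
        ∑ j ∈ Q with (κ j).toSet ⊆ (anc i).toSet, b' j * av σ g (κ j) ^ 2 := by
      refine Finset.sum_le_sum_of_subset_of_nonneg (fun j hj => ?_) fun j hj _ => ?_
      · obtain ⟨h3, h4⟩ := Finset.mem_filter.1 hj
        exact Finset.mem_filter.2 ⟨h3, h4 ▸ hancs j h3⟩
      · exact mul_nonneg (div_nonneg (hb j (Finset.mem_filter.1 hj).1) hc.le) (sq_nonneg _)
    have h3 : 0 ≤ (∫ x in (anc i).toSet, g x ∂σ) ^ 2 / (σ.real (anc i).toSet +
        ∑ j ∈ Q with (κ j).toSet ⊆ (anc i).toSet, b' j) :=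
      div_nonneg (sq_nonneg _) (add_nonneg measureReal_nonneg (Finset.sum_nonneg fun j hj =>
        div_nonneg (hb j (Finset.mem_filter.1 hj).1) hc.le))
    linarith
  have hsum : ∑ i ∈ Q, b' i * av σ g (κ i) ^ 2 ≤ 4 * l2 σ g ^ 2 := by
    rw [← Finset.sum_fiberwise_of_maps_to (s := Q) (t := Q.image anc) (g := anc)
      (fun i hi => Finset.mem_image_of_mem _ hi)]
    calc _ ≤ ∑ L ∈ Q.image anc, 4 * ∫ x in L.toSet, g x ^ 2 ∂σ := by
          refine Finset.sum_le_sum fun L hLi => ?_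
          obtain ⟨i, hi, rfl⟩ := Finset.mem_image.1 hLi
          exact htree i hi
      _ = 4 * ∫ x in ⋃ L ∈ Q.image anc, L.toSet, g x ^ 2 ∂σ := by
          rw [← Finset.mul_sum, integral_biUnion_finset _ (fun L _ => L.measurableSet_toSet)]
          · intro L hLi L' hLi' hne
            obtain ⟨i, hi, rfl⟩ := Finset.mem_image.1 hLi
            obtain ⟨j, hj, rfl⟩ := Finset.mem_image.1 hLi'
            refine Set.disjoint_left.2 fun x hx hx' => hne ?_
            exact hD.eq_of_mem (hancD j hj) (hancD i hi) ((hancl i hi).trans (hancl j hj).symm) hx' hx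
          · exact fun L _ => hg.integrable_sq.integrableOn
      _ ≤ 4 * l2 σ g ^ 2 := by
          rw [l2_sq]
          gcongr 4 * ?_
          exact setIntegral_le_integral hg.integrable_sq (Eventually.of_forall fun _ => sq_nonneg _)
  calc ∑ i ∈ Q, b i * av σ g (κ i) ^ 2 = c * ∑ i ∈ Q, b' i * av σ g (κ i) ^ 2 := by
        rw [Finset.mul_sum]
        refine Finset.sum_congr rfl fun i _ => ?_
        simp only [b']; field_simp
    _ ≤ c * (4 * l2 σ g ^ 2) := by gcongr
    _ = _ := by ring

end Carleson

/-! ### Inside sums for kernels of bounded range -/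

/-- A kernel of size at most `1 / a` that vanishes at distances larger than `a`. -/
structure LocalKernel (k : ℝ → ℝ → ℝ) (a : ℝ) : Prop where
  meas : Measurable (Function.uncurry k)
  pos : 0 < a
  bound : ∀ x y, |k x y| ≤ 1 / a
  support : ∀ x y, a < |x - y| → k x y = 0

lemma LocalKernel.poissonDominated {k : ℝ → ℝ → ℝ} {a : ℝ} (hk : LocalKernel k a) :
    PoissonDominated k 2 a := by
  refine ⟨hk.meas, by norm_num, hk.pos, fun x y => ?_⟩
  rcases le_or_gt |x - y| a with h | h
  · exact (hk.bound x y).trans (inv_le_two_mul_pk hk.pos h)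
  · rw [hk.support x y h, abs_zero]
    have := pk_nonneg hk.pos (x - y)
    positivity

lemma LocalKernel.flip {k : ℝ → ℝ → ℝ} {a : ℝ} (hk : LocalKernel k a) :
    LocalKernel (fun x y => k y x) a :=
  ⟨hk.meas.comp measurable_swap, hk.pos, fun x y => hk.bound y x, fun x y h =>
    hk.support y x (by rwa [abs_sub_comm])⟩

/-- The `ℓ²` norm of a finite family of functions. -/
noncomputable def fam (μ : Measure ℝ) (F : Finset Itv) (u : Itv → ℝ → ℝ) : ℝ :=
  √(∑ I ∈ F, l2 μ (u I) ^ 2)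

lemma fam_nonneg (μ : Measure ℝ) (F : Finset Itv) (u : Itv → ℝ → ℝ) : 0 ≤ fam μ F u :=
  Real.sqrt_nonneg _

lemma fam_sq (μ : Measure ℝ) (F : Finset Itv) (u : Itv → ℝ → ℝ) :
    fam μ F u ^ 2 = ∑ I ∈ F, l2 μ (u I) ^ 2 :=
  Real.sq_sqrt (Finset.sum_nonneg fun _ _ => sq_nonneg _)

lemma fam_mono (μ : Measure ℝ) {F F' : Finset Itv} (h : F ⊆ F') (u : Itv → ℝ → ℝ) :
    fam μ F u ≤ fam μ F' u :=
  Real.sqrt_le_sqrt (Finset.sum_le_sum_of_subset_of_nonneg h fun _ _ _ => sq_nonneg _)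

lemma l2_sum_eq_fam {D : Set Itv} (hD : IsDyadicGrid D) {σ : Measure ℝ} [IsLocallyFiniteMeasure σ]
    {F : Finset Itv} {u : Itv → ℝ → ℝ} (hF : ∀ I ∈ F, I ∈ D) (hu : ∀ I ∈ F, HaarStep σ I (u I)) :
    l2 σ (fun x => ∑ I ∈ F, u I x) = fam σ F u := by
  rw [fam, ← l2_sum_sq hD hF hu, Real.sqrt_sq (l2_nonneg _ _)]

/-- The summand of the inside sums for a general kernel: the average of `u I` over the child of `I`
around `J`, times the form on that child and `v J`. -/
noncomputable def insideTerm (k : ℝ → ℝ → ℝ) (σ w : Measure ℝ) (u v : Itv → ℝ → ℝ)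
    (I J : Itv) : ℝ :=
  av σ (u I) (I.childAt J) * bform k σ w (I.childAt J).ind (v J)

section

variable {D : Set Itv} {ℓ : ℝ} {lev : Itv → ℤ} {σ w : Measure ℝ} [IsLocallyFiniteMeasure σ]
  [IsLocallyFiniteMeasure w] {k : ℝ → ℝ → ℝ} {M t : ℝ}

/-- For a fixed `I`, the sum over `J` collapses to two forms, one for each child of `I`. -/
lemma abs_sum_insideTerm_le (hA : A2 σ w ≠ ∞) (hk : PoissonDominated k M t) (hD : IsDyadicGrid D)
    {I : Itv} {u v : Itv → ℝ → ℝ} (hu : HaarStep σ I (u I)) {G : Finset Itv}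
    (hG : ∀ J ∈ G, J ∈ D) (hv : ∀ J ∈ G, HaarStep w J (v J)) (hsub : ∀ J ∈ G, J.toSet ⊆ I.toSet)
    {B : ℝ} (hB0 : 0 ≤ B)
    (hB : ∀ K, K = I.minus ∨ K = I.plus → ∀ h : ℝ → ℝ, MemLp h 2 w → (∀ x, h x ≠ 0 → x ∈ I.toSet) →
      |bform k σ w K.ind h| ≤ B * (√(σ.real K.toSet) * l2 w h)) :
    |∑ J ∈ G, insideTerm k σ w u v I J| ≤ 2 * B * (l2 σ (u I) * fam w G v) := by
  classical
  have part : ∀ K, K = I.minus ∨ K = I.plus →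
      |∑ J ∈ G with I.childAt J = K, insideTerm k σ w u v I J| ≤
        B * (l2 σ (u I) * fam w G v) := by
    intro K hK
    set G' := G.filter fun J => I.childAt J = K
    have hG' : G' ⊆ G := Finset.filter_subset _ _
    have e : ∑ J ∈ G', insideTerm k σ w u v I J =
        av σ (u I) K * bform k σ w K.ind (fun x => ∑ J ∈ G', v J x) := by
      rw [hk.bform_sum_right hA G' (memLp_ind K) fun J hJ => (hv J (hG' hJ)).memLp, Finset.mul_sum]
      refine Finset.sum_congr rfl fun J hJ => ?_
      rw [insideTerm, (Finset.mem_filter.1 hJ).2]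
    rw [e, abs_mul]
    have h1 := hB K hK _ (memLp_sum fun J hJ => hv J (hG' hJ)) (fun x hx => by
      obtain ⟨J, hJ, hne⟩ := Finset.exists_ne_zero_of_sum_ne_zero hx
      by_contra hxI
      exact hne ((hv J (hG' hJ)).eq_zero_of_notMem fun h => hxI (hsub J (hG' hJ) h)))
    rw [l2_sum_eq_fam hD (fun J hJ => hG J (hG' hJ)) fun J hJ => hv J (hG' hJ)] at h1
    have h2 := hu.abs_av_mul_sqrt_le hK
    have h3 := fam_mono w hG' v
    have h4 := fam_nonneg w G' v
    calc _ ≤ |av σ (u I) K| * (B * (√(σ.real K.toSet) * fam w G' v)) := by gcongr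
      _ = B * ((|av σ (u I) K| * √(σ.real K.toSet)) * fam w G' v) := by ring
      _ ≤ _ := by gcongr; exact l2_nonneg _ _
  have hsplit : ∑ J ∈ G, insideTerm k σ w u v I J =
      ∑ J ∈ G with I.childAt J = I.minus, insideTerm k σ w u v I J +
      ∑ J ∈ G with I.childAt J = I.plus, insideTerm k σ w u v I J := by
    have hne : I.minus ≠ I.plus := fun h => by
      have h1 := I.minus.left_mem
      have h2 := h1
      rw [h] at h2
      exact Set.disjoint_left.1 I.disjoint_minus_plus h1 (h ▸ h1)
    rw [Finset.sum_filter, Finset.sum_filter, ← Finset.sum_add_distrib]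
    refine Finset.sum_congr rfl fun J _ => ?_
    rcases I.childAt_eq_or J with h | h
    · rw [if_pos h, if_neg (h ▸ hne), add_zero]
    · rw [if_pos h, if_neg (h ▸ hne.symm), zero_add]
  rw [hsplit]
  refine (abs_add_le _ _).trans ?_
  linarith [part _ (Or.inl rfl), part _ (Or.inr rfl)]

open Classical in
/-- Inside sums over a relation, summed row by row. -/
lemma abs_sum_rows_le (hA : A2 σ w ≠ ∞) (hk : PoissonDominated k M t) (hD : IsDyadicGrid D)
    {u v : Itv → ℝ → ℝ} {F G : Finset Itv} (hu : ∀ I ∈ F, HaarStep σ I (u I))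
    (hG : ∀ J ∈ G, J ∈ D) (hv : ∀ J ∈ G, HaarStep w J (v J)) (R : Itv → Itv → Prop)
    (hR : ∀ I ∈ F, ∀ J ∈ G, R I J → J.toSet ⊆ I.toSet)
    {B κ : ℝ} (hB0 : 0 ≤ B) (hκ : 0 ≤ κ) (c : Itv → ℝ) (hc : ∀ I, 0 ≤ c I)
    (hB : ∀ I ∈ F, (∃ J ∈ G, R I J) → ∀ K, K = I.minus ∨ K = I.plus → ∀ h : ℝ → ℝ, MemLp h 2 w →
      (∀ x, h x ≠ 0 → x ∈ I.toSet) →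
      |bform k σ w K.ind h| ≤ B * c I * (√(σ.real K.toSet) * l2 w h))
    (hsum : ∀ J ∈ G, ∑ I ∈ F with R I J, c I ^ 2 ≤ κ ^ 2) :
    |∑ I ∈ F, ∑ J ∈ G, if R I J then insideTerm k σ w u v I J else 0| ≤
      2 * B * κ * (fam σ F u * fam w G v) := by
  have hrow : ∀ I ∈ F, |∑ J ∈ G, if R I J then insideTerm k σ w u v I J else 0| ≤
      2 * B * (l2 σ (u I) * (c I * fam w (G.filter fun J => R I J) v)) := by
    intro I hI
    rw [← Finset.sum_filter]
    by_cases hex : ∃ J ∈ G, R I J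
    · refine (abs_sum_insideTerm_le hA hk hD (hu I hI)
        (fun J hJ => hG J (Finset.mem_filter.1 hJ).1) (fun J hJ => hv J (Finset.mem_filter.1 hJ).1)
        (fun J hJ => hR I hI J (Finset.mem_filter.1 hJ).1 (Finset.mem_filter.1 hJ).2)
        (mul_nonneg hB0 (hc I)) (hB I hI hex)).trans_eq (by ring)
    · rw [Finset.filter_eq_empty_iff.2 fun J hJ h => hex ⟨J, hJ, h⟩]
      simp [fam]
  calc _ ≤ ∑ I ∈ F, |∑ J ∈ G, if R I J then insideTerm k σ w u v I J else 0| :=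
        Finset.abs_sum_le_sum_abs _ _
    _ ≤ ∑ I ∈ F, 2 * B * (l2 σ (u I) * (c I * fam w (G.filter fun J => R I J) v)) :=
        Finset.sum_le_sum hrow
    _ = 2 * B * ∑ I ∈ F, l2 σ (u I) * (c I * fam w (G.filter fun J => R I J) v) := by
        rw [Finset.mul_sum]
    _ ≤ 2 * B * (fam σ F u * √(∑ I ∈ F, (c I * fam w (G.filter fun J => R I J) v) ^ 2)) := by
        gcongr
        exact Real.sum_mul_le_sqrt_mul_sqrt F _ _
    _ ≤ 2 * B * (fam σ F u * (κ * fam w G v)) := by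
        gcongr
        · exact fam_nonneg _ _ _
        apply Real.sqrt_le_iff.2 ⟨mul_nonneg hκ (fam_nonneg _ _ _), ?_⟩
        simp_rw [mul_pow, fam_sq, Finset.mul_sum, Finset.sum_filter]
        rw [Finset.sum_comm]
        refine Finset.sum_le_sum fun J hJ => ?_
        have := hsum J hJ
        rw [Finset.sum_filter] at this
        calc _ = (∑ I ∈ F, if R I J then c I ^ 2 else 0) * l2 w (v J) ^ 2 := by
              rw [Finset.sum_mul]
              refine Finset.sum_congr rfl fun I _ => ?_
              split_ifs <;> ring
          _ ≤ _ := by gcongr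
    _ = _ := by ring

/-- Telescoping: the averages of Haar differences over a family of ancestors of `P` that is closed
upwards sum to an average of the whole function. -/
lemma av_child_eq_sum (hD : IsDyadicGrid D) {u : Itv → ℝ → ℝ} {F : Finset Itv}
    (hF : ∀ I ∈ F, I ∈ D) (hu : ∀ I ∈ F, HaarStep σ I (u I)) {P : Itv} (hP : P ∈ D)
    {S : Finset Itv} (hSF : S ⊆ F) (hS : ∀ I ∈ S, P.toSet ⊆ I.toSet ∧ P.len < I.len)
    {I₀ : Itv} (hI₀ : I₀ ∈ S) (hmin : ∀ I ∈ S, I₀.len ≤ I.len)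
    (hup : ∀ I ∈ F, (I₀.childAt P).toSet ⊆ I.toSet → (I₀.childAt P).len < I.len → I ∈ S)
    (hσ : σ.real (I₀.childAt P).toSet ≠ 0) :
    av σ (fun x => ∑ I ∈ F, u I x) (I₀.childAt P) = ∑ I ∈ S, av σ (u I) (I.childAt P) := by
  classical
  have hI₀D := hF I₀ (hSF hI₀)
  have hPc := hD.subset_childAt hI₀D hP (hS I₀ hI₀).1 (hS I₀ hI₀).2
  rw [av_sum hD hF hu (hD.childAt_mem hI₀D P) hσ]
  have hset : F.filter (fun I => (I₀.childAt P).toSet ⊆ I.toSet ∧ (I₀.childAt P).len < I.len) = S := by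
    ext I
    rw [Finset.mem_filter]
    constructor
    · rintro ⟨h1, h2, h3⟩
      exact hup I h1 h2 h3
    · intro h
      have h1 : I₀.toSet ⊆ I.toSet := hD.subset_of_mem (hF I (hSF h)) hI₀D (hmin I h)
        ((hS I h).1 P.left_mem) ((hS I₀ hI₀).1 P.left_mem)
      refine ⟨hSF h, (I₀.childAt_subset P).trans h1, ?_⟩
      rw [childAt_len]
      have := hmin I h
      have := I₀.len_pos
      linarith
  rw [hset]
  refine Finset.sum_congr rfl fun I hI => ?_
  have hI' := hset ▸ hI
  obtain ⟨h1, h2, h3⟩ := Finset.mem_filter.1 hI'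
  rw [childAt_eq (J := P) (I.childAt_eq_or (I₀.childAt P))
    (hPc.trans (hD.subset_childAt (hF I h1) (hD.childAt_mem hI₀D P) h2 h3))]

open Classical in
/-- The Carleson estimate for the averages attached to neighbours: `ν Q` is a grid interval of the
same length as `Q`, and the sum runs over the ancestors `I` of `Q` whose child at `Q` contains
`ν Q`. -/
lemma sum_sq_neighbour_le (hD : IsDyadicGrid D) (hL : IsLevel D ℓ lev) {u : Itv → ℝ → ℝ}
    {F : Finset Itv} (hF : ∀ I ∈ F, I ∈ D) (hu : ∀ I ∈ F, HaarStep σ I (u I)) {q : ℝ}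
    (Qs : Finset Itv) (hQ : ∀ Q ∈ Qs, Q ∈ D ∧ Q.len = q) (ν : Itv → Itv)
    (hν : ∀ Q ∈ Qs, ν Q ∈ D ∧ (ν Q).len = q) (hinj : Set.InjOn ν Qs) :
    ∑ Q ∈ Qs, (∑ I ∈ F with q < I.len ∧ Q.toSet ⊆ I.toSet ∧ (ν Q).toSet ⊆ (I.childAt Q).toSet,
      av σ (u I) (I.childAt Q)) ^ 2 * σ.real (ν Q).toSet ≤ 4 * fam σ F u ^ 2 := by
  set S : Itv → Finset Itv := fun Q => F.filter fun I =>
    q < I.len ∧ Q.toSet ⊆ I.toSet ∧ (ν Q).toSet ⊆ (I.childAt Q).toSet with hSdef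
  set Qs' := Qs.filter fun Q => (S Q).Nonempty ∧ σ.real (ν Q).toSet ≠ 0
  have hmem : ∀ Q ∈ Qs', Q ∈ Qs ∧ (S Q).Nonempty ∧ σ.real (ν Q).toSet ≠ 0 := fun Q h =>
    Finset.mem_filter.1 h
  have hex : ∀ Q ∈ Qs', ∃ I₀ ∈ S Q, ∀ I ∈ S Q, I₀.len ≤ I.len := fun Q h =>
    (S Q).exists_min_image Itv.len (hmem Q h).2.1
  choose! I₀ hI₀ hmin using hex
  set κ : Itv → Itv := fun Q => (I₀ Q).childAt Q
  have hI₀F : ∀ Q ∈ Qs', I₀ Q ∈ F := fun Q h => (Finset.mem_filter.1 (hI₀ Q h)).1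
  have hsub : ∀ Q ∈ Qs', (ν Q).toSet ⊆ (κ Q).toSet := fun Q h =>
    (Finset.mem_filter.1 (hI₀ Q h)).2.2.2
  have hcar := carleson_embedding hD hL (memLp_sum (σ := σ) hu) Qs' κ
    (fun Q h => hD.childAt_mem (hF _ (hI₀F Q h)) Q) (fun Q => σ.real (ν Q).toSet)
    (fun _ _ => measureReal_nonneg) zero_le_one (fun L hLD => ?_)
  · rw [l2_sum_eq_fam hD hF hu] at hcar
    calc _ = ∑ Q ∈ Qs', (∑ I ∈ S Q, av σ (u I) (I.childAt Q)) ^ 2 * σ.real (ν Q).toSet := by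
          symm
          refine Finset.sum_subset (Finset.filter_subset _ _) fun Q hQ' hQn => ?_
          by_cases h1 : (S Q).Nonempty
          · have h2 : σ.real (ν Q).toSet = 0 := by
              by_contra h2
              exact hQn (Finset.mem_filter.2 ⟨hQ', h1, h2⟩)
            rw [h2, mul_zero]
          · rw [Finset.not_nonempty_iff_eq_empty.1 h1]; simp
      _ = ∑ Q ∈ Qs', σ.real (ν Q).toSet * av σ (fun x => ∑ I ∈ F, u I x) (κ Q) ^ 2 := by
          refine Finset.sum_congr rfl fun Q hQ' => ?_
          obtain ⟨hQs, -, hne⟩ := hmem Q hQ'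
          obtain ⟨hQD, hQl⟩ := hQ Q hQs
          have hSQ : ∀ I ∈ S Q, Q.toSet ⊆ I.toSet ∧ Q.len < I.len := fun I hI => by
            obtain ⟨-, h1, h2, -⟩ := Finset.mem_filter.1 hI
            exact ⟨h2, hQl ▸ h1⟩
          have hI₀D := hF _ (hI₀F Q hQ')
          have hQκ : Q.toSet ⊆ (κ Q).toSet :=
            hD.subset_childAt hI₀D hQD (hSQ _ (hI₀ Q hQ')).1 (hSQ _ (hI₀ Q hQ')).2
          rw [av_child_eq_sum hD hF hu hQD (Finset.filter_subset _ _) hSQ (hI₀ Q hQ')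
            (hmin Q hQ'), mul_comm]
          · intro I hI h1 h2
            refine Finset.mem_filter.2 ⟨hI, ?_, hQκ.trans h1, ?_⟩
            · rw [← hQl]; exact (len_le_of_subset hQκ).trans_lt h2
            · have h3 := hD.subset_childAt (hF I hI) (hD.childAt_mem hI₀D Q) h1 h2
              rw [childAt_eq (J := Q) (I.childAt_eq_or _) (hQκ.trans h3)]
              exact (hsub Q hQ').trans h3
          · intro h0
            apply hne
            exact le_antisymm ((measureReal_mono (hsub Q hQ')
              (((I₀ Q).childAt Q).measure_lt_top σ).ne).trans_eq h0) measureReal_nonneg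
      _ ≤ 4 * fam σ F u ^ 2 := by linarith
  · rw [one_mul, ← measureReal_biUnion_finset (fun Q hQ1 Q' hQ2 hne => ?_)
      (fun Q _ => (ν Q).measurableSet_toSet) (fun Q _ => ((ν Q).measure_lt_top σ).ne)]
    · refine measureReal_mono (Set.iUnion₂_subset fun Q hQ1 => ?_) (L.measure_lt_top σ).ne
      obtain ⟨h1, h2⟩ := Finset.mem_filter.1 hQ1
      exact (hsub Q h1).trans h2
    · have h1 := (hmem Q (Finset.mem_filter.1 hQ1).1).1
      have h2 := (hmem Q' (Finset.mem_filter.1 hQ2).1).1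
      refine Set.disjoint_left.2 fun x hx hx' => hne (hinj h1 h2 ?_)
      exact hD.eq_of_mem (hν Q' h2).1 (hν Q h1).1 ((hν Q h1).2.trans (hν Q' h2).2.symm) hx' hx

end

section

variable {D : Set Itv} {ℓ : ℝ} {lev : Itv → ℤ} {σ w : Measure ℝ} [IsLocallyFiniteMeasure σ]
  [IsLocallyFiniteMeasure w] {k : ℝ → ℝ → ℝ} {a : ℝ}

lemma LocalKernel.abs_bform_ind_le (hA : A2 σ w ≠ ∞) (hk : LocalKernel k a) (K : Itv)
    {h : ℝ → ℝ} (hh : MemLp h 2 w) :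
    |bform k σ w K.ind h| ≤ 60 * rootA2 σ w * (√(σ.real K.toSet) * l2 w h) := by
  have := hk.poissonDominated.abs_bform_le hA (memLp_ind (μ := σ) K) hh
  rw [l2_ind] at this
  linarith

/-- On intervals shorter than the range, the kernel is small compared to the Poisson kernel. -/
lemma LocalKernel.abs_bform_child_le (hA : A2 σ w ≠ ∞) (hk : LocalKernel k a) {I K : Itv}
    (hK : K = I.minus ∨ K = I.plus) {h : ℝ → ℝ} (hh : MemLp h 2 w)
    (hsupp : ∀ x, h x ≠ 0 → x ∈ I.toSet) :
    |bform k σ w K.ind h| ≤ 60 * rootA2 σ w * (I.len / a) * (√(σ.real K.toSet) * l2 w h) := by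
  have ha := hk.pos
  have hI := I.len_pos
  have := TwoWeight.abs_bform_le (t := I.len) (M := 2 * (I.len / a)) hA hk.meas
    (memLp_ind (μ := σ) K) hh (by positivity) hI fun x y hy hx => by
      have hyK : y ∈ K.toSet := by
        by_contra h'; exact hy (ind_of_notMem h')
      have hyI : y ∈ I.toSet := by
        rcases hK with rfl | rfl
        exacts [I.minus_subset hyK, I.plus_subset hyK]
      have hxI := hsupp x hx
      have hxy : |x - y| ≤ I.len := by
        unfold len; rw [abs_le]; constructor <;> linarith [hxI.1, hxI.2, hyI.1, hyI.2]
      calc |k x y| ≤ 1 / a := hk.bound x y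
        _ = (I.len / a) * (1 / I.len) := by field_simp
        _ ≤ (I.len / a) * (2 * pk I.len (x - y)) := by
            gcongr; exact inv_le_two_mul_pk hI hxy
        _ = _ := by ring
  rw [l2_ind] at this
  linarith

open Classical in
/-- Inside pairs whose larger interval is not much longer than the range of the kernel. -/
lemma abs_sum_short_le (hA : A2 σ w ≠ ∞) (hk : LocalKernel k a) (hD : IsDyadicGrid D)
    (hL : IsLevel D ℓ lev)
    {u v : Itv → ℝ → ℝ} {F G : Finset Itv} (hF : ∀ I ∈ F, I ∈ D) (hu : ∀ I ∈ F, HaarStep σ I (u I))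
    (hG : ∀ J ∈ G, J ∈ D) (hv : ∀ J ∈ G, HaarStep w J (v J)) (r : ℕ) {q : ℝ} (hq : 0 < q) :
    |∑ I ∈ F, ∑ J ∈ G, if I.len ≤ q ∧ J.Inside r I then insideTerm k σ w u v I J else 0| ≤
      240 * rootA2 σ w * (q / a) * (fam σ F u * fam w G v) := by
  have ha := hk.pos
  have hR := rootA2_nonneg σ w
  have hX := fam_nonneg σ F u
  have hY := fam_nonneg w G v
  have hsum : ∀ J ∈ G, ∑ I ∈ F with I.len ≤ q ∧ J.Inside r I, (I.len / a) ^ 2 ≤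
      (2 * (q / a)) ^ 2 := by
    intro J _
    calc ∑ I ∈ F with I.len ≤ q ∧ J.Inside r I, (I.len / a) ^ 2
        ≤ ∑ I ∈ F with I.len ≤ q ∧ J.Inside r I, q / a ^ 2 * I.len := by
          refine Finset.sum_le_sum fun I hI => ?_
          have h1 := (Finset.mem_filter.1 hI).2.1
          have := I.len_pos
          rw [div_pow, div_mul_eq_mul_div]
          gcongr
          nlinarith
      _ = q / a ^ 2 * ∑ I ∈ F with I.len ≤ q ∧ J.Inside r I, I.len := by rw [Finset.mul_sum]
      _ ≤ q / a ^ 2 * (2 * q) := by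
          gcongr
          refine hL.sum_len_le hD (x := J.left) hq.le _ fun I hI => ?_
          obtain ⟨h1, h2, h3⟩ := Finset.mem_filter.1 hI
          exact ⟨hF I h1, h3.1 J.left_mem, h2⟩
      _ ≤ (2 * (q / a)) ^ 2 := by
          have : q / a ^ 2 * (2 * q) = 2 * (q / a) ^ 2 := by field_simp
          rw [this]
          nlinarith [sq_nonneg (q / a)]
  have hrows := abs_sum_rows_le (B := 60 * rootA2 σ w) (κ := 2 * (q / a)) hA hk.poissonDominated
    hD hu hG hv (fun I J => I.len ≤ q ∧ J.Inside r I) (fun I _ J _ h => h.2.1) (by positivity)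
    (by positivity) (fun I => I.len / a) (fun I => by have := I.len_pos; positivity)
    (fun I _ _ K hK h hh hs => hk.abs_bform_child_le hA hK hh hs) (by convert hsum)
  refine (le_of_eq ?_).trans (hrows.trans_eq (by ring))
  congr!

open Classical in
/-- Inside pairs with exactly the ratio `2 ^ r` of lengths. -/
lemma abs_sum_ratio_le (hA : A2 σ w ≠ ∞) (hk : LocalKernel k a) (hD : IsDyadicGrid D)
    {u v : Itv → ℝ → ℝ} {F G : Finset Itv} (hF : ∀ I ∈ F, I ∈ D) (hu : ∀ I ∈ F, HaarStep σ I (u I))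
    (hG : ∀ J ∈ G, J ∈ D) (hv : ∀ J ∈ G, HaarStep w J (v J)) (r : ℕ) (q : ℝ) :
    |∑ I ∈ F, ∑ J ∈ G, if q < 2 ^ r * J.len ∧ I.len = 2 ^ r * J.len ∧ J.toSet ⊆ I.toSet then
      insideTerm k σ w u v I J else 0| ≤ 120 * rootA2 σ w * (fam σ F u * fam w G v) := by
  have hR := rootA2_nonneg σ w
  have hcard : ∀ J ∈ G, ∑ I ∈ F with q < 2 ^ r * J.len ∧ I.len = 2 ^ r * J.len ∧
      J.toSet ⊆ I.toSet, (1 : ℝ) ^ 2 ≤ 1 ^ 2 := by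
    intro J _
    simp only [one_pow, Finset.sum_const, nsmul_eq_mul, mul_one]
    rw [← Nat.cast_one (R := ℝ), Nat.cast_le, Finset.card_le_one]
    intro I hI I' hI'
    obtain ⟨h1, -, h2, h3⟩ := Finset.mem_filter.1 hI
    obtain ⟨h4, -, h5, h6⟩ := Finset.mem_filter.1 hI'
    exact hD.eq_of_mem (hF I' h4) (hF I h1) (h2.trans h5.symm) (h6 J.left_mem) (h3 J.left_mem)
  have hrows := abs_sum_rows_le (B := 60 * rootA2 σ w) (κ := 1) hA hk.poissonDominated hD hu hG hv
    (fun I J => q < 2 ^ r * J.len ∧ I.len = 2 ^ r * J.len ∧ J.toSet ⊆ I.toSet)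
    (fun I _ J _ h => h.2.2) (by positivity) zero_le_one (fun _ => 1) (fun I => zero_le_one)
    (fun I _ _ K _ h hh _ => by rw [mul_one]; exact hk.abs_bform_ind_le hA K hh)
    (by convert hcard)
  refine (le_of_eq ?_).trans (hrows.trans_eq (by ring))
  congr!

open Classical in
/-- Inside pairs with `J` short and `I` long compared to a scale `q` beyond the range of the
kernel. The intervals `J` inside a grid interval `Q` of length `q` see the same function
`∑ (average of u I) · (child of I)` on the three neighbours of `Q`, where it is constant and equal
to an average of `∑ u I`. -/
lemma abs_sum_neighbours_le (hA : A2 σ w ≠ ∞) (hk : LocalKernel k a) (hD : IsDyadicGrid D)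
    (hL : IsLevel D ℓ lev)
    {u v : Itv → ℝ → ℝ} {F G : Finset Itv} (hF : ∀ I ∈ F, I ∈ D) (hu : ∀ I ∈ F, HaarStep σ I (u I))
    (hG : ∀ J ∈ G, J ∈ D) (hv : ∀ J ∈ G, HaarStep w J (v J)) (r : ℕ) {q : ℝ} (haq : a ≤ q)
    (hq : ∃ Q ∈ D, Q.len = q) :
    |∑ I ∈ F, ∑ J ∈ G, if q < I.len ∧ 2 ^ r * J.len ≤ q ∧ J.toSet ⊆ I.toSet then
      insideTerm k σ w u v I J else 0| ≤ 360 * rootA2 σ w * (fam σ F u * fam w G v) := by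
  have hR := rootA2_nonneg σ w
  have hex : ∀ J : Itv, ∃ Q ∈ D, Q.len = q ∧ J.left ∈ Q.toSet := by
    intro J
    obtain ⟨Q, hQ, hQl⟩ := hq
    obtain ⟨Q', h1, h2, h3⟩ := hD.exists_mem hQ J.left
    exact ⟨Q', h1, h2.trans hQl, h3⟩
  choose anc hancD hancl hancm using hex
  have hlt : ∀ I ∈ D, ∃ L ∈ D, L.len = I.len ∧ L.right = I.left := fun I hI =>
    hD.exists_left_neighbour hI
  have hrt : ∀ I ∈ D, ∃ R ∈ D, R.len = I.len ∧ R.left = I.right := fun I hI =>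
    hD.exists_right_neighbour hI
  choose! lt hltD hltl hltr using hlt
  choose! rt hrtD hrtl hrtr using hrt
  -- the three neighbours of `Q`; together they contain all points within distance `q` of `Q`
  set ν : Fin 3 → Itv → Itv := ![lt, id, rt] with hνdef
  set Gs := G.filter fun J => 2 ^ r * J.len ≤ q with hGs
  have hGsG : Gs ⊆ G := Finset.filter_subset _ _
  have hancs : ∀ J ∈ Gs, J.toSet ⊆ (anc J).toSet := by
    intro J hJ
    obtain ⟨h1, h2⟩ := Finset.mem_filter.1 hJ
    refine hD.subset_of_mem (hancD J) (hG J h1) ?_ (hancm J) J.left_mem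
    rw [hancl]
    have := J.len_pos
    have h3 : (1 : ℝ) ≤ 2 ^ r := one_le_pow₀ (by norm_num)
    nlinarith
  set Qs := Gs.image anc with hQs
  have hQsD : ∀ Q ∈ Qs, Q ∈ D ∧ Q.len = q := by
    intro Q hQ
    obtain ⟨J, hJ, rfl⟩ := Finset.mem_image.1 hQ
    exact ⟨hancD J, hancl J⟩
  have hνD : ∀ i, ∀ Q ∈ D, ν i Q ∈ D ∧ (ν i Q).len = Q.len := by
    intro i Q h1
    fin_cases i
    · exact ⟨hltD Q h1, hltl Q h1⟩
    · exact ⟨h1, rfl⟩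
    · exact ⟨hrtD Q h1, hrtl Q h1⟩
  have hνinj : ∀ i, Set.InjOn (ν i) Qs := by
    intro i Q hQ Q' hQ' he
    obtain ⟨h1, h2⟩ := hQsD Q hQ
    obtain ⟨h3, h4⟩ := hQsD Q' hQ'
    have hl : Q.len = Q'.len := h2.trans h4.symm
    fin_cases i
    · have e : Q.left = Q'.left := by
        rw [← hltr Q h1, ← hltr Q' h3]; exact congrArg Itv.right he
      unfold len at hl
      ext
      · exact e
      · linarith
    · exact he
    · have e : Q.right = Q'.right := by
        rw [← hrtr Q h1, ← hrtr Q' h3]; exact congrArg Itv.left he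
      unfold len at hl
      ext
      · linarith
      · exact e
  -- near `Q`, an interval much longer than `Q` is the union of the neighbours of `Q` inside it
  have hpoint : ∀ Q ∈ D, Q.len = q → ∀ K ∈ D, q ≤ K.len → ∀ x ∈ Q.toSet, ∀ y, k x y * K.ind y =
      k x y * ∑ i, if (ν i Q).toSet ⊆ K.toSet then (ν i Q).ind y else 0 := by
    intro Q hQD hQq K hKD hKq x hx y
    by_cases hxy : a < |x - y|
    · rw [hk.support x y hxy, zero_mul, zero_mul]
    congr 1
    have hxy' := abs_le.1 (not_lt.1 hxy)
    have h1 : (ν 0 Q).right = Q.left := hltr Q hQD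
    have h2 : (ν 2 Q).left = Q.right := hrtr Q hQD
    have h3 : (ν 0 Q).len = q := (hνD 0 Q hQD).2.trans hQq
    have h4 : (ν 2 Q).len = q := (hνD 2 Q hQD).2.trans hQq
    have h5 : ν 1 Q = Q := rfl
    have hcase : ∃ i, y ∈ (ν i Q).toSet ∧ ∀ j, j ≠ i → y ∉ (ν j Q).toSet := by
      unfold len at h3 h4 hQq
      rcases lt_or_ge y Q.left with hy | hy
      · refine ⟨0, ⟨by linarith [hx.1], by linarith⟩, fun j hj => ?_⟩
        fin_cases j
        · exact absurd rfl hj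
        · exact fun h => absurd h.1 (not_le.2 hy)
        · exact fun h => by have := h.1; simp only [Fin.reduceFinMk] at this; linarith [Q.lt]
      rcases lt_or_ge y Q.right with hy' | hy'
      · refine ⟨1, ⟨hy, hy'⟩, fun j hj => ?_⟩
        fin_cases j
        · exact fun h => by have := h.2; simp only [Fin.zero_eta] at this; linarith
        · exact absurd rfl hj
        · exact fun h => by have := h.1; simp only [Fin.reduceFinMk] at this; linarith
      · refine ⟨2, ⟨by linarith, by linarith [hx.2]⟩, fun j hj => ?_⟩
        fin_cases j
        · exact fun h => by have := h.2; simp only [Fin.zero_eta] at this; linarith [Q.lt]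
        · exact fun h => absurd h.2 (not_lt.2 hy')
        · exact absurd rfl hj
    obtain ⟨i, hi, hj⟩ := hcase
    rw [Finset.sum_eq_single i (fun j _ hne => by rw [ind_of_notMem (hj j hne), ite_self])
      (fun h => absurd (Finset.mem_univ i) h), ind_of_mem hi]
    by_cases hyK : y ∈ K.toSet
    · rw [ind_of_mem hyK, if_pos]
      exact hD.subset_of_mem hKD (hνD i Q hQD).1 (by rw [(hνD i Q hQD).2, hQq]; exact hKq) hyK hi
    · rw [ind_of_notMem hyK, if_neg fun h => hyK (h hi)]
  set s : Fin 3 → Itv → ℝ := fun i Q => ∑ I ∈ F with q < I.len ∧ Q.toSet ⊆ I.toSet ∧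
    (ν i Q).toSet ⊆ (I.childAt Q).toSet, av σ (u I) (I.childAt Q) with hs
  have hterm : ∀ J ∈ Gs, ∑ I ∈ F, (if q < I.len ∧ J.toSet ⊆ I.toSet then
      insideTerm k σ w u v I J else 0) =
      ∑ i, s i (anc J) * bform k σ w (ν i (anc J)).ind (v J) := by
    intro J hJ
    have hJG := hGsG hJ
    have hvJ := hv J hJG
    have h1 : ∀ I ∈ F, (if q < I.len ∧ J.toSet ⊆ I.toSet then insideTerm k σ w u v I J else 0) =
        ∑ i, (if q < I.len ∧ (anc J).toSet ⊆ I.toSet ∧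
          (ν i (anc J)).toSet ⊆ (I.childAt (anc J)).toSet then av σ (u I) (I.childAt (anc J)) *
            bform k σ w (ν i (anc J)).ind (v J) else 0) := by
      intro I hI
      have hID := hF I hI
      by_cases hc : q < I.len ∧ J.toSet ⊆ I.toSet
      · have hQI : (anc J).toSet ⊆ I.toSet := hD.subset_of_mem hID (hancD J)
          (by rw [hancl]; exact hc.1.le) (hc.2 J.left_mem) (hancm J)
        have hQc := hD.subset_childAt hID (hancD J) hQI (by rw [hancl]; exact hc.1)
        have hch : I.childAt J = I.childAt (anc J) :=
          childAt_eq (I.childAt_eq_or _) ((hancs J hJ).trans hQc)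
        rw [if_pos hc, insideTerm, hch]
        have hlen : q ≤ (I.childAt (anc J)).len := by
          rw [childAt_len]
          have := hL.two_mul_len_le hID (hancD J) (by rw [hancl]; exact hc.1)
          rw [hancl] at this; linarith
        have e : bform k σ w (I.childAt (anc J)).ind (v J) =
            bform k σ w (fun y => ∑ i, (if (ν i (anc J)).toSet ⊆ (I.childAt (anc J)).toSet then
              (1 : ℝ) else 0) * (ν i (anc J)).ind y) (v J) := by
          apply bform_congr
          intro x y
          by_cases hx : x ∈ J.toSet
          · have := hpoint (anc J) (hancD J) (hancl J) _ (hD.childAt_mem hID _) hlen x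
              (hancs J hJ hx) y
            rw [← mul_assoc, this, mul_assoc]
            congr 3
            ext i
            split_ifs <;> simp
          · rw [hvJ.eq_zero_of_notMem hx]; ring
        rw [e, hk.poissonDominated.bform_sum_left hA _
          (fun i _ => (memLp_ind _).const_mul _) hvJ.memLp, Finset.mul_sum]
        refine Finset.sum_congr rfl fun i _ => ?_
        rw [bform_const_mul_left]
        by_cases hi : (ν i (anc J)).toSet ⊆ (I.childAt (anc J)).toSet
        · rw [if_pos hi, if_pos ⟨hc.1, hQI, hi⟩, one_mul]
        · rw [if_neg hi, if_neg fun h => hi h.2.2]; ring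
      · rw [if_neg hc, Finset.sum_eq_zero]
        intro i _
        rw [if_neg fun h => hc ⟨h.1, (hancs J hJ).trans h.2.1⟩]
    rw [Finset.sum_congr rfl h1, Finset.sum_comm]
    refine Finset.sum_congr rfl fun i _ => ?_
    rw [hs, Finset.sum_mul, Finset.sum_filter]
  have hdecomp : ∑ I ∈ F, ∑ J ∈ G, (if q < I.len ∧ 2 ^ r * J.len ≤ q ∧ J.toSet ⊆ I.toSet then
      insideTerm k σ w u v I J else 0) = ∑ i, ∑ Q ∈ Qs,
      s i Q * bform k σ w (ν i Q).ind (fun x => ∑ J ∈ Gs with anc J = Q, v J x) := by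
    rw [Finset.sum_comm]
    calc _ = ∑ J ∈ Gs, ∑ I ∈ F, (if q < I.len ∧ J.toSet ⊆ I.toSet then
          insideTerm k σ w u v I J else 0) := by
          rw [hGs, Finset.sum_filter]
          refine Finset.sum_congr rfl fun J _ => ?_
          split_ifs with h
          · refine Finset.sum_congr rfl fun I _ => ?_
            simp only [h, true_and]
          · refine Finset.sum_eq_zero fun I _ => ?_
            rw [if_neg fun h' => h h'.2.1]
      _ = ∑ J ∈ Gs, ∑ i, s i (anc J) * bform k σ w (ν i (anc J)).ind (v J) :=
          Finset.sum_congr rfl hterm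
      _ = ∑ i, ∑ J ∈ Gs, s i (anc J) * bform k σ w (ν i (anc J)).ind (v J) := Finset.sum_comm
      _ = _ := by
          refine Finset.sum_congr rfl fun i _ => ?_
          rw [← Finset.sum_fiberwise_of_maps_to (s := Gs) (t := Qs) (g := anc)
            (fun J hJ => Finset.mem_image_of_mem _ hJ)]
          refine Finset.sum_congr rfl fun Q _ => ?_
          rw [hk.poissonDominated.bform_sum_right hA _ (memLp_ind _) (fun J hJ =>
            (hv J (hGsG (Finset.mem_filter.1 hJ).1)).memLp), Finset.mul_sum]
          refine Finset.sum_congr rfl fun J hJ => ?_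
          rw [(Finset.mem_filter.1 hJ).2]
  have hi : ∀ i, |∑ Q ∈ Qs, s i Q *
      bform k σ w (ν i Q).ind (fun x => ∑ J ∈ Gs with anc J = Q, v J x)| ≤
      120 * rootA2 σ w * (fam σ F u * fam w G v) := by
    intro i
    have hnb := sum_sq_neighbour_le hD hL hF hu Qs hQsD (ν i) (fun Q hQ =>
      ⟨(hνD i Q (hQsD Q hQ).1).1, (hνD i Q (hQsD Q hQ).1).2.trans (hQsD Q hQ).2⟩) (hνinj i)
    calc _ ≤ ∑ Q ∈ Qs, |s i Q *
          bform k σ w (ν i Q).ind (fun x => ∑ J ∈ Gs with anc J = Q, v J x)| :=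
          Finset.abs_sum_le_sum_abs _ _
      _ ≤ ∑ Q ∈ Qs, 60 * rootA2 σ w * ((|s i Q| * √(σ.real (ν i Q).toSet)) *
            fam w (Gs.filter fun J => anc J = Q) v) := by
          refine Finset.sum_le_sum fun Q _ => ?_
          have hsub : ∀ J ∈ Gs.filter (fun J => anc J = Q), J ∈ G := fun J hJ =>
            hGsG (Finset.mem_filter.1 hJ).1
          have h1 := hk.abs_bform_ind_le hA (ν i Q) (memLp_sum fun J hJ => hv J (hsub J hJ))
          rw [l2_sum_eq_fam hD (fun J hJ => hG J (hsub J hJ)) fun J hJ => hv J (hsub J hJ)] at h1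
          rw [abs_mul]
          calc _ ≤ |s i Q| * _ := mul_le_mul_of_nonneg_left h1 (abs_nonneg _)
            _ = _ := by ring
      _ = 60 * rootA2 σ w * ∑ Q ∈ Qs, (|s i Q| * √(σ.real (ν i Q).toSet)) *
            fam w (Gs.filter fun J => anc J = Q) v := by rw [Finset.mul_sum]
      _ ≤ 60 * rootA2 σ w * (√(∑ Q ∈ Qs, (|s i Q| * √(σ.real (ν i Q).toSet)) ^ 2) *
            √(∑ Q ∈ Qs, fam w (Gs.filter fun J => anc J = Q) v ^ 2)) := by
          gcongr
          exact Real.sum_mul_le_sqrt_mul_sqrt _ _ _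
      _ ≤ 60 * rootA2 σ w * ((2 * fam σ F u) * fam w G v) := by
          gcongr
          · have := fam_nonneg σ F u; positivity
          · rw [Real.sqrt_le_left (by have := fam_nonneg σ F u; positivity)]
            simp_rw [mul_pow, sq_abs, Real.sq_sqrt (measureReal_nonneg (μ := σ))]
            refine hnb.trans_eq (by ring)
          · rw [Real.sqrt_le_left (fam_nonneg _ _ _)]
            simp_rw [fam_sq]
            rw [Finset.sum_fiberwise_of_maps_to (g := anc) (t := Qs)
              (fun J hJ => Finset.mem_image_of_mem _ hJ)]
            exact Finset.sum_le_sum_of_subset_of_nonneg hGsG fun _ _ _ => sq_nonneg _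
      _ = _ := by ring
  rw [hdecomp]
  calc _ ≤ ∑ i : Fin 3, |∑ Q ∈ Qs, s i Q *
      bform k σ w (ν i Q).ind (fun x => ∑ J ∈ Gs with anc J = Q, v J x)| :=
        Finset.abs_sum_le_sum_abs _ _
    _ ≤ ∑ i : Fin 3, 120 * rootA2 σ w * (fam σ F u * fam w G v) :=
        Finset.sum_le_sum fun i _ => hi i
    _ = _ := by rw [Finset.sum_const, Finset.card_univ, Fintype.card_fin]; simp; ring

end

section

variable {D : Set Itv} {ℓ : ℝ} {lev : Itv → ℤ} {σ w : Measure ℝ} [IsLocallyFiniteMeasure σ]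
  [IsLocallyFiniteMeasure w] {k : ℝ → ℝ → ℝ} {a ε : ℝ} {r : ℕ}

/-- Between two lengths, the geometric mean dominates the smaller one. -/
lemma le_rpow_mul_rpow {x y : ℝ} (hx : 0 < x) (hxy : x ≤ y) (hε : ε ≤ 1) :
    x ≤ x ^ ε * y ^ (1 - ε) := by
  calc x = x ^ ε * x ^ (1 - ε) := by rw [← Real.rpow_add hx]; simp
    _ ≤ _ := by gcongr

open Classical in
/-- Inside pairs with `J` longer than the range of the kernel and much shorter than `I`. By
goodness `J` lies deep inside the child of `I` containing it, so that the kernel cannot see the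
boundary of that child; the sum over `I` telescopes and leaves a paraproduct. -/
lemma abs_sum_paraproduct_le (hA : A2 σ w ≠ ∞) (hk : LocalKernel k a) (hD : IsDyadicGrid D)
    (hL : IsLevel D ℓ lev) (hε' : ε ≤ 1)
    {u v : Itv → ℝ → ℝ} {F G : Finset Itv} (hF : ∀ I ∈ F, I ∈ D) (hu : ∀ I ∈ F, HaarStep σ I (u I))
    (hG : ∀ J ∈ G, J ∈ D ∧ IsGood D ε r J) (hv : ∀ J ∈ G, HaarStep w J (v J)) :
    |∑ I ∈ F, ∑ J ∈ G, if a < J.len ∧ 2 ^ (r + 1) * J.len ≤ I.len ∧ J.toSet ⊆ I.toSet then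
      insideTerm k σ w u v I J else 0| ≤ 120 * rootA2 σ w * (fam σ F u * fam w G v) := by
  have hR := rootA2_nonneg σ w
  have hX := fam_nonneg σ F u
  set S : Itv → Finset Itv := fun J => F.filter fun I =>
    2 ^ (r + 1) * J.len ≤ I.len ∧ J.toSet ⊆ I.toSet with hSdef
  have h2r : (1 : ℝ) < 2 ^ (r + 1) := one_lt_pow₀ (by norm_num) (by omega)
  have hSmem : ∀ J, ∀ I ∈ S J, I ∈ F ∧ 2 ^ (r + 1) * J.len ≤ I.len ∧ J.toSet ⊆ I.toSet :=
    fun J I hI => Finset.mem_filter.1 hI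
  have hSlt : ∀ J, ∀ I ∈ S J, J.toSet ⊆ I.toSet ∧ J.len < I.len := by
    intro J I hI
    obtain ⟨-, h2, h3⟩ := hSmem J I hI
    have := J.len_pos
    exact ⟨h3, by nlinarith⟩
  set G₁ := G.filter fun J => a < J.len ∧ (S J).Nonempty
  have hG₁G : G₁ ⊆ G := Finset.filter_subset _ _
  have hex : ∀ J ∈ G₁, ∃ I₀ ∈ S J, ∀ I ∈ S J, I₀.len ≤ I.len := fun J hJ =>
    (S J).exists_min_image Itv.len (Finset.mem_filter.1 hJ).2.2
  choose! I₀ hI₀ hmin using hex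
  set κ : Itv → Itv := fun J => (I₀ J).childAt J
  have hI₀D : ∀ J ∈ G₁, I₀ J ∈ D := fun J hJ => hF _ (hSmem J _ (hI₀ J hJ)).1
  have hκD : ∀ J ∈ G₁, κ J ∈ D := fun J hJ => hD.childAt_mem (hI₀D J hJ) J
  have hJκ : ∀ J ∈ G₁, J.toSet ⊆ (κ J).toSet := fun J hJ =>
    hD.subset_childAt (hI₀D J hJ) (hG J (hG₁G hJ)).1 (hSlt J _ (hI₀ J hJ)).1
      (hSlt J _ (hI₀ J hJ)).2
  -- the kernel does not see the complement of `κ J` from `J`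
  have hdeep : ∀ J ∈ G₁, ∀ x ∈ J.toSet, ∀ y, y ∉ (κ J).toSet → k x y = 0 := by
    intro J hJ x hx y hy
    apply hk.support
    obtain ⟨-, h1, h2⟩ := hSmem J _ (hI₀ J hJ)
    obtain ⟨hJD, hJg⟩ := hG J (hG₁G hJ)
    have h3 := hJg.le_abs_sub_of_subset hD (hI₀D J hJ) hJD h1 h2 hx hy
    have h4 := le_rpow_mul_rpow J.len_pos (hSlt J _ (hI₀ J hJ)).2.le hε'
    have h5 := (Finset.mem_filter.1 hJ).2.1
    linarith
  have hrepl : ∀ J ∈ G₁, ∀ K : Itv, (κ J).toSet ⊆ K.toSet → ∀ c : ℝ,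
      bform k σ w K.ind (fun x => c * v J x) = bform k σ w (κ J).ind (fun x => c * v J x) := by
    intro J hJ K hK c
    apply bform_congr
    intro x y
    by_cases hx : x ∈ J.toSet
    · by_cases hy : y ∈ (κ J).toSet
      · rw [ind_of_mem hy, ind_of_mem (hK hy)]
      · rw [hdeep J hJ x hx y hy]; ring
    · rw [(hv J (hG₁G hJ)).eq_zero_of_notMem hx]; ring
  -- all ancestors of `J` can be replaced by the smallest one, `I₀ J`, so only averages are summed
  set s : Itv → ℝ := fun J => ∑ I ∈ S J, av σ (u I) (I.childAt J) with hs
  have hdecomp : ∑ I ∈ F, ∑ J ∈ G, (if a < J.len ∧ 2 ^ (r + 1) * J.len ≤ I.len ∧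
      J.toSet ⊆ I.toSet then insideTerm k σ w u v I J else 0) =
      ∑ J ∈ G₁, s J * bform k σ w (κ J).ind (v J) := by
    rw [Finset.sum_comm, Finset.sum_filter]
    refine Finset.sum_congr rfl fun J hJ => ?_
    split_ifs with h
    · have hJ₁ : J ∈ G₁ := Finset.mem_filter.2 ⟨hJ, h⟩
      rw [hs, Finset.sum_mul, Finset.sum_filter]
      refine Finset.sum_congr rfl fun I hI => ?_
      simp only [h.1, true_and]
      split_ifs with h'
      · have hIS : I ∈ S J := Finset.mem_filter.2 ⟨hI, h'⟩
        have h1 : (I₀ J).toSet ⊆ I.toSet := hD.subset_of_mem (hF I hI) (hI₀D J hJ₁)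
          (hmin J hJ₁ I hIS) (h'.2 J.left_mem) ((hSlt J _ (hI₀ J hJ₁)).1 J.left_mem)
        have h2 : (κ J).toSet ⊆ (I.childAt J).toSet := by
          have h3 := hD.subset_childAt (hF I hI) (hκD J hJ₁) (((I₀ J).childAt_subset J).trans h1)
            (by
              have := hmin J hJ₁ I hIS
              have := (I₀ J).len_pos
              simp only [κ, childAt_len]; linarith)
          rwa [childAt_eq (J := J) (I.childAt_eq_or _) ((hJκ J hJ₁).trans h3)]
        have h4 := hrepl J hJ₁ _ h2 1
        simp only [one_mul] at h4
        rw [insideTerm, h4]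
      · rfl
    · refine Finset.sum_eq_zero fun I hI => ?_
      rw [if_neg]
      rintro ⟨h1, h2⟩
      exact h ⟨h1, I, Finset.mem_filter.2 ⟨hI, h2⟩⟩
  -- the coefficients `β J` of the paraproduct, normalized so that `v J` has norm `1`
  set y : Itv → ℝ := fun J => l2 w (v J)
  set β : Itv → ℝ := fun J => bform k σ w (κ J).ind (fun x => (y J)⁻¹ * v J x)
  have hβ : ∀ J ∈ G₁, bform k σ w (κ J).ind (v J) = β J * y J := by
    intro J hJ
    simp only [β]
    rw [bform_const_mul_right]
    by_cases h0 : y J = 0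
    · have := hk.abs_bform_ind_le hA (κ J) (hv J (hG₁G hJ)).memLp
      rw [show l2 w (v J) = 0 from h0, mul_zero, mul_zero] at this
      rw [abs_nonpos_iff.1 this]; ring
    · field_simp
  -- the averages telescope only over intervals of positive mass; the others contribute nothing
  set G₂ := G₁.filter fun J => σ.real (κ J).toSet ≠ 0
  have hG₂ : G₂ ⊆ G₁ := Finset.filter_subset _ _
  have hav : ∀ J ∈ G₂, av σ (fun x => ∑ I ∈ F, u I x) (κ J) = s J := by
    intro J hJ
    have hJ₁ := hG₂ hJ
    refine av_child_eq_sum hD hF hu (hG J (hG₁G hJ₁)).1 (Finset.filter_subset _ _) (hSlt J)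
      (hI₀ J hJ₁) (hmin J hJ₁) (fun I hI h1 h2 => ?_) (Finset.mem_filter.1 hJ).2
    refine Finset.mem_filter.2 ⟨hI, ?_, (hJκ J hJ₁).trans h1⟩
    have h3 := hL.two_mul_len_le (hF I hI) (hκD J hJ₁) h2
    have h4 := (hSmem J _ (hI₀ J hJ₁)).2.1
    simp only [κ, childAt_len] at h3
    linarith
  have hcar : ∑ J ∈ G₂, β J ^ 2 * s J ^ 2 ≤ 4 * (60 * rootA2 σ w) ^ 2 * fam σ F u ^ 2 := by
    have h := carleson_embedding hD hL (memLp_sum (σ := σ) hu) G₂ κ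
      (fun J hJ => hκD J (hG₂ hJ)) (fun J => β J ^ 2) (fun _ _ => sq_nonneg _)
      (c := (60 * rootA2 σ w) ^ 2) (sq_nonneg _) (fun L hLD => ?_)
    · rw [l2_sum_eq_fam hD hF hu] at h
      refine (le_of_eq (Finset.sum_congr rfl fun J hJ => ?_)).trans h
      rw [hav J hJ]
    · -- the Carleson condition for `β J ^ 2`: by duality, the form on `L` and `∑ β J * v J / y J`
      set T := G₂.filter fun J => (κ J).toSet ⊆ L.toSet
      have hT₁ : T ⊆ G₁ := (Finset.filter_subset _ _).trans hG₂
      have e : ∑ J ∈ T, β J ^ 2 =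
          bform k σ w L.ind (fun x => ∑ J ∈ T, β J * (y J)⁻¹ * v J x) := by
        rw [hk.poissonDominated.bform_sum_right hA _ (memLp_ind _) fun J hJ =>
          (hv J (hG₁G (hT₁ hJ))).memLp.const_mul _]
        refine Finset.sum_congr rfl fun J hJ => ?_
        rw [hrepl J (hT₁ hJ) L (Finset.mem_filter.1 hJ).2 (β J * (y J)⁻¹), sq,
          bform_const_mul_right]
        simp only [β]
        rw [bform_const_mul_right]
        ring
      have hHaar : ∀ J ∈ T, HaarStep w J (fun x => β J * (y J)⁻¹ * v J x) := fun J hJ =>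
        (hv J (hG₁G (hT₁ hJ))).const_mul _
      have h1 := hk.abs_bform_ind_le hA L (memLp_sum hHaar)
      rw [l2_sum_eq_fam hD (fun J hJ => (hG J (hG₁G (hT₁ hJ))).1) hHaar, ← e,
        abs_of_nonneg (Finset.sum_nonneg fun _ _ => sq_nonneg _)] at h1
      have h2 : fam w T (fun J x => β J * (y J)⁻¹ * v J x) ≤ √(∑ J ∈ T, β J ^ 2) := by
        apply Real.sqrt_le_sqrt
        refine Finset.sum_le_sum fun J _ => ?_
        rw [l2_const_mul, mul_pow, sq_abs, mul_pow, mul_assoc, ← mul_pow]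
        have h3 : (y J)⁻¹ * l2 w (v J) ≤ 1 := inv_mul_le_one
        have h4 : 0 ≤ (y J)⁻¹ * l2 w (v J) :=
          mul_nonneg (inv_nonneg.2 (l2_nonneg _ _)) (l2_nonneg _ _)
        have h5 : ((y J)⁻¹ * l2 w (v J)) ^ 2 ≤ 1 := pow_le_one₀ h4 h3
        nlinarith [sq_nonneg (β J)]
      set V := ∑ J ∈ T, β J ^ 2
      have h0 : 0 ≤ V := Finset.sum_nonneg fun _ _ => sq_nonneg _
      have h3 : V ≤ 60 * rootA2 σ w * √(σ.real L.toSet) * √V := by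
        calc V ≤ _ := h1
          _ ≤ 60 * rootA2 σ w * (√(σ.real L.toSet) * √V) := by gcongr
          _ = _ := by ring
      have h4 : √V ≤ 60 * rootA2 σ w * √(σ.real L.toSet) := by
        rcases (Real.sqrt_nonneg V).eq_or_lt with h5 | h5
        · rw [← h5]; positivity
        · refine le_of_mul_le_mul_right ?_ h5
          rwa [Real.mul_self_sqrt h0]
      calc V = √V ^ 2 := (Real.sq_sqrt h0).symm
        _ ≤ (60 * rootA2 σ w * √(σ.real L.toSet)) ^ 2 := by gcongr
        _ = _ := by rw [mul_pow, Real.sq_sqrt measureReal_nonneg]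
  have hred : ∑ J ∈ G₁, s J * bform k σ w (κ J).ind (v J) = ∑ J ∈ G₂, (β J * s J) * y J := by
    symm
    rw [Finset.sum_subset hG₂]
    · refine Finset.sum_congr rfl fun J hJ => ?_
      rw [hβ J hJ]; ring
    · intro J hJ hJ₂
      have h0 : σ.real (κ J).toSet = 0 := by
        by_contra h0
        exact hJ₂ (Finset.mem_filter.2 ⟨hJ, h0⟩)
      have := hk.abs_bform_ind_le hA (κ J) (hv J (hG₁G hJ)).memLp
      rw [h0, Real.sqrt_zero, zero_mul, mul_zero, abs_nonpos_iff, hβ J hJ] at this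
      linear_combination s J * this
  rw [hdecomp, hred]
  calc |∑ J ∈ G₂, (β J * s J) * y J| ≤ ∑ J ∈ G₂, |β J * s J| * y J := by
        refine (Finset.abs_sum_le_sum_abs _ _).trans (le_of_eq ?_)
        refine Finset.sum_congr rfl fun J _ => ?_
        rw [abs_mul _ (y J), abs_of_nonneg (l2_nonneg w (v J) : 0 ≤ y J)]
    _ ≤ √(∑ J ∈ G₂, |β J * s J| ^ 2) * √(∑ J ∈ G₂, y J ^ 2) :=
        Real.sum_mul_le_sqrt_mul_sqrt _ _ _
    _ ≤ (120 * rootA2 σ w * fam σ F u) * fam w G v := by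
        gcongr
        · rw [Real.sqrt_le_left (by positivity)]
          simp_rw [sq_abs, mul_pow]
          refine hcar.trans_eq (by ring)
        · exact fam_mono w (hG₂.trans hG₁G) v
    _ = _ := by ring

/-- The constant in the bound for inside sums of local kernels. -/
noncomputable def insideConst (r : ℕ) : ℝ := 240 * 2 ^ (r + 1) + 600

open Classical in
/-- Inside sums for a kernel of bounded range are bounded by the square root of `A₂` alone. With `q`
a length of the grid comparable to `2 ^ r * a`, there are four kinds of pairs: `|I| ≤ q`; `2 ^ r *
|J| ≤ q < |I|`; and for `2 ^ r * |J| > q`, where `|J| > a`, the extreme ratio `|I| = 2 ^ r * |J|`,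
which goodness does not reach, and the larger ratios. -/
theorem abs_sum_inside_le (hA : A2 σ w ≠ ∞) (hk : LocalKernel k a) (hD : IsDyadicGrid D)
    (hε' : ε ≤ 1)
    {u v : Itv → ℝ → ℝ} {F G : Finset Itv} (hF : ∀ I ∈ F, I ∈ D) (hu : ∀ I ∈ F, HaarStep σ I (u I))
    (hG : ∀ J ∈ G, J ∈ D ∧ IsGood D ε r J) (hv : ∀ J ∈ G, HaarStep w J (v J)) :
    |∑ I ∈ F, ∑ J ∈ G, if J.Inside r I then insideTerm k σ w u v I J else 0| ≤
      insideConst r * rootA2 σ w * (fam σ F u * fam w G v) := by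
  obtain ⟨ℓ, lev, hL⟩ := hD.exists_isLevel
  have ha := hk.pos
  -- a length `q` of the grid between `2 ^ r * a` and twice as much
  obtain ⟨m, hm⟩ := exists_mem_Ioc_zpow (x := 2 ^ r * a / ℓ * 2) (y := (2 : ℝ))
    (by have := hL.pos; positivity) (by norm_num)
  obtain ⟨Q, hQD, hQl⟩ := hL.exists_len m
  set q := Q.len with hq
  have hq1 : q < 2 ^ (r + 1) * a := by
    rw [hQl, pow_succ]
    have := (lt_div_iff₀ hL.pos).1 (show (2 : ℝ) ^ m < 2 ^ r * a * 2 / ℓ by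
      rw [mul_div_right_comm]; exact hm.1)
    linarith
  have hq2 : 2 ^ r * a ≤ q := by
    rw [hQl]
    have h1 := hm.2
    rw [zpow_add_one₀ (by norm_num)] at h1
    have h2 := (div_le_iff₀ hL.pos).1 (show 2 ^ r * a / ℓ ≤ (2 : ℝ) ^ m by linarith)
    exact h2
  have h1r : (1 : ℝ) ≤ 2 ^ r := one_le_pow₀ (by norm_num)
  have haq : a ≤ q := by nlinarith
  have hqpos : 0 < q := Q.len_pos
  have hGD : ∀ J ∈ G, J ∈ D := fun J hJ => (hG J hJ).1
  have b1 := abs_sum_short_le hA hk hD hL hF hu hGD hv r hqpos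
  have b2 := abs_sum_ratio_le hA hk hD hF hu hGD hv r q
  have b3 := abs_sum_neighbours_le hA hk hD hL hF hu hGD hv r haq ⟨Q, hQD, rfl⟩
  have hG' : ∀ J ∈ G.filter (fun J => q < 2 ^ r * J.len), J ∈ G := fun J hJ =>
    (Finset.mem_filter.1 hJ).1
  have b4 := abs_sum_paraproduct_le hA hk hD hL hε' hF hu (fun J hJ => hG J (hG' J hJ))
    (fun J hJ => hv J (hG' J hJ))
  have hfam : fam w (G.filter fun J => q < 2 ^ r * J.len) v ≤ fam w G v :=
    fam_mono w (Finset.filter_subset _ _) v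
  have hdecomp : ∑ I ∈ F, ∑ J ∈ G, (if J.Inside r I then insideTerm k σ w u v I J else 0) =
      ∑ I ∈ F, ∑ J ∈ G, (if I.len ≤ q ∧ J.Inside r I then insideTerm k σ w u v I J else 0) +
      ∑ I ∈ F, ∑ J ∈ G, (if q < 2 ^ r * J.len ∧ I.len = 2 ^ r * J.len ∧ J.toSet ⊆ I.toSet then
        insideTerm k σ w u v I J else 0) +
      ∑ I ∈ F, ∑ J ∈ G, (if q < I.len ∧ 2 ^ r * J.len ≤ q ∧ J.toSet ⊆ I.toSet then
        insideTerm k σ w u v I J else 0) +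
      ∑ I ∈ F, ∑ J ∈ G with q < 2 ^ r * J.len, (if a < J.len ∧ 2 ^ (r + 1) * J.len ≤ I.len ∧
        J.toSet ⊆ I.toSet then insideTerm k σ w u v I J else 0) := by
    simp only [← Finset.sum_add_distrib]
    refine Finset.sum_congr rfl fun I hI => ?_
    rw [Finset.sum_filter]
    simp only [← Finset.sum_add_distrib]
    refine Finset.sum_congr rfl fun J hJ => ?_
    have hJp := J.len_pos
    by_cases hin : J.Inside r I
    · obtain ⟨hs, hl⟩ := hin
      rw [if_pos ⟨hs, hl⟩]
      rcases le_or_gt I.len q with c1 | c1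
      · rw [if_pos ⟨c1, hs, hl⟩, if_neg fun h => by linarith [h.1], if_neg fun h => by
          linarith [h.1], if_neg fun h => by linarith]
        ring
      rw [if_neg fun h => by linarith [h.1]]
      rcases le_or_gt (2 ^ r * J.len) q with c2 | c2
      · rw [if_neg fun h => by linarith [h.1], if_pos ⟨c1, c2, hs⟩, if_neg fun h => by linarith]
        ring
      rw [if_neg (c := q < I.len ∧ _) fun h => by linarith [h.2.1], if_pos c2]
      by_cases c3 : I.len = 2 ^ r * J.len
      · rw [if_pos ⟨c2, c3, hs⟩, if_neg]
        · ring
        · rintro ⟨-, h, -⟩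
          rw [c3, pow_succ] at h
          nlinarith
      · have h4 := hL.pow_succ_mul_len_le (hF I hI) (hGD J hJ) (lt_of_le_of_ne hl (Ne.symm c3))
        have h5 : a < J.len := lt_of_mul_lt_mul_left (hq2.trans_lt c2) (by positivity)
        rw [if_neg fun h => c3 h.2.1, if_pos ⟨h5, h4, hs⟩]
        ring
    · rw [if_neg hin, if_neg fun h => hin h.2, if_neg fun h => hin ⟨h.2.2, h.2.1.ge⟩,
        if_neg fun h => hin ⟨h.2.2, h.2.1.trans h.1.le⟩, if_neg (c := a < J.len ∧ _)]
      · simp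
      · rintro ⟨-, h, h'⟩
        exact hin ⟨h', by rw [pow_succ] at h; nlinarith⟩
  rw [hdecomp]
  have hX := fam_nonneg σ F u
  have hY := fam_nonneg w G v
  have hR := rootA2_nonneg σ w
  have b1' : 240 * rootA2 σ w * (q / a) * (fam σ F u * fam w G v) ≤
      240 * rootA2 σ w * 2 ^ (r + 1) * (fam σ F u * fam w G v) := by
    gcongr
    rw [div_le_iff₀ ha]; exact hq1.le
  have b4' : 120 * rootA2 σ w *
      (fam σ F u * fam w (G.filter fun J => q < 2 ^ r * J.len) v) ≤
      120 * rootA2 σ w * (fam σ F u * fam w G v) := by gcongr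
  have t1 := abs_add_le (∑ I ∈ F, ∑ J ∈ G, (if I.len ≤ q ∧ J.Inside r I then
      insideTerm k σ w u v I J else 0) +
      ∑ I ∈ F, ∑ J ∈ G, (if q < 2 ^ r * J.len ∧ I.len = 2 ^ r * J.len ∧ J.toSet ⊆ I.toSet then
        insideTerm k σ w u v I J else 0) +
      ∑ I ∈ F, ∑ J ∈ G, (if q < I.len ∧ 2 ^ r * J.len ≤ q ∧ J.toSet ⊆ I.toSet then
        insideTerm k σ w u v I J else 0))
      (∑ I ∈ F, ∑ J ∈ G with q < 2 ^ r * J.len, (if a < J.len ∧ 2 ^ (r + 1) * J.len ≤ I.len ∧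
        J.toSet ⊆ I.toSet then insideTerm k σ w u v I J else 0))
  have t2 := abs_add_three (∑ I ∈ F, ∑ J ∈ G, (if I.len ≤ q ∧ J.Inside r I then
      insideTerm k σ w u v I J else 0))
      (∑ I ∈ F, ∑ J ∈ G, (if q < 2 ^ r * J.len ∧ I.len = 2 ^ r * J.len ∧ J.toSet ⊆ I.toSet then
        insideTerm k σ w u v I J else 0))
      (∑ I ∈ F, ∑ J ∈ G, (if q < I.len ∧ 2 ^ r * J.len ≤ q ∧ J.toSet ⊆ I.toSet then
        insideTerm k σ w u v I J else 0))
  have e : insideConst r * rootA2 σ w * (fam σ F u * fam w G v) =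
      240 * rootA2 σ w * 2 ^ (r + 1) * (fam σ F u * fam w G v) +
      120 * rootA2 σ w * (fam σ F u * fam w G v) + 360 * rootA2 σ w * (fam σ F u * fam w G v) +
      120 * rootA2 σ w * (fam σ F u * fam w G v) := by
    unfold insideConst; ring
  rw [e]
  linarith

end

/-! ### Separated pairs and kernels with smoothness -/

/-- On each half line the increments of `s` are at most twice those of `1 / t`. Nothing is required
of the jump at `0`, since separated points see only one half line. -/
def HasSmoothness (s : ℝ → ℝ) : Prop :=
  ∀ t t', 0 < t * t' → |s t - s t'| ≤ 2 * |t - t'| / (|t| * |t'|)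

section

variable {D : Set Itv} {ℓ : ℝ} {lev : Itv → ℤ} {σ w : Measure ℝ} [IsLocallyFiniteMeasure σ]
  [IsLocallyFiniteMeasure w] {ε : ℝ} {r : ℕ}

lemma poissonDominated_pk {t : ℝ} (ht : 0 < t) : PoissonDominated (fun x y => pk t (x - y)) 1 t :=
  ⟨(measurable_pk t).comp (measurable_fst.sub measurable_snd), zero_le_one, ht, fun x y => by
    rw [abs_of_nonneg (pk_nonneg ht _), one_mul]⟩

/-- The variation of the kernel over an interval `J` that is separated from `y`. The factor
`(|J| / L) ^ (1 - 2 * ε)` is the loss `(|J| / L) ^ (-2 * ε)` of the separation, squared, against the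
gain `|J| / L` of the difference. -/
lemma smooth_sub_le {s : ℝ → ℝ} (hs : HasSmoothness s) (hε : 0 ≤ ε) (hε' : ε ≤ 1) {J : Itv} {L : ℝ}
    (hJL : J.len ≤ L) {x y : ℝ} (hx : x ∈ J.toSet)
    (hsep : ∀ x ∈ J.toSet, J.len ^ ε * L ^ (1 - ε) ≤ |x - y|) :
    |s (x - y) - s (J.left - y)| ≤ 8 * (J.len / L) ^ (1 - 2 * ε) * pk L (x - y) := by
  have hJ := J.len_pos
  have hLpos : 0 < L := hJ.trans_le hJL
  set ρ := J.len / L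
  have hρ : 0 < ρ := div_pos hJ hLpos
  have hρ1 : ρ ≤ 1 := (div_le_one hLpos).2 hJL
  have hD : J.len ^ ε * L ^ (1 - ε) = ρ ^ ε * L := by
    rw [Real.div_rpow hJ.le hLpos.le, Real.rpow_sub hLpos, Real.rpow_one]
    ring
  have hDJ : J.len ≤ J.len ^ ε * L ^ (1 - ε) := le_rpow_mul_rpow hJ hJL hε'
  have h1 := hsep x hx
  have h2 := hsep J.left J.left_mem
  set d := |x - y| with hd
  set d' := |J.left - y| with hd'
  have hdpos : 0 < d := hJ.trans_le (hDJ.trans h1)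
  have hd'pos : 0 < d' := hJ.trans_le (hDJ.trans h2)
  have hxx : |x - J.left| < J.len := by
    unfold len; rw [abs_of_nonneg (by linarith [hx.1])]; linarith [hx.2]
  -- both points of `J` lie on the same side of `y`
  have hsame : 0 < (x - y) * (J.left - y) := by
    by_contra hneg
    have h3 : |x - J.left| = d + d' := by
      rw [hd, hd', show x - J.left = (x - y) - (J.left - y) by ring]
      rcases le_total 0 (x - y) with h | h
      · have h4 : J.left - y ≤ 0 := by
          by_contra h5
          have : 0 < x - y := lt_of_le_of_ne h fun h6 => by
            rw [hd, ← h6, abs_zero] at hdpos; exact lt_irrefl _ hdpos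
          exact hneg (mul_pos this (not_le.1 h5))
        rw [abs_of_nonneg h, abs_of_nonpos h4, abs_of_nonneg (by linarith)]; ring
      · have h4 : 0 ≤ J.left - y := by
          by_contra h5
          have : x - y < 0 := lt_of_le_of_ne h fun h6 => by
            rw [hd, h6, abs_zero] at hdpos; exact lt_irrefl _ hdpos
          exact hneg (mul_pos_of_neg_of_neg this (not_le.1 h5))
        rw [abs_of_nonpos h, abs_of_nonneg h4, abs_of_nonpos (by linarith)]; ring
    linarith
  have h3 := hs _ _ hsame
  rw [show x - y - (J.left - y) = x - J.left by ring] at h3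
  have h4 : d ≤ 2 * d' := by
    have : d ≤ |x - J.left| + d' := by
      rw [hd, hd', show x - y = (x - J.left) + (J.left - y) by ring]; exact abs_add_le _ _
    linarith
  have h5 : |s (x - y) - s (J.left - y)| ≤ 4 * J.len / d ^ 2 := by
    refine h3.trans ?_
    rw [div_le_div_iff₀ (mul_pos hdpos hd'pos) (by positivity)]
    calc 2 * |x - J.left| * d ^ 2 ≤ 2 * J.len * (d * (2 * d')) := by
          rw [sq]; gcongr
      _ = _ := by ring
  have hρε : 0 < ρ ^ ε := Real.rpow_pos_of_pos hρ _
  have hρε1 : ρ ^ ε ≤ 1 := Real.rpow_le_one hρ.le hρ1 hε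
  have h6 : (ρ ^ ε) ^ 2 * (L ^ 2 + d ^ 2) ≤ 2 * d ^ 2 := by
    have e1 : (ρ ^ ε * L) ^ 2 ≤ d ^ 2 := by
      gcongr; rw [← hD]; exact h1
    have e2 : (ρ ^ ε) ^ 2 * d ^ 2 ≤ 1 * d ^ 2 := by
      gcongr; exact pow_le_one₀ hρε.le hρε1
    rw [mul_pow] at e1
    linarith
  refine h5.trans ?_
  have hexp : ρ ^ (1 - 2 * ε) = ρ / (ρ ^ ε) ^ 2 := by
    rw [Real.rpow_sub hρ, Real.rpow_one, two_mul, Real.rpow_add hρ, sq]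
  have hsq : (x - y) ^ 2 = d ^ 2 := by rw [hd, sq_abs]
  rw [hexp]
  unfold pk
  rw [hsq]
  have e : 8 * (ρ / (ρ ^ ε) ^ 2) * (L / (L ^ 2 + d ^ 2)) =
      8 * J.len / ((ρ ^ ε) ^ 2 * (L ^ 2 + d ^ 2)) := by
    have : ρ * L = J.len := div_mul_cancel₀ _ hLpos.ne'
    rw [← this]; field_simp
  rw [e, div_le_div_iff₀ (by positivity) (by positivity)]
  nlinarith

/-- The form of a smooth kernel on a separated pair: cancellation in `v` gains a power of the
ratio of lengths over the Poisson kernel. -/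
lemma abs_bform_separated_le (hA : A2 σ w ≠ ∞) {s : ℝ → ℝ} (hs : HasSmoothness s)
    (hsm : Measurable s) {c M t : ℝ} (hc : ∀ t, |s t| ≤ c)
    (hk : PoissonDominated (fun x y => s (x - y)) M t) (hε : 0 ≤ ε) (hε' : ε ≤ 1)
    {J : Itv} {v g : ℝ → ℝ} (hv : HaarStep w J v) (hg : MemLp g 2 σ) (hgi : Integrable g σ) {L : ℝ}
    (hJL : J.len ≤ L)
    (hsep : ∀ x ∈ J.toSet, ∀ y, g y ≠ 0 → J.len ^ ε * L ^ (1 - ε) ≤ |x - y|) :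
    |bform (fun x y => s (x - y)) σ w g v| ≤ 8 * (J.len / L) ^ (1 - 2 * ε) *
      bform (fun x y => pk L (x - y)) σ w (fun y => |g y|) (fun x => |v x|) := by
  have hLpos : 0 < L := J.len_pos.trans_le hJL
  have hgc : Integrable (fun y => s (J.left - y) * g y) σ := by
    refine (hgi.norm.const_mul c).mono' ((hsm.comp (measurable_const.sub
      measurable_id)).aestronglyMeasurable.mul hg.1) (Eventually.of_forall fun y => ?_)
    rw [norm_mul]
    exact mul_le_mul_of_nonneg_right (hc _) (norm_nonneg _)
  have hprod : Integrable (fun z : ℝ × ℝ => v z.1 * (s (J.left - z.2) * g z.2)) (w.prod σ) :=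
    hv.integrable.mul_prod hgc
  have hzero : ∫ z : ℝ × ℝ, v z.1 * (s (J.left - z.2) * g z.2) ∂(w.prod σ) = 0 := by
    rw [integral_prod_mul v (fun y => s (J.left - y) * g y), hv.integral_eq_zero, zero_mul]
  have hsub : bform (fun x y => s (x - y)) σ w g v =
      ∫ z : ℝ × ℝ, (s (z.1 - z.2) - s (J.left - z.2)) * (g z.2 * v z.1) ∂(w.prod σ) := by
    have h1 := integral_sub (hk.integrable hA hg hv.memLp) hprod
    rw [hzero, sub_zero] at h1
    unfold bform
    rw [← h1]
    congr 1; ext z; ring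
  rw [hsub, ← Real.norm_eq_abs]
  unfold bform
  rw [← integral_const_mul]
  refine norm_integral_le_of_norm_le (((poissonDominated_pk hLpos).integrable hA hg.abs
    hv.memLp.abs).const_mul _) (Eventually.of_forall fun z => ?_)
  rw [norm_mul, norm_mul, Real.norm_eq_abs, Real.norm_eq_abs, Real.norm_eq_abs]
  by_cases hx : z.1 ∈ J.toSet
  · by_cases hy : g z.2 = 0
    · simp [hy]
    · have := smooth_sub_le hs hε hε' hJL hx fun x hx => hsep x hx z.2 hy
      rw [← mul_assoc (8 * _)]
      exact mul_le_mul_of_nonneg_right this (by positivity)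
  · simp [hv.eq_zero_of_notMem hx]

/-- Intervals of equal length are disjoint, so at most one summand is nonzero. -/
lemma abs_sum_eq_sum_abs {μ : Measure ℝ} (hD : IsDyadicGrid D) {F : Finset Itv} {u : Itv → ℝ → ℝ}
    (hF : ∀ I ∈ F, I ∈ D) (hu : ∀ I ∈ F, HaarStep μ I (u I)) {c : ℝ} (hc : ∀ I ∈ F, I.len = c)
    (x : ℝ) : ∑ I ∈ F, |u I x| = |∑ I ∈ F, u I x| := by
  by_cases hx : ∃ I ∈ F, x ∈ I.toSet
  · obtain ⟨I, hI, hxI⟩ := hx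
    have hother : ∀ K ∈ F, K ≠ I → u K x = 0 := fun K hK hne =>
      (hu K hK).eq_zero_of_notMem fun hxK => hne
        (hD.eq_of_mem (hF I hI) (hF K hK) ((hc K hK).trans (hc I hI).symm) hxI hxK)
    rw [Finset.sum_eq_single I (fun K hK hne => by rw [hother K hK hne, abs_zero])
      (fun h => absurd hI h), Finset.sum_eq_single I hother (fun h => absurd hI h)]
  · push Not at hx
    have hz : ∀ I ∈ F, u I x = 0 := fun I hI => (hu I hI).eq_zero_of_notMem (hx I hI)
    rw [Finset.sum_eq_zero hz, Finset.sum_eq_zero fun I hI => by rw [hz I hI, abs_zero], abs_zero]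

/-- Between two generations the sum over all pairs is a single Poisson form. -/
lemma sum_bform_pk_le (hA : A2 σ w ≠ ∞) (hD : IsDyadicGrid D) {F G : Finset Itv}
    {u v : Itv → ℝ → ℝ} (hF : ∀ I ∈ F, I ∈ D) (hu : ∀ I ∈ F, HaarStep σ I (u I))
    (hG : ∀ J ∈ G, J ∈ D) (hv : ∀ J ∈ G, HaarStep w J (v J)) {c c' t : ℝ} (ht : 0 < t)
    (hc : ∀ I ∈ F, I.len = c) (hc' : ∀ J ∈ G, J.len = c') :
    ∑ I ∈ F, ∑ J ∈ G, bform (fun x y => pk t (x - y)) σ w (fun y => |u I y|) (fun x => |v J x|) ≤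
      30 * rootA2 σ w * (fam σ F u * fam w G v) := by
  have hp := poissonDominated_pk ht
  have hu' : ∀ I ∈ F, MemLp (fun y => |u I y|) 2 σ := fun I hI => (hu I hI).memLp.abs
  have hv' : ∀ J ∈ G, MemLp (fun x => |v J x|) 2 w := fun J hJ => (hv J hJ).memLp.abs
  have h1 : ∑ I ∈ F, ∑ J ∈ G,
      bform (fun x y => pk t (x - y)) σ w (fun y => |u I y|) (fun x => |v J x|) =
      bform (fun x y => pk t (x - y)) σ w (fun y => ∑ I ∈ F, |u I y|)
        (fun x => ∑ J ∈ G, |v J x|) := by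
    rw [hp.bform_sum_left hA F hu' (memLp_finsetSum _ hv')]
    exact Finset.sum_congr rfl fun I hI => (hp.bform_sum_right hA G (hu' I hI) hv').symm
  have h2 := hp.abs_bform_le hA (memLp_finsetSum F hu') (memLp_finsetSum G hv')
  have e1 : l2 σ (fun x => ∑ I ∈ F, |u I x|) = fam σ F u := by
    rw [← l2_sum_eq_fam hD hF hu, ← l2_abs σ (fun x => ∑ I ∈ F, u I x)]
    congr 1; ext x; exact abs_sum_eq_sum_abs hD hF hu hc x
  have e2 : l2 w (fun x => ∑ J ∈ G, |v J x|) = fam w G v := by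
    rw [← l2_sum_eq_fam hD hG hv, ← l2_abs w (fun x => ∑ J ∈ G, v J x)]
    congr 1; ext x; exact abs_sum_eq_sum_abs hD hG hv hc' x
  rw [h1]
  rw [e1, e2, one_mul] at h2
  exact (le_abs_self _).trans h2

open Classical in
/-- Pairs whose levels differ by a fixed number. -/
lemma sum_bform_pk_shift_le (hA : A2 σ w ≠ ∞) (hD : IsDyadicGrid D) (hL : IsLevel D ℓ lev)
    {F G : Finset Itv} {u v : Itv → ℝ → ℝ} (hF : ∀ I ∈ F, I ∈ D)
    (hu : ∀ I ∈ F, HaarStep σ I (u I)) (hG : ∀ J ∈ G, J ∈ D) (hv : ∀ J ∈ G, HaarStep w J (v J))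
    (s : ℕ) :
    ∑ I ∈ F, ∑ J ∈ G, (if lev I = lev J + s then
      bform (fun x y => pk I.len (x - y)) σ w (fun y => |u I y|) (fun x => |v J x|) else 0) ≤
      30 * rootA2 σ w * (fam σ F u * fam w G v) := by
  have hR := rootA2_nonneg σ w
  rw [← Finset.sum_fiberwise_of_maps_to (s := F) (t := F.image lev) (g := lev)
    (fun I hI => Finset.mem_image_of_mem _ hI)]
  have hn : ∀ n ∈ F.image lev, ∑ I ∈ F with lev I = n, ∑ J ∈ G, (if lev I = lev J + s then
      bform (fun x y => pk I.len (x - y)) σ w (fun y => |u I y|) (fun x => |v J x|) else 0) ≤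
      30 * rootA2 σ w * (fam σ (F.filter fun I => lev I = n) u *
        fam w (G.filter fun J => n = lev J + s) v) := by
    intro n _
    have hF' : ∀ I ∈ F.filter (fun I => lev I = n), I ∈ F := fun I h => (Finset.mem_filter.1 h).1
    have hG' : ∀ J ∈ G.filter (fun J => n = lev J + s), J ∈ G := fun J h =>
      (Finset.mem_filter.1 h).1
    have h := sum_bform_pk_le hA hD (fun I hI => hF I (hF' I hI)) (fun I hI => hu I (hF' I hI))
      (fun J hJ => hG J (hG' J hJ)) (fun J hJ => hv J (hG' J hJ)) (c := 2 ^ n * ℓ)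
      (c' := 2 ^ (n - s) * ℓ) (t := 2 ^ n * ℓ) (by have := hL.pos; positivity)
      (fun I hI => by rw [hL.len_eq I (hF I (hF' I hI)), (Finset.mem_filter.1 hI).2])
      (fun J hJ => by
        rw [hL.len_eq J (hG J (hG' J hJ)), (Finset.mem_filter.1 hJ).2]; simp)
    refine (le_of_eq (Finset.sum_congr rfl fun I hI => ?_)).trans h
    rw [Finset.sum_filter]
    have hI2 := (Finset.mem_filter.1 hI).2
    refine Finset.sum_congr rfl fun J _ => ?_
    rw [hL.len_eq I (hF I (hF' I hI)), hI2]
  calc _ ≤ ∑ n ∈ F.image lev, 30 * rootA2 σ w * (fam σ (F.filter fun I => lev I = n) u *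
        fam w (G.filter fun J => n = lev J + s) v) := Finset.sum_le_sum hn
    _ = 30 * rootA2 σ w * ∑ n ∈ F.image lev, fam σ (F.filter fun I => lev I = n) u *
        fam w (G.filter fun J => n = lev J + s) v := by rw [Finset.mul_sum]
    _ ≤ 30 * rootA2 σ w * (√(∑ n ∈ F.image lev, fam σ (F.filter fun I => lev I = n) u ^ 2) *
        √(∑ n ∈ F.image lev, fam w (G.filter fun J => n = lev J + s) v ^ 2)) := by
        gcongr
        exact Real.sum_mul_le_sqrt_mul_sqrt _ _ _
    _ ≤ _ := by
        gcongr
        · exact fam_nonneg _ _ _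
        · rw [Real.sqrt_le_left (fam_nonneg _ _ _)]
          simp_rw [fam_sq]
          rw [Finset.sum_fiberwise_of_maps_to (g := lev)
            (fun I hI => Finset.mem_image_of_mem _ hI)]
        · rw [Real.sqrt_le_left (fam_nonneg _ _ _)]
          simp_rw [fam_sq, Finset.sum_filter]
          rw [Finset.sum_comm]
          refine Finset.sum_le_sum fun J _ => ?_
          rw [Finset.sum_ite_eq' (F.image lev) (lev J + s) (fun _ => l2 w (v J) ^ 2)]
          split_ifs
          · exact le_rfl
          · exact sq_nonneg _

open Classical in
/-- Summation over all pairs with a gain of a power of the ratio of the lengths. -/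
lemma sum_ratio_rpow_mul_bform_pk_le (hA : A2 σ w ≠ ∞) (hD : IsDyadicGrid D)
    {F G : Finset Itv} {u v : Itv → ℝ → ℝ} (hF : ∀ I ∈ F, I ∈ D)
    (hu : ∀ I ∈ F, HaarStep σ I (u I)) (hG : ∀ J ∈ G, J ∈ D) (hv : ∀ J ∈ G, HaarStep w J (v J))
    {δ : ℝ} (hδ : 0 < δ) :
    ∑ I ∈ F, ∑ J ∈ G, (if J.len ≤ I.len then (J.len / I.len) ^ δ *
      bform (fun x y => pk I.len (x - y)) σ w (fun y => |u I y|) (fun x => |v J x|) else 0) ≤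
      (1 - (2 : ℝ) ^ (-δ))⁻¹ * (30 * rootA2 σ w * (fam σ F u * fam w G v)) := by
  obtain ⟨ℓ, lev, hL⟩ := hD.exists_isLevel
  set c : ℝ := 2 ^ (-δ)
  have hc0 : 0 < c := by positivity
  have hc1 : c < 1 := Real.rpow_lt_one_of_one_lt_of_neg (by norm_num) (by linarith)
  obtain ⟨N, hN⟩ : ∃ N : ℕ, ∀ I ∈ F, ∀ J ∈ G, (lev I - lev J).toNat < N := by
    refine ⟨(F ×ˢ G).sup (fun p => (lev p.1 - lev p.2).toNat) + 1, fun I hI J hJ => ?_⟩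
    exact Nat.lt_succ_of_le (Finset.le_sup (f := fun p : Itv × Itv => (lev p.1 - lev p.2).toNat)
      (Finset.mk_mem_product hI hJ))
  have hX := fam_nonneg σ F u
  have hY := fam_nonneg w G v
  have hR := rootA2_nonneg σ w
  calc _ = ∑ I ∈ F, ∑ J ∈ G, ∑ s ∈ Finset.range N, c ^ s * (if lev I = lev J + s then
      bform (fun x y => pk I.len (x - y)) σ w (fun y => |u I y|) (fun x => |v J x|) else 0) := by
        refine Finset.sum_congr rfl fun I hI => Finset.sum_congr rfl fun J hJ => ?_
        have hID := hF I hI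
        have hJD := hG J hJ
        split_ifs with h
        · have hlev := (hL.len_le_iff hID hJD).1 h
          have hs : lev I = lev J + (lev I - lev J).toNat := by omega
          rw [Finset.sum_eq_single (lev I - lev J).toNat, if_pos hs]
          · congr 1
            rw [hL.len_eq I hID, hL.len_eq J hJD]
            have h1 : (2 : ℝ) ^ lev J * ℓ / (2 ^ lev I * ℓ) =
                2 ^ (-((lev I - lev J).toNat : ℝ)) := by
              have := hL.pos
              rw [mul_div_mul_right _ _ this.ne', ← zpow_sub₀ (by norm_num), ← Real.rpow_intCast]
              congr 1
              have h2 : lev J - lev I = -((lev I - lev J).toNat : ℤ) := by omega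
              rw [h2]; push_cast; ring
            rw [h1, ← Real.rpow_mul (by norm_num), ← Real.rpow_natCast, ← Real.rpow_mul (by norm_num)]
            congr 1; ring
          · intro s _ hne
            rw [if_neg, mul_zero]
            intro h'; apply hne; omega
          · intro h'
            exact absurd (Finset.mem_range.2 (hN I hI J hJ)) h'
        · symm
          refine Finset.sum_eq_zero fun s _ => ?_
          rw [if_neg, mul_zero]
          intro h'
          exact h ((hL.len_le_iff hID hJD).2 (by omega))
    _ = ∑ s ∈ Finset.range N, c ^ s * ∑ I ∈ F, ∑ J ∈ G, (if lev I = lev J + s then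
      bform (fun x y => pk I.len (x - y)) σ w (fun y => |u I y|) (fun x => |v J x|) else 0) := by
        simp_rw [Finset.mul_sum]
        refine (Finset.sum_congr rfl fun I _ => Finset.sum_comm).trans ?_
        rw [Finset.sum_comm]
    _ ≤ ∑ s ∈ Finset.range N, c ^ s * (30 * rootA2 σ w * (fam σ F u * fam w G v)) := by
        refine Finset.sum_le_sum fun s _ => ?_
        gcongr
        exact sum_bform_pk_shift_le hA hD hL hF hu hG hv s
    _ = (∑ s ∈ Finset.range N, c ^ s) * (30 * rootA2 σ w * (fam σ F u * fam w G v)) := by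
        rw [Finset.sum_mul]
    _ ≤ _ := by
        gcongr
        rw [← tsum_geometric_of_lt_one hc0.le hc1]
        exact (summable_geometric_of_lt_one hc0.le hc1).sum_le_tsum _ fun _ _ => by positivity

end

/-! ### The truncated Hilbert kernel -/

/-- The sharply truncated kernel `1 / t`. -/
noncomputable def sharpKernel (α β t : ℝ) : ℝ := if α < |t| ∧ |t| < β then t⁻¹ else 0

/-- The Lipschitz truncation of `1 / t`: `1 / t - 1 / β` for `α ≤ t ≤ β`, constant for `0 < t ≤ α`,
zero for `t ≥ β`, and odd. It is discontinuous only at `0`. -/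
noncomputable def smoothKernel (α β t : ℝ) : ℝ :=
  t / |t| * ((max |t| α)⁻¹ - (max |t| β)⁻¹)

/-- The jump of the sharp truncation at `β`. -/
noncomputable def outerKernel (β t : ℝ) : ℝ := if |t| < β then t / |t| / β else 0

/-- The jump of the sharp truncation at `α`. -/
noncomputable def innerKernel (α t : ℝ) : ℝ := if |t| ≤ α then -(t / |t| / α) else 0

lemma abs_div_abs_self_le (t : ℝ) : |(t / |t|)| ≤ 1 := by
  rw [abs_div, abs_abs]; exact div_self_le_one _

lemma abs_inv_max_sub_inv_max_le {a b α : ℝ} (ha : 0 < a) (hb : 0 < b) :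
    |(max a α)⁻¹ - (max b α)⁻¹| ≤ |a - b| / (a * b) := by
  have h1 : 0 < max a α := ha.trans_le (le_max_left _ _)
  have h2 : 0 < max b α := hb.trans_le (le_max_left _ _)
  rw [inv_sub_inv h1.ne' h2.ne', abs_div, abs_of_pos (mul_pos h1 h2), abs_sub_comm]
  exact div_le_div₀ (abs_nonneg _) (abs_max_sub_max_le_abs a b α) (mul_pos ha hb)
    (mul_le_mul (le_max_left _ _) (le_max_left _ _) hb.le h1.le)

/-- On each half line the kernel is a difference of two functions `1 / max |t| a`, whose increments
are at most those of `1 / t`; hence the factor `2`. -/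
lemma hasSmoothness_smoothKernel (α β : ℝ) : HasSmoothness (smoothKernel α β) := by
  intro t t' h
  have ht : t ≠ 0 := fun h0 => by simp [h0] at h
  have ht' : t' ≠ 0 := fun h0 => by simp [h0] at h
  have hsign : t / |t| = t' / |t'| ∧ |(|t| - |t'|)| = |t - t'| := by
    rcases pos_and_pos_or_neg_and_neg_of_mul_pos h with ⟨h1, h2⟩ | ⟨h1, h2⟩
    · rw [abs_of_pos h1, abs_of_pos h2, div_self ht, div_self ht']; exact ⟨rfl, rfl⟩
    · rw [abs_of_neg h1, abs_of_neg h2, div_neg, div_neg, div_self ht, div_self ht']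
      exact ⟨rfl, by rw [neg_sub_neg, abs_sub_comm]⟩
  have p1 := abs_pos.2 ht
  have p2 := abs_pos.2 ht'
  unfold smoothKernel
  rw [hsign.1, ← mul_sub, abs_mul]
  have e : (max |t| α)⁻¹ - (max |t| β)⁻¹ - ((max |t'| α)⁻¹ - (max |t'| β)⁻¹) =
      ((max |t| α)⁻¹ - (max |t'| α)⁻¹) - ((max |t| β)⁻¹ - (max |t'| β)⁻¹) := by ring
  rw [e]
  have h1 := abs_inv_max_sub_inv_max_le (α := α) p1 p2
  have h2 := abs_inv_max_sub_inv_max_le (α := β) p1 p2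
  rw [hsign.2] at h1 h2
  calc _ ≤ 1 * (|t - t'| / (|t| * |t'|) + |t - t'| / (|t| * |t'|)) :=
        mul_le_mul (abs_div_abs_self_le _) ((abs_sub _ _).trans (add_le_add h1 h2))
          (abs_nonneg _) zero_le_one
    _ = _ := by ring

lemma HasSmoothness.comp_neg {s : ℝ → ℝ} (hs : HasSmoothness s) : HasSmoothness fun t => s (-t) := by
  intro t t' h
  have := hs (-t) (-t') (by rwa [neg_mul_neg])
  rwa [abs_neg, abs_neg, neg_sub_neg, abs_sub_comm t'] at this

lemma measurable_smoothKernel (α β : ℝ) : Measurable (smoothKernel α β) := by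
  unfold smoothKernel; fun_prop

lemma measurable_sharpKernel (α β : ℝ) : Measurable (sharpKernel α β) :=
  Measurable.ite ((measurableSet_lt measurable_const measurable_abs).inter
    (measurableSet_lt measurable_abs measurable_const)) measurable_inv measurable_const

lemma measurable_outerKernel (β : ℝ) : Measurable (outerKernel β) :=
  Measurable.ite (measurableSet_lt measurable_abs measurable_const) (by fun_prop) measurable_const

lemma measurable_innerKernel (α : ℝ) : Measurable (innerKernel α) :=
  Measurable.ite (measurableSet_le measurable_abs measurable_const) (by fun_prop) measurable_const

section

variable {α β : ℝ}

lemma abs_sharpKernel_le (hα : 0 < α) (t : ℝ) : |sharpKernel α β t| ≤ α⁻¹ := by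
  unfold sharpKernel
  split_ifs with h
  · rw [abs_inv]; exact inv_anti₀ hα h.1.le
  · rw [abs_zero]; positivity

lemma sharpKernel_eq_zero {t : ℝ} (h : β < |t|) : sharpKernel α β t = 0 :=
  if_neg fun h' => lt_asymm h h'.2

lemma abs_smoothKernel_le (hα : 0 < α) (hβ : α < β) (t : ℝ) : |smoothKernel α β t| ≤ α⁻¹ := by
  unfold smoothKernel
  rw [abs_mul]
  have h1 : (max |t| β)⁻¹ ≤ (max |t| α)⁻¹ := inv_anti₀ (hα.trans_le (le_max_right _ _)) (by gcongr)
  have h2 : (max |t| α)⁻¹ ≤ α⁻¹ := inv_anti₀ hα (le_max_right _ _)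
  have h3 : 0 ≤ (max |t| β)⁻¹ := inv_nonneg.2 ((abs_nonneg t).trans (le_max_left _ _))
  calc _ ≤ 1 * |(max |t| α)⁻¹ - (max |t| β)⁻¹| := by gcongr; exact abs_div_abs_self_le t
    _ ≤ _ := by rw [one_mul, abs_of_nonneg (by linarith)]; linarith

lemma smoothKernel_eq_zero (hβ : α < β) {t : ℝ} (h : β < |t|) : smoothKernel α β t = 0 := by
  unfold smoothKernel
  rw [max_eq_left (hβ.trans h).le, max_eq_left h.le, sub_self, mul_zero]

/-- `outerKernel` restores the constant `1 / β` that `smoothKernel` subtracts for `|t| < β`, and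
`innerKernel` removes the constant `1 / α` that it leaves for `|t| ≤ α`. -/
lemma sharpKernel_eq (hβ : α < β) (t : ℝ) :
    sharpKernel α β t = smoothKernel α β t + (outerKernel β t + innerKernel α t) := by
  unfold sharpKernel smoothKernel outerKernel innerKernel
  rcases le_or_gt |t| α with h1 | h1
  · rw [if_neg fun h => not_lt.2 h1 h.1, if_pos (h1.trans_lt hβ), if_pos h1, max_eq_right h1,
      max_eq_right (h1.trans hβ.le)]
    ring
  · rcases lt_or_ge |t| β with h2 | h2
    · rw [if_pos ⟨h1, h2⟩, if_pos h2, if_neg (not_le.2 h1), max_eq_left h1.le, max_eq_right h2.le]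
      have : t * |t|⁻¹ * |t|⁻¹ = t⁻¹ := by
        rw [mul_assoc, ← mul_inv, abs_mul_abs_self, mul_inv, ← mul_assoc]
        by_cases h : t = 0
        · simp [h]
        · field_simp
      rw [← this]; ring
    · rw [if_neg fun h => not_lt.2 h2 h.2, if_neg (not_lt.2 h2), if_neg (not_le.2 h1),
        max_eq_left h1.le, max_eq_left h2]
      ring

lemma measurable_uncurry_sub {s : ℝ → ℝ} (hs : Measurable s) :
    Measurable (Function.uncurry fun x y => s (x - y)) :=
  hs.comp (measurable_fst.sub measurable_snd)

lemma localKernel_outer (hβ : 0 < β) : LocalKernel (fun x y => outerKernel β (x - y)) β := by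
  refine ⟨measurable_uncurry_sub (measurable_outerKernel β), hβ, fun x y => ?_, fun x y h => ?_⟩
  · unfold outerKernel
    split_ifs
    · rw [abs_div, abs_of_pos hβ]; gcongr; exact abs_div_abs_self_le _
    · rw [abs_zero]; positivity
  · exact if_neg (not_lt.2 h.le)

lemma localKernel_inner (hα : 0 < α) : LocalKernel (fun x y => innerKernel α (x - y)) α := by
  refine ⟨measurable_uncurry_sub (measurable_innerKernel α), hα, fun x y => ?_, fun x y h => ?_⟩
  · unfold innerKernel
    split_ifs
    · rw [abs_neg, abs_div, abs_of_pos hα]; gcongr; exact abs_div_abs_self_le _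
    · rw [abs_zero]; positivity
  · exact if_neg (not_le.2 h)

/-- The sharp kernel is a multiple of a local kernel, with a constant that depends on the
truncation. -/
lemma localKernel_sharp (hα : 0 < α) (hβ : α < β) :
    LocalKernel (fun x y => α / β * sharpKernel α β (x - y)) β := by
  have hβ0 := hα.trans hβ
  refine ⟨(measurable_uncurry_sub (measurable_sharpKernel α β)).const_mul _, hβ0, fun x y => ?_,
    fun x y h => by rw [sharpKernel_eq_zero h, mul_zero]⟩
  rw [abs_mul, abs_of_pos (div_pos hα hβ0)]
  calc _ ≤ α / β * α⁻¹ := by gcongr; exact abs_sharpKernel_le hα _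
    _ = _ := by field_simp

lemma poissonDominated_of_abs_le {s : ℝ → ℝ} (hs : Measurable s) {c b : ℝ} (hb : 0 < b)
    (hc : ∀ t, |s t| ≤ c) (h0 : ∀ t, b < |t| → s t = 0) :
    PoissonDominated (fun x y => s (x - y)) (2 * c * b) b := by
  have hc0 : 0 ≤ c := (abs_nonneg _).trans (hc 0)
  refine ⟨measurable_uncurry_sub hs, by positivity, hb, fun x y => ?_⟩
  rcases le_or_gt |x - y| b with h | h
  · calc _ ≤ c * b * (1 / b) := (hc _).trans_eq (by field_simp)
      _ ≤ c * b * (2 * pk b (x - y)) := by gcongr; exact inv_le_two_mul_pk hb h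
      _ = _ := by ring
  · rw [h0 _ h, abs_zero]
    have := pk_nonneg hb (x - y)
    positivity

lemma poissonDominated_sharp (hα : 0 < α) (hβ : α < β) :
    PoissonDominated (fun x y => sharpKernel α β (x - y)) (2 * α⁻¹ * β) β :=
  poissonDominated_of_abs_le (measurable_sharpKernel α β) (hα.trans hβ) (abs_sharpKernel_le hα)
    fun _ => sharpKernel_eq_zero

lemma poissonDominated_smooth (hα : 0 < α) (hβ : α < β) :
    PoissonDominated (fun x y => smoothKernel α β (x - y)) (2 * α⁻¹ * β) β :=
  poissonDominated_of_abs_le (measurable_smoothKernel α β) (hα.trans hβ)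
    (abs_smoothKernel_le hα hβ) fun _ => smoothKernel_eq_zero hβ

end

/-! ### Pairs of comparable and close intervals -/

/-- The pair `I`, `J` is of comparable length, and at distance less than the larger length. -/
def Near (r : ℕ) (I J : Itv) : Prop :=
  I.len ≤ 2 ^ r * J.len ∧ J.len ≤ 2 ^ r * I.len ∧
    ∃ x ∈ I.toSet, ∃ y ∈ J.toSet, |x - y| < max I.len J.len

lemma Near.symm {r : ℕ} {I J : Itv} (h : Near r I J) : Near r J I := by
  obtain ⟨h1, h2, x, hx, y, hy, hxy⟩ := h
  exact ⟨h2, h1, y, hy, x, hx, by rwa [abs_sub_comm, max_comm]⟩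

lemma near_comm {r : ℕ} {I J : Itv} : Near r I J ↔ Near r J I := ⟨Near.symm, Near.symm⟩

/-- A bound for the number of grid intervals near a given one. -/
noncomputable def nearConst (r : ℕ) : ℝ := (2 * r + 1) * ((1 + 2 ^ (r + 2)) * 2 ^ r)

open Classical in
/-- There are `2 * r + 1` possible levels, and on each of them the near intervals are disjoint and
contained in a neighbourhood of `I` of comparable length. -/
lemma card_near_le {D : Set Itv} (hD : IsDyadicGrid D) (r : ℕ) {I : Itv} (hI : I ∈ D)
    {G : Finset Itv} (hG : ∀ J ∈ G, J ∈ D) :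
    ((G.filter fun J => Near r I J).card : ℝ) ≤ nearConst r := by
  obtain ⟨ℓ, lev, hL⟩ := hD.exists_isLevel
  have hIp := I.len_pos
  have hlev : ∀ J ∈ G.filter (fun J => Near r I J), lev J ∈ Finset.Icc (lev I - r) (lev I + r) := by
    intro J hJ
    obtain ⟨hJG, h1, h2, -⟩ := Finset.mem_filter.1 hJ
    have e1 := (hL.len_le_pow_mul_iff (hG J hJG) hI r).1 h1
    have e2 := (hL.len_le_pow_mul_iff hI (hG J hJG) r).1 h2
    rw [Finset.mem_Icc]; constructor <;> linarith
  have hpow : (1 : ℝ) ≤ 2 ^ r := one_le_pow₀ (by norm_num)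
  have hfib : ∀ m ∈ Finset.Icc (lev I - r) (lev I + r),
      (((G.filter fun J => Near r I J).filter fun J => lev J = m).card : ℝ) ≤
        (1 + 2 ^ (r + 2)) * 2 ^ r := by
    intro m _
    set S := (G.filter fun J => Near r I J).filter fun J => lev J = m
    rcases S.eq_empty_or_nonempty with h0 | ⟨J₀, hJ₀⟩
    · rw [h0]; simp; positivity
    have hmem : ∀ J ∈ S, J ∈ D ∧ Near r I J ∧ lev J = m := fun J hJ =>
      ⟨hG J (Finset.mem_filter.1 (Finset.mem_filter.1 hJ).1).1,
        (Finset.mem_filter.1 (Finset.mem_filter.1 hJ).1).2, (Finset.mem_filter.1 hJ).2⟩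
    have hc : ∀ J ∈ S, J.len = J₀.len := fun J hJ =>
      (hL.len_eq_iff (hmem J₀ hJ₀).1 (hmem J hJ).1).2
        ((hmem J hJ).2.2.trans (hmem J₀ hJ₀).2.2.symm)
    have h := hD.card_mul_le (c := J₀.len) (p := I.left - 2 ^ (r + 1) * I.len)
      (q := I.right + 2 ^ (r + 1) * I.len)
      (by have := I.lt
          have : 0 < 2 ^ (r + 1) * I.len := by positivity
          linarith) S (fun J hJ => by
        obtain ⟨hJD, ⟨h1, h2, x, hx, y, hy, hxy⟩, -⟩ := hmem J hJ
        have hmax : max I.len J.len ≤ 2 ^ r * I.len :=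
          max_le (by nlinarith) h2
        have h3 := abs_lt.1 (hxy.trans_le hmax)
        have e : 2 ^ (r + 1) * I.len = 2 * (2 ^ r * I.len) := by ring
        have hJl : J.len = J.right - J.left := rfl
        refine ⟨hJD, hc J hJ, ?_, ?_⟩
        · linarith [hx.1, hx.2, hy.1, hy.2, h3.1, h3.2]
        · linarith [hx.1, hx.2, hy.1, hy.2, h3.1, h3.2])
    have h1 := (hmem J₀ hJ₀).2.1.1
    have hJp := J₀.len_pos
    have e : I.right + 2 ^ (r + 1) * I.len - (I.left - 2 ^ (r + 1) * I.len) =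
        (1 + 2 ^ (r + 2)) * I.len := by unfold len; ring
    rw [e] at h
    have h2 : (S.card : ℝ) * J₀.len ≤ (1 + 2 ^ (r + 2)) * 2 ^ r * J₀.len := by
      refine h.trans ?_
      rw [mul_assoc]; gcongr
    exact le_of_mul_le_mul_right h2 hJp
  rw [Finset.card_eq_sum_card_fiberwise hlev]
  push_cast
  refine (Finset.sum_le_sum hfib).trans ?_
  rw [Finset.sum_const, Int.card_Icc, nsmul_eq_mul]
  have e : (((lev I + r + 1 - (lev I - r)).toNat : ℕ) : ℝ) = 2 * r + 1 := by
    have : (lev I + r + 1 - (lev I - r)).toNat = 2 * r + 1 := by omega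
    rw [this]; push_cast; ring
  rw [e, nearConst]

open Classical in
/-- Schur's test for a relation with finite degrees. -/
lemma sum_relation_le {F G : Finset Itv} {R : Itv → Itv → Prop} {x y : Itv → ℝ} {N : ℝ}
    (hrow : ∀ I ∈ F, ((G.filter fun J => R I J).card : ℝ) ≤ N)
    (hcol : ∀ J ∈ G, ((F.filter fun I => R I J).card : ℝ) ≤ N) :
    ∑ I ∈ F, ∑ J ∈ G, (if R I J then x I * y J else 0) ≤
      N * (√(∑ I ∈ F, x I ^ 2) * √(∑ J ∈ G, y J ^ 2)) := by
  rcases F.eq_empty_or_nonempty with h0 | ⟨I₀, hI₀⟩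
  · simp [h0]
  have hN : 0 ≤ N := le_trans (by positivity) (hrow I₀ hI₀)
  have e1 : ∑ I ∈ F, ∑ J ∈ G, (if R I J then x I * y J else 0) =
      ∑ p ∈ (F ×ˢ G).filter fun p => R p.1 p.2, x p.1 * y p.2 := by
    rw [Finset.sum_filter, Finset.sum_product]
  have e2 : ∑ p ∈ (F ×ˢ G).filter (fun p => R p.1 p.2), x p.1 ^ 2 ≤ N * ∑ I ∈ F, x I ^ 2 := by
    rw [Finset.sum_filter, Finset.sum_product, Finset.mul_sum]
    refine Finset.sum_le_sum fun I hI => ?_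
    dsimp only
    rw [← Finset.sum_filter, Finset.sum_const, nsmul_eq_mul]
    exact mul_le_mul_of_nonneg_right (hrow I hI) (sq_nonneg _)
  have e3 : ∑ p ∈ (F ×ˢ G).filter (fun p => R p.1 p.2), y p.2 ^ 2 ≤ N * ∑ J ∈ G, y J ^ 2 := by
    rw [Finset.sum_filter, Finset.sum_product_right, Finset.mul_sum]
    refine Finset.sum_le_sum fun J hJ => ?_
    dsimp only
    rw [← Finset.sum_filter, Finset.sum_const, nsmul_eq_mul]
    exact mul_le_mul_of_nonneg_right (hcol J hJ) (sq_nonneg _)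
  rw [e1]
  refine (Real.sum_mul_le_sqrt_mul_sqrt _ _ _).trans ?_
  calc _ ≤ √(N * ∑ I ∈ F, x I ^ 2) * √(N * ∑ J ∈ G, y J ^ 2) := by gcongr
    _ = (√N * √N) * (√(∑ I ∈ F, x I ^ 2) * √(∑ J ∈ G, y J ^ 2)) := by
        rw [Real.sqrt_mul hN, Real.sqrt_mul hN]; ring
    _ = _ := by rw [Real.mul_self_sqrt hN]

section

variable {D : Set Itv} {σ w : Measure ℝ} [IsLocallyFiniteMeasure σ]
  [IsLocallyFiniteMeasure w] {ε : ℝ} {r : ℕ} {k : ℝ → ℝ → ℝ} {M t : ℝ}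

open Classical in
/-- The part of the form on the pair `(u I, v J)` that is left after removing the inside terms. At
most one of them is present if `r` is positive. -/
noncomputable def residue (k : ℝ → ℝ → ℝ) (r : ℕ) (σ w : Measure ℝ) (u v : Itv → ℝ → ℝ)
    (I J : Itv) : ℝ :=
  bform k σ w (u I) (v J) - (if J.Inside r I then insideTerm k σ w u v I J else 0) -
    (if I.Inside r J then insideTerm (fun x y => k y x) w σ v u J I else 0)

lemma residue_flip (k : ℝ → ℝ → ℝ) (r : ℕ) (u v : Itv → ℝ → ℝ) (I J : Itv) :
    residue (fun x y => k y x) r w σ v u J I = residue k r σ w u v I J := by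
  unfold residue
  rw [bform_flip k σ w]; ring

/-- The residue is additive in the kernel, which allows splitting the truncation. -/
lemma residue_add (hA : A2 σ w ≠ ∞) (hk : PoissonDominated k M t) {k' : ℝ → ℝ → ℝ} {M' t' : ℝ}
    (hk' : PoissonDominated k' M' t') {u v : Itv → ℝ → ℝ} {I J : Itv} (hu : HaarStep σ I (u I))
    (hv : HaarStep w J (v J)) :
    residue (fun x y => k x y + k' x y) r σ w u v I J =
      residue k r σ w u v I J + residue k' r σ w u v I J := by
  have hA' : A2 w σ ≠ ∞ := by rwa [A2_comm]
  unfold residue insideTerm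
  rw [bform_add_kernel hA hk hk' hu.memLp hv.memLp,
    bform_add_kernel hA hk hk' (memLp_ind _) hv.memLp,
    bform_add_kernel hA' hk.flip hk'.flip (memLp_ind _) hu.memLp]
  split_ifs <;> ring

/-- A Haar difference is the combination of its two children with its averages as coefficients. -/
lemma bform_haarStep_right (hA : A2 σ w ≠ ∞) (hk : PoissonDominated k M t) {g h : ℝ → ℝ} {J : Itv}
    (hg : MemLp g 2 σ) (hh : HaarStep w J h) :
    bform k σ w g h = av w h J.minus * bform k σ w g J.minus.ind +
      av w h J.plus * bform k σ w g J.plus.ind := by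
  have hA' : A2 w σ ≠ ∞ := by rwa [A2_comm]
  have h1 := hk.flip.bform_add_left hA'
    ((memLp_ind (μ := w) J.minus).const_mul (av w h J.minus))
    ((memLp_ind (μ := w) J.plus).const_mul (av w h J.plus)) hg
  rw [bform_flip k σ w, bform_flip k σ w, bform_flip k σ w, bform_const_mul_right,
    bform_const_mul_right] at h1
  rw [← h1]
  exact congrArg _ (funext hh.apply_eq)

/-- The form on a child of `I` and a Haar difference on `J`. -/
lemma abs_bform_ind_haarStep_le (hA : A2 σ w ≠ ∞) (hk : PoissonDominated k M t) {B : ℝ}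
    (hB0 : 0 ≤ B) {K J : Itv} {h : ℝ → ℝ} (hh : HaarStep w J h)
    (hB : ∀ L, L = J.minus ∨ L = J.plus → |bform k σ w K.ind L.ind| ≤
      B * (√(σ.real K.toSet) * √(w.real L.toSet))) :
    |bform k σ w K.ind h| ≤ 2 * B * (√(σ.real K.toSet) * l2 w h) := by
  rw [bform_haarStep_right hA hk (memLp_ind _) hh]
  have part : ∀ L, L = J.minus ∨ L = J.plus → |av w h L * bform k σ w K.ind L.ind| ≤
      B * (√(σ.real K.toSet) * l2 w h) := by
    intro L hL
    have h1 := hB L hL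
    have h2 := hh.abs_av_mul_sqrt_le hL
    rw [abs_mul]
    calc _ ≤ |av w h L| * (B * (√(σ.real K.toSet) * √(w.real L.toSet))) := by gcongr
      _ = B * (√(σ.real K.toSet) * (|av w h L| * √(w.real L.toSet))) := by ring
      _ ≤ _ := by gcongr
  refine (abs_add_le _ _).trans ?_
  linarith [part _ (Or.inl rfl), part _ (Or.inr rfl)]

lemma abs_insideTerm_le (hA : A2 σ w ≠ ∞) (hk : PoissonDominated k M t) {B : ℝ}
    (hB0 : 0 ≤ B) {I J : Itv} {u v : Itv → ℝ → ℝ} (hu : HaarStep σ I (u I))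
    (hv : HaarStep w J (v J))
    (hB : ∀ K, K = I.minus ∨ K = I.plus → ∀ L, L = J.minus ∨ L = J.plus →
      |bform k σ w K.ind L.ind| ≤ B * (√(σ.real K.toSet) * √(w.real L.toSet))) :
    |insideTerm k σ w u v I J| ≤ 2 * B * (l2 σ (u I) * l2 w (v J)) := by
  have hK := I.childAt_eq_or J
  have h1 := abs_bform_ind_haarStep_le hA hk hB0 hv (hB _ hK)
  have h2 := hu.abs_av_mul_sqrt_le hK
  have := l2_nonneg w (v J)
  rw [insideTerm, abs_mul]
  calc _ ≤ |av σ (u I) (I.childAt J)| *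
        (2 * B * (√(σ.real (I.childAt J).toSet) * l2 w (v J))) := by gcongr
    _ = 2 * B * (|av σ (u I) (I.childAt J)| * √(σ.real (I.childAt J).toSet) * l2 w (v J)) := by
        ring
    _ ≤ _ := by gcongr

lemma abs_bform_haarStep_le (hA : A2 σ w ≠ ∞) (hk : PoissonDominated k M t) {B : ℝ}
    (hB0 : 0 ≤ B) {I J : Itv} {g h : ℝ → ℝ} (hg : HaarStep σ I g) (hh : HaarStep w J h)
    (hB : ∀ K, K = I.minus ∨ K = I.plus → ∀ L, L = J.minus ∨ L = J.plus →
      |bform k σ w K.ind L.ind| ≤ B * (√(σ.real K.toSet) * √(w.real L.toSet))) :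
    |bform k σ w g h| ≤ 4 * B * (l2 σ g * l2 w h) := by
  have hA' : A2 w σ ≠ ∞ := by rwa [A2_comm]
  have h0 := l2_nonneg w h
  have h1 := bform_haarStep_right (σ := w) (w := σ) hA' hk.flip hh.memLp hg
  rw [bform_flip k σ w, bform_flip k σ w, bform_flip k σ w] at h1
  have part : ∀ K, K = I.minus ∨ K = I.plus → |av σ g K * bform k σ w K.ind h| ≤
      2 * B * (l2 σ g * l2 w h) := by
    intro K hK
    have h1 := abs_bform_ind_haarStep_le hA hk hB0 hh (hB _ hK)
    have h2 := hg.abs_av_mul_sqrt_le hK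
    rw [abs_mul]
    calc _ ≤ |av σ g K| * (2 * B * (√(σ.real K.toSet) * l2 w h)) := by gcongr
      _ = 2 * B * (|av σ g K| * √(σ.real K.toSet) * l2 w h) := by ring
      _ ≤ _ := by gcongr
  rw [h1]
  refine (abs_add_le _ _).trans ?_
  linarith [part _ (Or.inl rfl), part _ (Or.inr rfl)]

open Classical in
/-- The form on the pair is a combination of its values on four pairs of children, and each inside
term of two such values. -/
lemma abs_residue_le (hA : A2 σ w ≠ ∞) (hk : PoissonDominated k M t) {B : ℝ} (hB0 : 0 ≤ B)
    (hB : ∀ K L : Itv, L.len ≤ 2 ^ r * K.len → K.len ≤ 2 ^ r * L.len →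
      |bform k σ w K.ind L.ind| ≤ B * (√(σ.real K.toSet) * √(w.real L.toSet)))
    {I J : Itv} {u v : Itv → ℝ → ℝ} (hu : HaarStep σ I (u I)) (hv : HaarStep w J (v J))
    (h1 : I.len ≤ 2 ^ r * J.len) (h2 : J.len ≤ 2 ^ r * I.len) :
    |residue k r σ w u v I J| ≤ 8 * B * (l2 σ (u I) * l2 w (v J)) := by
  have hA' : A2 w σ ≠ ∞ := by rwa [A2_comm]
  have hlen : ∀ (I K : Itv), K = I.minus ∨ K = I.plus → K.len = I.len / 2 := by
    rintro I K (rfl | rfl)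
    exacts [I.minus_len, I.plus_len]
  have hB' : ∀ K, K = I.minus ∨ K = I.plus → ∀ L, L = J.minus ∨ L = J.plus →
      |bform k σ w K.ind L.ind| ≤ B * (√(σ.real K.toSet) * √(w.real L.toSet)) := by
    intro K hK L hL
    apply hB <;> rw [hlen I K hK, hlen J L hL] <;> linarith
  have e1 := abs_bform_haarStep_le hA hk hB0 hu hv hB'
  have e2 := abs_insideTerm_le hA hk hB0 hu hv hB'
  have e3 := abs_insideTerm_le (u := v) (v := u) hA' hk.flip hB0 hv hu (fun L hL K hK => by
    rw [bform_flip k σ w, mul_comm (√_)]; exact hB' K hK L hL)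
  have hp : 0 ≤ B * (l2 σ (u I) * l2 w (v J)) :=
    mul_nonneg hB0 (mul_nonneg (l2_nonneg _ _) (l2_nonneg _ _))
  rw [mul_comm (l2 w _)] at e3
  unfold residue
  have h4 : |(if J.Inside r I then insideTerm k σ w u v I J else 0)| ≤
      2 * B * (l2 σ (u I) * l2 w (v J)) := by
    split_ifs
    · exact e2
    · rw [abs_zero]; linarith
  have h5 : |(if I.Inside r J then insideTerm (fun x y => k y x) w σ v u J I else 0)| ≤
      2 * B * (l2 σ (u I) * l2 w (v J)) := by
    split_ifs
    · exact e3
    · rw [abs_zero]; linarith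
  have h6 := abs_sub (bform k σ w (u I) (v J))
    (if J.Inside r I then insideTerm k σ w u v I J else 0)
  refine (abs_sub _ _).trans ?_
  linarith

open Classical in
/-- The near part is controlled by a weak boundedness constant `B` alone. -/
lemma abs_sum_residue_near_le (hA : A2 σ w ≠ ∞) (hk : PoissonDominated k M t)
    (hD : IsDyadicGrid D) {B : ℝ} (hB0 : 0 ≤ B)
    (hB : ∀ K L : Itv, L.len ≤ 2 ^ r * K.len → K.len ≤ 2 ^ r * L.len →
      |bform k σ w K.ind L.ind| ≤ B * (√(σ.real K.toSet) * √(w.real L.toSet)))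
    {F G : Finset Itv} {u v : Itv → ℝ → ℝ} (hF : ∀ I ∈ F, I ∈ D) (hu : ∀ I ∈ F, HaarStep σ I (u I))
    (hG : ∀ J ∈ G, J ∈ D) (hv : ∀ J ∈ G, HaarStep w J (v J)) :
    |∑ I ∈ F, ∑ J ∈ G, if Near r I J then residue k r σ w u v I J else 0| ≤
      8 * nearConst r * B * (fam σ F u * fam w G v) := by
  have h := sum_relation_le (F := F) (G := G) (R := Near r) (x := fun I => l2 σ (u I))
    (y := fun J => l2 w (v J)) (N := nearConst r) (fun I hI => card_near_le hD r (hF I hI) hG)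
    (fun J hJ => by
      simp_rw [near_comm (J := J)]
      exact card_near_le hD r (hG J hJ) hF)
  calc _ ≤ ∑ I ∈ F, ∑ J ∈ G, |if Near r I J then residue k r σ w u v I J else 0| :=
        (Finset.abs_sum_le_sum_abs _ _).trans
          (Finset.sum_le_sum fun I _ => Finset.abs_sum_le_sum_abs _ _)
    _ ≤ ∑ I ∈ F, ∑ J ∈ G, 8 * B * (if Near r I J then l2 σ (u I) * l2 w (v J) else 0) := by
        refine Finset.sum_le_sum fun I hI => Finset.sum_le_sum fun J hJ => ?_
        split_ifs with hn
        · exact abs_residue_le hA hk hB0 hB (hu I hI) (hv J hJ) hn.1 hn.2.1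
        · simp
    _ = 8 * B * ∑ I ∈ F, ∑ J ∈ G, (if Near r I J then l2 σ (u I) * l2 w (v J) else 0) := by
        simp_rw [Finset.mul_sum]
    _ ≤ 8 * B * (nearConst r * (fam σ F u * fam w G v)) := by gcongr; exact h
    _ = _ := by ring

end

/-! ### The residue of the sharp kernel -/

section

variable {D : Set Itv} {σ w : Measure ℝ} [IsLocallyFiniteMeasure σ]
  [IsLocallyFiniteMeasure w] {ε : ℝ} {r : ℕ} {M t : ℝ} {s : ℝ → ℝ}

/-- A pair that is not near is separated once the child of `I` around `J` is cut away, by the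
goodness of `J` or by definition. -/
lemma abs_residue_far_le (hA : A2 σ w ≠ ∞) (hD : IsDyadicGrid D) (hs : HasSmoothness s)
    (hsm : Measurable s) {c : ℝ} (hc : ∀ t, |s t| ≤ c)
    (hk : PoissonDominated (fun x y => s (x - y)) M t) (hε : 0 ≤ ε) (hε' : ε < 1) (hr : 1 ≤ r)
    {I J : Itv} (hI : I ∈ D) (hJ : J ∈ D) (hJg : IsGood D ε r J) {u v : Itv → ℝ → ℝ}
    (hu : HaarStep σ I (u I)) (hv : HaarStep w J (v J)) (hle : J.len ≤ I.len)
    (hfar : ¬ Near r I J) :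
    |residue (fun x y => s (x - y)) r σ w u v I J| ≤ 8 * ((J.len / I.len) ^ (1 - 2 * ε) *
      bform (fun x y => pk I.len (x - y)) σ w (fun y => |u I y|) (fun x => |v J x|)) := by
  obtain ⟨ℓ, lev, hL⟩ := hD.exists_isLevel
  have hIp := I.len_pos
  have hJp := J.len_pos
  have hpow : (2 : ℝ) ≤ 2 ^ r := by
    calc (2 : ℝ) = 2 ^ 1 := by norm_num
      _ ≤ _ := pow_le_pow_right₀ (by norm_num) hr
  have hnI : ¬ I.Inside r J := fun h => by nlinarith [h.2]
  have hJI : J.len ≤ 2 ^ r * I.len := by nlinarith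
  by_cases hin : J.Inside r I
  · have hlt : 2 ^ r * J.len < I.len := by
      by_contra h
      refine hfar ⟨not_lt.1 h, hJI, J.left, hin.1 J.left_mem, J.left, J.left_mem, ?_⟩
      rw [sub_self, abs_zero]
      exact lt_max_of_lt_left hIp
    have hl := hL.pow_succ_mul_len_le hI hJ hlt
    set K := I.childAt J with hK
    have hKc := I.childAt_eq_or J
    have hg : ∀ y, (y ∈ K.toSet ∧ u I y - av σ (u I) K * K.ind y = 0) ∨
        (y ∉ K.toSet ∧ u I y - av σ (u I) K * K.ind y = u I y) := by
      intro y
      by_cases hy : y ∈ K.toSet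
      · left; exact ⟨hy, by rw [ind_of_mem hy, hu.eq_av hKc hy]; ring⟩
      · right; exact ⟨hy, by rw [ind_of_notMem hy]; ring⟩
    have hgL : MemLp (fun y => u I y - av σ (u I) K * K.ind y) 2 σ :=
      hu.memLp.sub ((memLp_ind K).const_mul _)
    have hgi : Integrable (fun y => u I y - av σ (u I) K * K.ind y) σ :=
      hu.integrable.sub ((integrable_ind K).const_mul _)
    have e : residue (fun x y => s (x - y)) r σ w u v I J =
        bform (fun x y => s (x - y)) σ w (fun y => u I y - av σ (u I) K * K.ind y) (v J) := by
      rw [hk.bform_sub_left hA hu.memLp ((memLp_ind K).const_mul _) hv.memLp,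
        bform_const_mul_left, residue, if_pos hin, if_neg hnI, sub_zero]
      rfl
    rw [e]
    refine (abs_bform_separated_le hA hs hsm hc hk hε hε'.le hv hgL hgi hle ?_).trans ?_
    · intro x hx y hy
      rcases hg y with ⟨-, h0⟩ | ⟨hyK, -⟩
      · exact absurd h0 hy
      · exact hJg.le_abs_sub_of_subset hD hI hJ hl hin.1 hx hyK
    · rw [mul_assoc]
      gcongr
      have hp := poissonDominated_pk hIp
      refine integral_mono (hp.integrable hA hgL.abs hv.memLp.abs)
        (hp.integrable hA hu.memLp.abs hv.memLp.abs) fun z => ?_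
      have := pk_nonneg hIp (z.1 - z.2)
      have h1 : |u I z.2 - av σ (u I) K * K.ind z.2| ≤ |u I z.2| := by
        rcases hg z.2 with ⟨-, h0⟩ | ⟨-, h0⟩ <;> rw [h0]
        rw [abs_zero]; exact abs_nonneg _
      exact mul_le_mul_of_nonneg_left (mul_le_mul_of_nonneg_right h1 (abs_nonneg _)) this
  · rw [residue, if_neg hin, if_neg hnI, sub_zero, sub_zero, ← mul_assoc]
    refine abs_bform_separated_le hA hs hsm hc hk hε hε'.le hv hu.memLp hu.integrable hle ?_
    intro x hx y hy
    have hyI : y ∈ I.toSet := by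
      by_contra h; exact hy (hu.eq_zero_of_notMem h)
    rcases le_or_gt I.len (2 ^ r * J.len) with h | h
    · have h2 : I.len ≤ |x - y| := by
        by_contra h3
        refine hfar ⟨h, hJI, y, hyI, x, hx, ?_⟩
        rw [abs_sub_comm, max_eq_left hle]
        exact not_le.1 h3
      refine le_trans ?_ h2
      calc _ ≤ I.len ^ ε * I.len ^ (1 - ε) := by gcongr
        _ = I.len := by rw [← Real.rpow_add hIp]; simp
    · have hdisj : Disjoint J.toSet I.toSet :=
        (hD.subset_or_disjoint hI hJ hle).resolve_left fun h' => hin ⟨h', h.le⟩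
      exact hJg.le_abs_sub_of_disjoint hD hε' hI h.le hdisj hx hyI

/-- The constant in the bound for far pairs and the smooth kernel; the inverse is the sum of the
geometric series over the ratios of lengths. -/
noncomputable def farConst (ε : ℝ) : ℝ := 8 * ((1 - (2 : ℝ) ^ (-(1 - 2 * ε)))⁻¹ * 30)

open Classical in
/-- The far pairs with `J` the shorter interval. -/
lemma sum_abs_residue_far_le (hA : A2 σ w ≠ ∞) (hD : IsDyadicGrid D) (hs : HasSmoothness s)
    (hsm : Measurable s) {c : ℝ} (hc : ∀ t, |s t| ≤ c)
    (hk : PoissonDominated (fun x y => s (x - y)) M t) (hε : 0 ≤ ε) (hε' : ε < 1 / 2) (hr : 1 ≤ r)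
    {F G : Finset Itv} {u v : Itv → ℝ → ℝ} (hF : ∀ I ∈ F, I ∈ D) (hu : ∀ I ∈ F, HaarStep σ I (u I))
    (hG : ∀ J ∈ G, J ∈ D ∧ IsGood D ε r J) (hv : ∀ J ∈ G, HaarStep w J (v J)) :
    ∑ I ∈ F, ∑ J ∈ G, (if J.len ≤ I.len ∧ ¬ Near r I J then
      |residue (fun x y => s (x - y)) r σ w u v I J| else 0) ≤
      farConst ε * rootA2 σ w * (fam σ F u * fam w G v) := by
  have h := sum_ratio_rpow_mul_bform_pk_le hA hD hF hu (fun J hJ => (hG J hJ).1) hv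
    (δ := 1 - 2 * ε) (by linarith)
  have e : farConst ε * rootA2 σ w * (fam σ F u * fam w G v) =
      8 * ((1 - (2 : ℝ) ^ (-(1 - 2 * ε)))⁻¹ * (30 * rootA2 σ w * (fam σ F u * fam w G v))) := by
    unfold farConst; ring
  rw [e]
  refine le_trans ?_ (mul_le_mul_of_nonneg_left h (by norm_num))
  simp_rw [Finset.mul_sum]
  refine Finset.sum_le_sum fun I hI => Finset.sum_le_sum fun J hJ => ?_
  split_ifs with h1 h2 h2
  · exact abs_residue_far_le hA hD hs hsm hc hk hε (by linarith) hr (hF I hI) (hG J hJ).1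
      (hG J hJ).2 (hu I hI) (hv J hJ) h1.1 h1.2
  · exact absurd h1.1 h2
  · have hIp := I.len_pos
    have hJp := J.len_pos
    have : 0 ≤ bform (fun x y => pk I.len (x - y)) σ w (fun y => |u I y|) (fun x => |v J x|) :=
      integral_nonneg fun z => mul_nonneg (pk_nonneg hIp _) (by positivity)
    positivity
  · simp

open Classical in
/-- The far part for a smooth kernel. The pairs with `I` the shorter interval are reduced to those
with `J` the shorter one by exchanging the roles of `σ` and `w`. -/
lemma abs_sum_residue_far_le (hA : A2 σ w ≠ ∞) (hD : IsDyadicGrid D) (hs : HasSmoothness s)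
    (hsm : Measurable s) {c : ℝ} (hc : ∀ t, |s t| ≤ c)
    (hk : PoissonDominated (fun x y => s (x - y)) M t) (hε : 0 ≤ ε) (hε' : ε < 1 / 2) (hr : 1 ≤ r)
    {F G : Finset Itv} {u v : Itv → ℝ → ℝ} (hF : ∀ I ∈ F, I ∈ D ∧ IsGood D ε r I)
    (hu : ∀ I ∈ F, HaarStep σ I (u I))
    (hG : ∀ J ∈ G, J ∈ D ∧ IsGood D ε r J) (hv : ∀ J ∈ G, HaarStep w J (v J)) :
    |∑ I ∈ F, ∑ J ∈ G, if Near r I J then 0 else residue (fun x y => s (x - y)) r σ w u v I J| ≤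
      2 * farConst ε * rootA2 σ w * (fam σ F u * fam w G v) := by
  have hA' : A2 w σ ≠ ∞ := by rwa [A2_comm]
  have hflip : (fun x y => s (-(x - y))) = fun x y => s (y - x) := by
    ext x y; rw [neg_sub]
  have h1 := sum_abs_residue_far_le hA hD hs hsm hc hk hε hε' hr (fun I hI => (hF I hI).1) hu hG hv
  have h2 := sum_abs_residue_far_le (s := fun t => s (-t)) (M := M) (t := t) hA' hD hs.comp_neg
    (hsm.comp measurable_neg) (fun t => hc (-t)) (by rw [hflip]; exact hk.flip) hε hε' hr
    (fun J hJ => (hG J hJ).1) hv hF hu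
  rw [rootA2_comm, Finset.sum_comm, mul_comm (fam w G v)] at h2
  calc _ ≤ ∑ I ∈ F, ∑ J ∈ G,
        |if Near r I J then 0 else residue (fun x y => s (x - y)) r σ w u v I J| :=
        (Finset.abs_sum_le_sum_abs _ _).trans
          (Finset.sum_le_sum fun I _ => Finset.abs_sum_le_sum_abs _ _)
    _ ≤ ∑ I ∈ F, ∑ J ∈ G, ((if J.len ≤ I.len ∧ ¬ Near r I J then
          |residue (fun x y => s (x - y)) r σ w u v I J| else 0) +
        (if I.len ≤ J.len ∧ ¬ Near r J I then
          |residue (fun x y => s (-(x - y))) r w σ v u J I| else 0)) := by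
        refine Finset.sum_le_sum fun I _ => Finset.sum_le_sum fun J _ => ?_
        rw [hflip, residue_flip (fun x y => s (x - y)), near_comm (I := J)]
        by_cases hn : Near r I J
        · simp [hn]
        · simp only [hn, if_false, not_false_eq_true, and_true]
          have := abs_nonneg (residue (fun x y => s (x - y)) r σ w u v I J)
          rcases le_total J.len I.len with h | h
          · rw [if_pos h]; split_ifs <;> linarith
          · rw [if_pos h]; split_ifs <;> linarith
    _ ≤ _ := by
        simp_rw [Finset.sum_add_distrib]
        refine (add_le_add h1 h2).trans_eq (by ring)

variable {k : ℝ → ℝ → ℝ} {a : ℝ}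

/-- The constant in the bound for all pairs and a local kernel: the whole form, and two inside
sums. -/
noncomputable def localConst (r : ℕ) : ℝ := 60 + 2 * insideConst r

/-- For a local kernel the whole form and both inside sums are bounded separately, so the
cancellation between them is not needed. -/
lemma LocalKernel.abs_sum_residue_le (hA : A2 σ w ≠ ∞) (hk : LocalKernel k a)
    (hD : IsDyadicGrid D) (hε' : ε ≤ 1) {F G : Finset Itv} {u v : Itv → ℝ → ℝ}
    (hF : ∀ I ∈ F, I ∈ D ∧ IsGood D ε r I) (hu : ∀ I ∈ F, HaarStep σ I (u I))
    (hG : ∀ J ∈ G, J ∈ D ∧ IsGood D ε r J) (hv : ∀ J ∈ G, HaarStep w J (v J)) :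
    |∑ I ∈ F, ∑ J ∈ G, residue k r σ w u v I J| ≤
      localConst r * rootA2 σ w * (fam σ F u * fam w G v) := by
  classical
  have hA' : A2 w σ ≠ ∞ := by rwa [A2_comm]
  have hp := hk.poissonDominated
  have h1 := hp.abs_bform_le hA (memLp_sum hu) (memLp_sum hv)
  rw [l2_sum_eq_fam hD (fun I hI => (hF I hI).1) hu,
    l2_sum_eq_fam hD (fun I hI => (hG I hI).1) hv,
    hp.bform_sum_left hA F (fun I hI => (hu I hI).memLp) (memLp_sum hv)] at h1
  rw [Finset.sum_congr rfl fun I hI =>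
    hp.bform_sum_right hA G (hu I hI).memLp fun J hJ => (hv J hJ).memLp] at h1
  have h2 := abs_sum_inside_le hA hk hD hε' (fun I hI => (hF I hI).1) hu hG hv
  have h3 := abs_sum_inside_le hA' hk.flip hD hε' (fun I hI => (hG I hI).1) hv hF hu
  rw [rootA2_comm, Finset.sum_comm, mul_comm (fam w G v)] at h3
  unfold residue
  simp_rw [Finset.sum_sub_distrib]
  have h4 := abs_sub (∑ I ∈ F, ∑ J ∈ G, bform k σ w (u I) (v J) -
    ∑ I ∈ F, ∑ J ∈ G, if J.Inside r I then insideTerm k σ w u v I J else 0)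
    (∑ I ∈ F, ∑ J ∈ G, if I.Inside r J then insideTerm (fun x y => k y x) w σ v u J I else 0)
  have h5 := abs_sub (∑ I ∈ F, ∑ J ∈ G, bform k σ w (u I) (v J))
    (∑ I ∈ F, ∑ J ∈ G, if J.Inside r I then insideTerm k σ w u v I J else 0)
  have e : localConst r * rootA2 σ w * (fam σ F u * fam w G v) =
      2 * (30 * rootA2 σ w) * (fam σ F u * fam w G v) +
      insideConst r * rootA2 σ w * (fam σ F u * fam w G v) +
      insideConst r * rootA2 σ w * (fam σ F u * fam w G v) := by unfold localConst; ring
  rw [e]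
  linarith

open Classical in
/-- The far part for a local kernel, as the whole sum minus the near part. The kernel is its own
majorant, so `√A₂` serves as the weak boundedness constant. -/
lemma LocalKernel.abs_sum_residue_far_le (hA : A2 σ w ≠ ∞) (hk : LocalKernel k a)
    (hD : IsDyadicGrid D) (hε' : ε ≤ 1) {F G : Finset Itv} {u v : Itv → ℝ → ℝ}
    (hF : ∀ I ∈ F, I ∈ D ∧ IsGood D ε r I) (hu : ∀ I ∈ F, HaarStep σ I (u I))
    (hG : ∀ J ∈ G, J ∈ D ∧ IsGood D ε r J) (hv : ∀ J ∈ G, HaarStep w J (v J)) :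
    |∑ I ∈ F, ∑ J ∈ G, if Near r I J then 0 else residue k r σ w u v I J| ≤
      (localConst r + 480 * nearConst r) * rootA2 σ w * (fam σ F u * fam w G v) := by
  have h1 := hk.abs_sum_residue_le hA hD hε' hF hu hG hv
  have h2 := abs_sum_residue_near_le (r := r) hA hk.poissonDominated hD (B := 60 * rootA2 σ w)
    (by have := rootA2_nonneg σ w; positivity)
    (fun K L _ _ => by
      have := hk.abs_bform_ind_le hA K (memLp_ind (μ := w) L)
      rwa [l2_ind] at this) (fun I hI => (hF I hI).1) hu (fun J hJ => (hG J hJ).1) hv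
  have e : ∑ I ∈ F, ∑ J ∈ G, (if Near r I J then 0 else residue k r σ w u v I J) =
      ∑ I ∈ F, ∑ J ∈ G, residue k r σ w u v I J -
      ∑ I ∈ F, ∑ J ∈ G, if Near r I J then residue k r σ w u v I J else 0 := by
    rw [← Finset.sum_sub_distrib]
    refine Finset.sum_congr rfl fun I _ => ?_
    rw [← Finset.sum_sub_distrib]
    refine Finset.sum_congr rfl fun J _ => ?_
    split_ifs <;> ring
  rw [e]
  refine (abs_sub _ _).trans ((add_le_add h1 h2).trans_eq (by ring))

/-- The constant for finite sums: near pairs, far pairs for the smooth kernel, and far pairs for the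
two local kernels. -/
noncomputable def finiteConst (ε : ℝ) (r : ℕ) : ℝ :=
  8 * nearConst r + 2 * farConst ε + 2 * (localConst r + 480 * nearConst r)

lemma nearConst_nonneg (r : ℕ) : 0 ≤ nearConst r := by unfold nearConst; positivity

lemma localConst_nonneg (r : ℕ) : 0 ≤ localConst r := by
  unfold localConst insideConst; positivity

lemma farConst_nonneg (hε' : ε < 1 / 2) : 0 ≤ farConst ε := by
  unfold farConst
  have : (2 : ℝ) ^ (-(1 - 2 * ε)) < 1 :=
    Real.rpow_lt_one_of_one_lt_of_neg (by norm_num) (by linarith)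
  have : 0 < 1 - (2 : ℝ) ^ (-(1 - 2 * ε)) := by linarith
  positivity

lemma finiteConst_nonneg (hε' : ε < 1 / 2) : 0 ≤ finiteConst ε r := by
  have := nearConst_nonneg r
  have := localConst_nonneg r
  have := farConst_nonneg hε'
  unfold finiteConst; positivity

/-- The estimate for finite sums of Haar differences. -/
theorem abs_sum_residue_sharp_le (hA : A2 σ w ≠ ∞) (hD : IsDyadicGrid D) {α β : ℝ} (hα : 0 < α)
    (hβ : α < β) (hε : 0 ≤ ε) (hε' : ε < 1 / 2) (hr : 1 ≤ r) {W : ℝ} (hW : 0 ≤ W)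
    (hB : ∀ K L : Itv, L.len ≤ 2 ^ r * K.len → K.len ≤ 2 ^ r * L.len →
      |bform (fun x y => sharpKernel α β (x - y)) σ w K.ind L.ind| ≤
        W * (√(σ.real K.toSet) * √(w.real L.toSet)))
    {F G : Finset Itv} {u v : Itv → ℝ → ℝ}
    (hF : ∀ I ∈ F, I ∈ D ∧ IsGood D ε r I) (hu : ∀ I ∈ F, HaarStep σ I (u I))
    (hG : ∀ J ∈ G, J ∈ D ∧ IsGood D ε r J) (hv : ∀ J ∈ G, HaarStep w J (v J)) :
    |∑ I ∈ F, ∑ J ∈ G, residue (fun x y => sharpKernel α β (x - y)) r σ w u v I J| ≤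
      finiteConst ε r * (rootA2 σ w + W) * (fam σ F u * fam w G v) := by
  classical
  have hK := poissonDominated_sharp hα hβ
  have hS := poissonDominated_smooth hα hβ
  have hO := localKernel_outer (hα.trans hβ)
  have hN := localKernel_inner hα
  have h1 := abs_sum_residue_near_le hA hK hD hW hB (fun I hI => (hF I hI).1) hu
    (fun J hJ => (hG J hJ).1) hv
  have h2 := abs_sum_residue_far_le hA hD (hasSmoothness_smoothKernel α β)
    (measurable_smoothKernel α β) (abs_smoothKernel_le hα hβ) hS hε hε' hr hF hu hG hv
  have h3 := hO.abs_sum_residue_far_le hA hD (by linarith) hF hu hG hv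
  have h4 := hN.abs_sum_residue_far_le hA hD (by linarith) hF hu hG hv
  set X := fam σ F u * fam w G v
  have hX : 0 ≤ X := mul_nonneg (fam_nonneg _ _ _) (fam_nonneg _ _ _)
  have e : ∑ I ∈ F, ∑ J ∈ G, residue (fun x y => sharpKernel α β (x - y)) r σ w u v I J =
      ∑ I ∈ F, ∑ J ∈ G, (if Near r I J then
        residue (fun x y => sharpKernel α β (x - y)) r σ w u v I J else 0) +
      (∑ I ∈ F, ∑ J ∈ G, (if Near r I J then 0 else
        residue (fun x y => smoothKernel α β (x - y)) r σ w u v I J) +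
      (∑ I ∈ F, ∑ J ∈ G, (if Near r I J then 0 else
        residue (fun x y => outerKernel β (x - y)) r σ w u v I J) +
      ∑ I ∈ F, ∑ J ∈ G, (if Near r I J then 0 else
        residue (fun x y => innerKernel α (x - y)) r σ w u v I J))) := by
    simp_rw [← Finset.sum_add_distrib]
    refine Finset.sum_congr rfl fun I hI => Finset.sum_congr rfl fun J hJ => ?_
    split_ifs
    · ring
    · have hON : PoissonDominated
          (fun x y => outerKernel β (x - y) + innerKernel α (x - y)) (2 * (α⁻¹ + α⁻¹) * β) β :=
        poissonDominated_of_abs_le ((measurable_outerKernel β).add (measurable_innerKernel α))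
          (hα.trans hβ) (fun t => by
            have e : outerKernel β t + innerKernel α t =
              sharpKernel α β t - smoothKernel α β t := by rw [sharpKernel_eq hβ]; ring
            change |outerKernel β t + innerKernel α t| ≤ _
            rw [e]
            exact (abs_sub _ _).trans
              (add_le_add (abs_sharpKernel_le hα t) (abs_smoothKernel_le hα hβ t)))
          (fun t ht => by
            have e : outerKernel β t + innerKernel α t =
              sharpKernel α β t - smoothKernel α β t := by rw [sharpKernel_eq hβ]; ring
            change outerKernel β t + innerKernel α t = 0
            rw [e, sharpKernel_eq_zero ht, smoothKernel_eq_zero hβ ht, sub_zero])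
      rw [zero_add, ← residue_add hA hO.poissonDominated hN.poissonDominated (hu I hI) (hv J hJ),
        ← residue_add hA hS hON (hu I hI) (hv J hJ)]
      congr 1
      ext x y
      exact sharpKernel_eq hβ _
  rw [e]
  refine (abs_add_le _ _).trans ((add_le_add h1 ((abs_add_le _ _).trans (add_le_add h2
    ((abs_add_le _ _).trans (add_le_add h3 h4))))).trans ?_)
  have hR := rootA2_nonneg σ w
  have n1 := nearConst_nonneg r
  have n2 := localConst_nonneg r
  have n3 := farConst_nonneg hε'
  have key : 8 * nearConst r * W + (2 * farConst ε * rootA2 σ w +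
      ((localConst r + 480 * nearConst r) * rootA2 σ w +
        (localConst r + 480 * nearConst r) * rootA2 σ w)) ≤
      finiteConst ε r * (rootA2 σ w + W) := by
    unfold finiteConst
    have m1 : 0 ≤ nearConst r * rootA2 σ w := by positivity
    have m2 : 0 ≤ nearConst r * W := by positivity
    have m3 : 0 ≤ localConst r * W := by positivity
    have m4 : 0 ≤ farConst ε * W := by positivity
    linarith
  calc _ = (8 * nearConst r * W + (2 * farConst ε * rootA2 σ w +
      ((localConst r + 480 * nearConst r) * rootA2 σ w +
        (localConst r + 480 * nearConst r) * rootA2 σ w))) * X := by ring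
    _ ≤ _ := by gcongr

end

/-! ### A Hardy inequality for adjacent intervals -/

/-- The chain rule `d(m²) ≤ 2 m dm` for the distribution function `m` of `μ`, with atoms allowed:
at least half of the square `(-∞, u]²` lies on or below the diagonal. -/
lemma measure_Iic_sq_le (μ : Measure ℝ) [SFinite μ] (u : ℝ) :
    μ (Set.Iic u) ^ 2 ≤ 2 * ∫⁻ v in Set.Iic u, μ (Set.Iic v) ∂μ := by
  set ρ := μ.restrict (Set.Iic u) with hρ
  have hu : ρ Set.univ = μ (Set.Iic u) := by rw [hρ, Measure.restrict_apply_univ]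
  have hswap : ∫⁻ v, ρ (Set.Ici v) ∂ρ = ∫⁻ v, ρ (Set.Iic v) ∂ρ := by
    have hs : MeasurableSet {p : ℝ × ℝ | p.1 ≤ p.2} := measurableSet_le measurable_fst measurable_snd
    have h1 := Measure.prod_apply (μ := ρ) (ν := ρ) hs
    have h2 := Measure.prod_apply_symm (μ := ρ) (ν := ρ) hs
    exact h1.symm.trans h2
  calc μ (Set.Iic u) ^ 2 = ∫⁻ _, ρ Set.univ ∂ρ := by rw [lintegral_const, hu, sq]
    _ ≤ ∫⁻ v, ρ (Set.Iic v) + ρ (Set.Ici v) ∂ρ := by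
        refine lintegral_mono fun v => ?_
        rw [← Set.Iic_union_Ici (a := v)]
        exact measure_union_le _ _
    _ = 2 * ∫⁻ v, ρ (Set.Iic v) ∂ρ := by
        have hm : Measurable fun v => ρ (Set.Iic v) :=
          Monotone.measurable fun a b h => measure_mono (Set.Iic_subset_Iic.2 h)
        rw [lintegral_add_left hm, hswap, two_mul]
    _ ≤ _ := by
        exact mul_le_mul' le_rfl (lintegral_mono fun v => Measure.restrict_apply_le _ _)

/-- Hardy's inequality with the Poisson-type `A₂` condition, tested on a constant. -/
lemma lintegral_hardy_le {μ ν : Measure ℝ} [SFinite μ] [SFinite ν] {A : ℝ≥0∞}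
    (hμ : ∀ᵐ v ∂μ, 0 ≤ v)
    (hA : ∀ t > 0, μ (Set.Iic t) * ∫⁻ u in Set.Ici t, ENNReal.ofReal (1 / u) ^ 2 ∂ν ≤ A) :
    ∫⁻ u, ENNReal.ofReal (1 / u) * μ (Set.Iic u) ∂ν ≤
      (2 * A * μ Set.univ) ^ (1 / 2 : ℝ) * ν Set.univ ^ (1 / 2 : ℝ) := by
  have hm : Measurable fun v => μ (Set.Iic v) :=
    Monotone.measurable fun a b h => measure_mono (Set.Iic_subset_Iic.2 h)
  have hq : Measurable fun u : ℝ => ENNReal.ofReal (1 / u) := by fun_prop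
  -- the hypothesis extends to `t = 0` by monotone convergence
  have hA' : ∀ v, 0 ≤ v →
      μ (Set.Iic v) * ∫⁻ u in Set.Ici v, ENNReal.ofReal (1 / u) ^ 2 ∂ν ≤ A := by
    intro v hv
    rcases hv.eq_or_lt with rfl | hv
    swap
    · exact hA v hv
    have hpos : ∀ n : ℕ, (0 : ℝ) < 1 / ((n : ℝ) + 1) := fun n => by positivity
    calc _ ≤ μ (Set.Iic 0) * ∫⁻ u, ⨆ n : ℕ,
          (Set.Ici (1 / ((n : ℝ) + 1))).indicator (fun u => ENNReal.ofReal (1 / u) ^ 2) u ∂ν := by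
          rw [← lintegral_indicator measurableSet_Ici]
          gcongr with u
          by_cases hu : 0 < u
          · obtain ⟨n, hn⟩ := exists_nat_one_div_lt hu
            refine le_iSup_of_le n ?_
            rw [Set.indicator_of_mem (Set.mem_Ici.2 hu.le),
              Set.indicator_of_mem (Set.mem_Ici.2 hn.le)]
          · have : ENNReal.ofReal (1 / u) = 0 :=
              ENNReal.ofReal_of_nonpos (one_div_nonpos.2 (not_lt.1 hu))
            rw [Set.indicator_apply, this]
            split_ifs <;> simp
      _ = ⨆ n : ℕ, μ (Set.Iic 0) *
            ∫⁻ u in Set.Ici (1 / ((n : ℝ) + 1)), ENNReal.ofReal (1 / u) ^ 2 ∂ν := by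
          rw [lintegral_iSup (fun n => (hq.pow_const 2).indicator measurableSet_Ici), ENNReal.mul_iSup]
          · simp_rw [lintegral_indicator measurableSet_Ici]
          · intro n m hnm u
            refine Set.indicator_le_indicator_of_subset (Set.Ici_subset_Ici.2 ?_)
              (fun _ => zero_le) u
            exact one_div_le_one_div_of_le (by positivity) (by gcongr)
      _ ≤ A := iSup_le fun n => le_trans (by gcongr; exact (hpos n).le) (hA _ (hpos n))
  have hcs := lintegral_mul_le_sqrt_mul_sqrt ν
    (f := fun u => ENNReal.ofReal (1 / u) * μ (Set.Iic u)) (g := fun _ => 1)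
    (hq.mul hm).aemeasurable aemeasurable_const
  simp only [mul_one, one_pow, lintegral_const, one_mul] at hcs
  refine hcs.trans ?_
  gcongr
  calc ∫⁻ u, (ENNReal.ofReal (1 / u) * μ (Set.Iic u)) ^ 2 ∂ν
      ≤ ∫⁻ u, ∫⁻ v, 2 * (ENNReal.ofReal (1 / u) ^ 2 *
          (Set.Iic u).indicator (fun v => μ (Set.Iic v)) v) ∂μ ∂ν := by
        refine lintegral_mono fun u => ?_
        rw [lintegral_const_mul _ (((hm.indicator measurableSet_Iic)).const_mul _),
          lintegral_const_mul _ (hm.indicator measurableSet_Iic),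
          lintegral_indicator measurableSet_Iic, mul_pow]
        calc _ ≤ ENNReal.ofReal (1 / u) ^ 2 * (2 * ∫⁻ v in Set.Iic u, μ (Set.Iic v) ∂μ) := by
              gcongr; exact measure_Iic_sq_le μ u
          _ = _ := by ring
    _ = ∫⁻ v, ∫⁻ u, 2 * (ENNReal.ofReal (1 / u) ^ 2 *
          (Set.Iic u).indicator (fun v => μ (Set.Iic v)) v) ∂ν ∂μ := by
        refine lintegral_lintegral_swap (Measurable.aemeasurable ?_)
        have h1 : Measurable fun p : ℝ × ℝ =>
            (Set.Iic p.1).indicator (fun v => μ (Set.Iic v)) p.2 := by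
          have h2 : (fun p : ℝ × ℝ => (Set.Iic p.1).indicator (fun v => μ (Set.Iic v)) p.2) =
              {p : ℝ × ℝ | p.2 ≤ p.1}.indicator fun p => μ (Set.Iic p.2) := by
            ext p; simp [Set.indicator_apply]
          rw [h2]
          exact (hm.comp measurable_snd).indicator (measurableSet_le measurable_snd measurable_fst)
        exact (((hq.comp measurable_fst).pow_const 2).mul h1).const_mul 2
    _ ≤ ∫⁻ _, 2 * A ∂μ := by
        refine lintegral_mono_ae (hμ.mono fun v hv => ?_)
        have e : ∀ u, 2 * (ENNReal.ofReal (1 / u) ^ 2 *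
            (Set.Iic u).indicator (fun v => μ (Set.Iic v)) v) =
            (2 * μ (Set.Iic v)) *
              (Set.Ici v).indicator (fun u => ENNReal.ofReal (1 / u) ^ 2) u := by
          intro u
          simp only [Set.indicator_apply, Set.mem_Iic, Set.mem_Ici]
          split_ifs
          · ring
          · simp
        simp_rw [e]
        rw [lintegral_const_mul _ ((hq.pow_const 2).indicator measurableSet_Ici),
          lintegral_indicator measurableSet_Ici, mul_assoc]
        gcongr
        exact hA' v hv
    _ = 2 * A * μ Set.univ := by rw [lintegral_const]

/-- The mass within distance `t` of `b`, on one side, against the Poisson extension at `(b, t)`. The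
map `e` is the distance to `b`, that is `y ↦ y - b` or `y ↦ b - y`. -/
lemma map_Iic_le_poisson (σ : Measure ℝ) (Q : Itv) {b t : ℝ} (ht : 0 < t) {e : ℝ → ℝ}
    (he : Measurable e) (habs : ∀ y, |e y| = |b - y|) (h0 : ∀ y ∈ Q.toSet, 0 ≤ e y) :
    (σ.restrict Q.toSet).map e (Set.Iic t) ≤
      ENNReal.ofReal (2 * Real.pi * t) * poisson σ b t := by
  rw [Measure.map_apply he measurableSet_Iic, Measure.restrict_apply (he measurableSet_Iic),
    poisson, ← lintegral_const_mul _ (by fun_prop), ← lintegral_indicator_one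
      ((he measurableSet_Iic).inter Q.measurableSet_toSet)]
  refine lintegral_mono fun y => ?_
  by_cases h : y ∈ e ⁻¹' Set.Iic t ∩ Q.toSet
  swap
  · rw [Set.indicator_of_notMem h]; exact zero_le
  · rw [Set.indicator_of_mem h]
    obtain ⟨h1, h2⟩ := h
    have h3 : |b - y| ≤ t := by rw [← habs, abs_of_nonneg (h0 y h2)]; exact h1
    have h4 : (b - y) ^ 2 ≤ t ^ 2 := by rw [← sq_abs (b - y)]; gcongr
    rw [← ENNReal.ofReal_mul (by positivity), Pi.one_apply, ← ENNReal.ofReal_one]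
    refine ENNReal.ofReal_le_ofReal ?_
    have hpi := Real.pi_pos
    rw [← mul_div_assoc, le_div_iff₀ (by positivity)]
    nlinarith

/-- The tail beyond distance `t` from `b` against the Poisson extension at `(b, t)`. -/
lemma lintegral_map_le_poisson (w : Measure ℝ) (P : Itv) {b t : ℝ} (ht : 0 < t) {e : ℝ → ℝ}
    (he : Measurable e) (habs : ∀ y, |e y| = |b - y|) :
    ∫⁻ u in Set.Ici t, ENNReal.ofReal (1 / u) ^ 2 ∂((w.restrict P.toSet).map e) ≤
      ENNReal.ofReal (2 * Real.pi / t) * poisson w b t := by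
  have hq : Measurable fun u : ℝ => ENNReal.ofReal (1 / u) ^ 2 := by fun_prop
  rw [← lintegral_indicator measurableSet_Ici,
    lintegral_map (hq.indicator measurableSet_Ici) he]
  refine (setLIntegral_le_lintegral _ _).trans ?_
  rw [poisson, ← lintegral_const_mul _ (by fun_prop)]
  refine lintegral_mono fun y => ?_
  simp only [Set.indicator_apply]
  split_ifs with h
  · have h1 : t ≤ e y := h
    have h2 : (e y) ^ 2 = (b - y) ^ 2 := by rw [← sq_abs, habs, sq_abs]
    have hpos : 0 < e y := ht.trans_le h1
    rw [← ENNReal.ofReal_pow (by positivity), ← ENNReal.ofReal_mul (by positivity)]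
    refine ENNReal.ofReal_le_ofReal ?_
    rw [← h2]
    have e1 : 2 * Real.pi / t * (t / (Real.pi * (t ^ 2 + e y ^ 2))) = 2 / (t ^ 2 + e y ^ 2) := by
      field_simp
    rw [e1, div_pow, one_pow, div_le_div_iff₀ (by positivity) (by positivity)]
    nlinarith
  · exact zero_le

/-- The hypothesis of the Hardy inequality follows from the Poisson `A₂` condition at the common
endpoint `b`. -/
lemma map_mul_lintegral_map_le_A2 (σ w : Measure ℝ) (P Q : Itv) {b t : ℝ} (ht : 0 < t)
    {e e' : ℝ → ℝ} (he : Measurable e) (habs : ∀ y, |e y| = |b - y|) (h0 : ∀ y ∈ Q.toSet, 0 ≤ e y)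
    (he' : Measurable e') (habs' : ∀ y, |e' y| = |b - y|) :
    (σ.restrict Q.toSet).map e (Set.Iic t) *
      ∫⁻ u in Set.Ici t, ENNReal.ofReal (1 / u) ^ 2 ∂((w.restrict P.toSet).map e') ≤
      40 * A2 σ w := by
  refine (mul_le_mul' (map_Iic_le_poisson σ Q ht he habs h0)
    (lintegral_map_le_poisson w P ht he' habs')).trans ?_
  calc _ = ENNReal.ofReal (2 * Real.pi * t) * ENNReal.ofReal (2 * Real.pi / t) *
        (poisson w b t * poisson σ b t) := by ring
    _ ≤ 40 * A2 σ w := by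
        gcongr
        · rw [← ENNReal.ofReal_mul (by positivity)]
          have h1 : 2 * Real.pi * t * (2 * Real.pi / t) = 4 * Real.pi ^ 2 := by field_simp; ring
          rw [h1, show (40 : ℝ≥0∞) = ENNReal.ofReal 40 by norm_num]
          refine ENNReal.ofReal_le_ofReal ?_
          have := Real.pi_lt_d2
          have := Real.pi_pos
          nlinarith
        · exact poisson_mul_le_A2 σ w ht b

/-- The Hilbert kernel on disjoint intervals is controlled by `A₂` alone: with `u`, `v` the
distances of the two points to an endpoint between them, `1 / (u + v)` is at most the reciprocal of
the larger one, and each of the two cases is a Hardy inequality. -/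
lemma lintegral_inv_abs_le {σ w : Measure ℝ} [IsLocallyFiniteMeasure σ]
    [IsLocallyFiniteMeasure w] {P Q : Itv} (hPQ : P.right ≤ Q.left) :
    ∫⁻ x in P.toSet, ∫⁻ y in Q.toSet, ENNReal.ofReal (1 / |x - y|) ∂σ ∂w ≤
      18 * A2 σ w ^ (1 / 2 : ℝ) * (σ Q.toSet ^ (1 / 2 : ℝ) * w P.toSet ^ (1 / 2 : ℝ)) := by
  set b := Q.left
  have heQ : Measurable fun y : ℝ => y - b := by fun_prop
  have heP : Measurable fun x : ℝ => b - x := by fun_prop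
  set μ := (σ.restrict Q.toSet).map fun y => y - b with hμ
  set ν := (w.restrict P.toSet).map fun x => b - x with hν
  have hQ0 : ∀ y ∈ Q.toSet, 0 ≤ y - b := fun y hy => sub_nonneg.2 hy.1
  have hP0 : ∀ x ∈ P.toSet, 0 < b - x := fun x hx => sub_pos.2 (hx.2.trans_le hPQ)
  have habs : ∀ y, |y - b| = |b - y| := fun y => abs_sub_comm _ _
  have hq : Measurable fun u : ℝ => ENNReal.ofReal (1 / u) := by fun_prop
  have hμ0 : ∀ᵐ v ∂μ, 0 ≤ v := by
    rw [ae_map_iff heQ.aemeasurable measurableSet_Ici]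
    exact (ae_restrict_iff' Q.measurableSet_toSet).2 (Eventually.of_forall hQ0)
  have hν0 : ∀ᵐ v ∂ν, 0 ≤ v := by
    rw [ae_map_iff heP.aemeasurable measurableSet_Ici]
    exact (ae_restrict_iff' P.measurableSet_toSet).2
      (Eventually.of_forall fun x hx => (hP0 x hx).le)
  have hμu : μ Set.univ = σ Q.toSet := by
    rw [hμ, Measure.map_apply heQ MeasurableSet.univ]; simp
  have hνu : ν Set.univ = w P.toSet := by
    rw [hν, Measure.map_apply heP MeasurableSet.univ]; simp
  have H1 := lintegral_hardy_le (μ := μ) (ν := ν) hμ0 fun t ht =>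
    map_mul_lintegral_map_le_A2 σ w P Q ht heQ habs hQ0 heP fun _ => rfl
  have H2 := lintegral_hardy_le (μ := ν) (ν := μ) hν0 fun t ht =>
    map_mul_lintegral_map_le_A2 w σ Q P ht heP (fun _ => rfl) (fun x hx => (hP0 x hx).le) heQ habs
  rw [hμu, hνu] at H1 H2
  rw [A2_comm] at H2
  have hroot : ∀ m : ℝ≥0∞, (2 * (40 * A2 σ w) * m) ^ (1 / 2 : ℝ) ≤
      9 * A2 σ w ^ (1 / 2 : ℝ) * m ^ (1 / 2 : ℝ) := by
    intro m
    rw [← mul_assoc, ENNReal.mul_rpow_of_nonneg _ _ (by norm_num),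
      ENNReal.mul_rpow_of_nonneg _ _ (by norm_num)]
    gcongr
    have h1 : (2 * 40 : ℝ≥0∞) ≤ 9 ^ (2 : ℝ) := by norm_num
    refine (ENNReal.rpow_le_rpow h1 (by norm_num : (0 : ℝ) ≤ 1 / 2)).trans_eq ?_
    rw [← ENNReal.rpow_mul]; norm_num
  have hmeas1 : Measurable fun p : ℝ × ℝ =>
      (Set.Iic p.1).indicator (fun _ => ENNReal.ofReal (1 / p.1)) p.2 := by
    have : (fun p : ℝ × ℝ => (Set.Iic p.1).indicator (fun _ => ENNReal.ofReal (1 / p.1)) p.2) =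
        {p : ℝ × ℝ | p.2 ≤ p.1}.indicator fun p => ENNReal.ofReal (1 / p.1) := by
      ext p; simp [Set.indicator_apply]
    rw [this]
    exact (hq.comp measurable_fst).indicator (measurableSet_le measurable_snd measurable_fst)
  calc _ ≤ ∫⁻ x in P.toSet, ∫⁻ y in Q.toSet,
        ((Set.Iic (b - x)).indicator (fun _ => ENNReal.ofReal (1 / (b - x))) (y - b) +
          (Set.Iic (y - b)).indicator (fun _ => ENNReal.ofReal (1 / (y - b))) (b - x)) ∂σ ∂w := by
        refine setLIntegral_mono' P.measurableSet_toSet fun x hx => ?_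
        refine setLIntegral_mono' Q.measurableSet_toSet fun y hy => ?_
        have h1 := hP0 x hx
        have h2 := hQ0 y hy
        have h3 : |x - y| = (b - x) + (y - b) := by rw [abs_of_nonpos (by linarith)]; ring
        rw [h3]
        rcases le_total (y - b) (b - x) with h | h
        · refine le_add_right ?_
          rw [Set.indicator_of_mem (Set.mem_Iic.2 h)]
          exact ENNReal.ofReal_le_ofReal (one_div_le_one_div_of_le h1 (by linarith))
        · refine le_add_left ?_
          rw [Set.indicator_of_mem (Set.mem_Iic.2 h)]
          exact ENNReal.ofReal_le_ofReal (one_div_le_one_div_of_le (h1.trans_le h) (by linarith))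
    _ = ∫⁻ u, ∫⁻ v, ((Set.Iic u).indicator (fun _ => ENNReal.ofReal (1 / u)) v +
          (Set.Iic v).indicator (fun _ => ENNReal.ofReal (1 / v)) u) ∂μ ∂ν := by
        have hm : Measurable fun p : ℝ × ℝ =>
            (Set.Iic p.1).indicator (fun _ => ENNReal.ofReal (1 / p.1)) p.2 +
            (Set.Iic p.2).indicator (fun _ => ENNReal.ofReal (1 / p.2)) p.1 :=
          hmeas1.add (hmeas1.comp measurable_swap)
        rw [hν, lintegral_map hm.lintegral_prod_right' heP]
        refine lintegral_congr fun x => ?_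
        exact (lintegral_map (hm.comp measurable_prodMk_left) heQ).symm
    _ = ∫⁻ u, ENNReal.ofReal (1 / u) * μ (Set.Iic u) ∂ν +
          ∫⁻ v, ENNReal.ofReal (1 / v) * ν (Set.Iic v) ∂μ := by
        have e1 : ∀ (ρ : Measure ℝ) (u : ℝ),
            ∫⁻ v, (Set.Iic u).indicator (fun _ => ENNReal.ofReal (1 / u)) v ∂ρ =
            ENNReal.ofReal (1 / u) * ρ (Set.Iic u) := fun ρ u =>
          lintegral_indicator_const measurableSet_Iic _
        have e2 : ∀ u, ∫⁻ v, ((Set.Iic u).indicator (fun _ => ENNReal.ofReal (1 / u)) v +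
            (Set.Iic v).indicator (fun _ => ENNReal.ofReal (1 / v)) u) ∂μ =
            ENNReal.ofReal (1 / u) * μ (Set.Iic u) +
            ∫⁻ v, (Set.Iic v).indicator (fun _ => ENNReal.ofReal (1 / v)) u ∂μ := fun u => by
          rw [lintegral_add_left (measurable_const.indicator measurableSet_Iic), e1]
        have hm2 : Measurable fun u =>
            ∫⁻ v, (Set.Iic v).indicator (fun _ => ENNReal.ofReal (1 / v)) u ∂μ :=
          (hmeas1.comp measurable_swap).lintegral_prod_right'
        have e3 : ∫⁻ u, ∫⁻ v, (Set.Iic v).indicator (fun _ => ENNReal.ofReal (1 / v)) u ∂μ ∂ν =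
            ∫⁻ v, ∫⁻ u, (Set.Iic v).indicator (fun _ => ENNReal.ofReal (1 / v)) u ∂ν ∂μ :=
          lintegral_lintegral_swap (hmeas1.comp measurable_swap).aemeasurable
        simp_rw [e2]
        rw [lintegral_add_right _ hm2, e3]
        simp_rw [e1]
    _ ≤ 9 * A2 σ w ^ (1 / 2 : ℝ) * σ Q.toSet ^ (1 / 2 : ℝ) * w P.toSet ^ (1 / 2 : ℝ) +
        9 * A2 σ w ^ (1 / 2 : ℝ) * w P.toSet ^ (1 / 2 : ℝ) * σ Q.toSet ^ (1 / 2 : ℝ) :=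
        add_le_add (H1.trans (by gcongr; exact hroot _)) (H2.trans (by gcongr; exact hroot _))
    _ = _ := by ring

/-! ### The truncated Hilbert transform as a bilinear form -/

section

variable {σ w : Measure ℝ} [IsLocallyFiniteMeasure σ] [IsLocallyFiniteMeasure w] {α β : ℝ} {r : ℕ}

lemma hilbert_eq (α β : ℝ) (σ : Measure ℝ) (f : ℝ → ℝ) (x : ℝ) :
    hilbert α β σ f x = ∫ y, sharpKernel α β (x - y) * f y ∂σ := by
  have hs : MeasurableSet {y : ℝ | α < |x - y| ∧ |x - y| < β} :=
    (measurableSet_lt (g := fun y : ℝ => |x - y|) measurable_const (by fun_prop)).inter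
      (measurableSet_lt (f := fun y : ℝ => |x - y|) (by fun_prop) measurable_const)
  unfold hilbert
  rw [← integral_indicator hs]
  congr 1; ext y
  by_cases h : α < |x - y| ∧ |x - y| < β
  · rw [Set.indicator_of_mem (by exact h), sharpKernel, if_pos h]; ring
  · rw [Set.indicator_of_notMem (by exact h), sharpKernel, if_neg h, zero_mul]

lemma integrable_hilbert_mul (hA : A2 σ w ≠ ∞) (hα : 0 < α) (hβ : α < β) {g h : ℝ → ℝ}
    (hg : MemLp g 2 σ) (hh : MemLp h 2 w) : Integrable (fun x => hilbert α β σ g x * h x) w := by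
  have := ((poissonDominated_sharp hα hβ).integrable hA hg hh).integral_prod_left
  refine this.congr (Eventually.of_forall fun x => ?_)
  simp only
  rw [hilbert_eq, ← integral_mul_const]
  congr 1; ext y; ring

lemma pair_hilbert (hA : A2 σ w ≠ ∞) (hα : 0 < α) (hβ : α < β) {g h : ℝ → ℝ}
    (hg : MemLp g 2 σ) (hh : MemLp h 2 w) :
    pair w (hilbert α β σ g) h = bform (fun x y => sharpKernel α β (x - y)) σ w g h := by
  unfold pair bform
  rw [integral_prod _ ((poissonDominated_sharp hα hβ).integrable hA hg hh)]
  congr 1; ext x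
  rw [hilbert_eq, ← integral_mul_const]
  congr 1; ext y; ring

lemma measurable_hilbert (α β : ℝ) {g : ℝ → ℝ} (hg : Measurable g) :
    Measurable (hilbert α β σ g) := by
  rw [funext (hilbert_eq α β σ g)]
  have : StronglyMeasurable (Function.uncurry fun x y => sharpKernel α β (x - y) * g y) :=
    ((measurable_uncurry_sub (measurable_sharpKernel α β)).mul
      (hg.comp measurable_snd)).stronglyMeasurable
  exact this.integral_prod_right.measurable

/-! ### The weak boundedness constant -/

lemma PoissonDominated.bform_add_right {k : ℝ → ℝ → ℝ} {M t : ℝ} (hA : A2 σ w ≠ ∞)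
    (hk : PoissonDominated k M t) {g h h' : ℝ → ℝ} (hg : MemLp g 2 σ) (hh : MemLp h 2 w)
    (hh' : MemLp h' 2 w) :
    bform k σ w g (fun y => h y + h' y) = bform k σ w g h + bform k σ w g h' := by
  unfold bform
  rw [← integral_add (hk.integrable hA hg hh) (hk.integrable hA hg hh')]
  congr 1; ext z; ring

lemma enorm_sharpKernel_le (α β t : ℝ) : ‖sharpKernel α β t‖ₑ ≤ ENNReal.ofReal (1 / |t|) := by
  unfold sharpKernel
  split_ifs
  · rw [← ofReal_norm, norm_inv, Real.norm_eq_abs, one_div]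
  · simp

/-- The form on disjoint intervals, `P` to the left of `Q`. -/
lemma lintegral_sharp_le (α β : ℝ) {P Q : Itv} (hPQ : P.right ≤ Q.left) :
    ∫⁻ z : ℝ × ℝ, ‖sharpKernel α β (z.1 - z.2) * (Q.ind z.2 * P.ind z.1)‖ₑ ∂(w.prod σ) ≤
      18 * A2 σ w ^ (1 / 2 : ℝ) * (σ Q.toSet ^ (1 / 2 : ℝ) * w P.toSet ^ (1 / 2 : ℝ)) := by
  refine le_trans ?_ (lintegral_inv_abs_le hPQ)
  have hm : Measurable fun z : ℝ × ℝ =>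
      ‖sharpKernel α β (z.1 - z.2) * (Q.ind z.2 * P.ind z.1)‖ₑ :=
    ((measurable_uncurry_sub (measurable_sharpKernel α β)).mul
      ((Q.measurable_ind.comp measurable_snd).mul (P.measurable_ind.comp measurable_fst))).enorm
  rw [lintegral_prod _ hm.aemeasurable, ← lintegral_indicator P.measurableSet_toSet]
  refine lintegral_mono fun x => ?_
  by_cases hx : x ∈ P.toSet
  · rw [Set.indicator_of_mem hx, ← lintegral_indicator Q.measurableSet_toSet]
    refine lintegral_mono fun y => ?_
    by_cases hy : y ∈ Q.toSet
    · rw [Set.indicator_of_mem hy, ind_of_mem hx, ind_of_mem hy, mul_one, mul_one]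
      exact enorm_sharpKernel_le _ _ _
    · simp [ind_of_notMem hy]
  · simp [ind_of_notMem hx]

lemma enorm_bform_le (k : ℝ → ℝ → ℝ) (σ w : Measure ℝ) (g h : ℝ → ℝ) :
    ENNReal.ofReal |bform k σ w g h| ≤ ∫⁻ z, ‖k z.1 z.2 * (g z.2 * h z.1)‖ₑ ∂(w.prod σ) := by
  rw [← Real.norm_eq_abs, ofReal_norm]
  exact enorm_integral_le_lintegral_enorm _

lemma sharpKernel_neg (α β t : ℝ) : sharpKernel α β (-t) = -sharpKernel α β t := by
  unfold sharpKernel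
  rw [abs_neg]
  split_ifs
  · rw [inv_neg]
  · rw [neg_zero]

/-- The sharp truncation on two disjoint intervals, uniformly in the truncation. -/
lemma enorm_bform_sharp_of_disjoint_le (α β : ℝ) {I P : Itv}
    (h : P.right ≤ I.left ∨ I.right ≤ P.left) :
    ENNReal.ofReal |bform (fun x y => sharpKernel α β (x - y)) σ w I.ind P.ind| ≤
      18 * A2 σ w ^ (1 / 2 : ℝ) * (σ I.toSet ^ (1 / 2 : ℝ) * w P.toSet ^ (1 / 2 : ℝ)) := by
  rcases h with h | h
  · exact (enorm_bform_le _ _ _ _ _).trans (lintegral_sharp_le α β h)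
  · have e : bform (fun x y => sharpKernel α β (x - y)) σ w I.ind P.ind =
        -bform (fun x y => sharpKernel α β (x - y)) w σ P.ind I.ind := by
      rw [← bform_flip]
      unfold bform
      rw [← integral_neg]
      congr 1; ext z
      dsimp only
      rw [← neg_sub, sharpKernel_neg]; ring
    rw [e, abs_neg]
    refine (enorm_bform_le _ _ _ _ _).trans ((lintegral_sharp_le α β h).trans_eq ?_)
    rw [A2_comm, mul_comm (w _ ^ _)]

/-- The part of `J` to the left of `I` is empty or an interval, and so is the part to the right. -/
lemma ind_eq_add (I J : Itv) : ∃ l m : ℝ → ℝ,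
    (∀ x, J.ind x = J.ind x * I.ind x + (l x + m x)) ∧
    ((∀ x, l x = 0) ∨ ∃ P : Itv, P.toSet ⊆ J.toSet ∧ P.right ≤ I.left ∧ l = P.ind) ∧
    ((∀ x, m x = 0) ∨ ∃ P : Itv, P.toSet ⊆ J.toSet ∧ I.right ≤ P.left ∧ m = P.ind) := by
  classical
  refine ⟨fun x => if x < I.left then J.ind x else 0, fun x => if I.right ≤ x then J.ind x else 0,
    fun x => ?_, ?_, ?_⟩
  · have hI := I.lt
    by_cases h1 : x < I.left
    · simp only
      rw [if_pos h1, if_neg (by linarith), ind_of_notMem (I := I) fun h => by linarith [h.1]]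
      ring
    · by_cases h2 : I.right ≤ x
      · simp only
        rw [if_neg h1, if_pos h2, ind_of_notMem (I := I) fun h => by linarith [h.2]]
        ring
      · simp only
        rw [if_neg h1, if_neg h2, ind_of_mem (I := I) ⟨not_lt.1 h1, not_le.1 h2⟩]
        ring
  · by_cases h : J.left < I.left
    · right
      let P : Itv := ⟨J.left, min J.right I.left, lt_min J.lt h⟩
      refine ⟨P,
        Set.Ico_subset_Ico_right (min_le_left _ _), min_le_right _ _, funext fun x => ?_⟩
      by_cases hx : x ∈ J.toSet
      · by_cases h1 : x < I.left
        · rw [if_pos h1, ind_of_mem (I := J) hx, ind_of_mem (I := P) ⟨hx.1, lt_min hx.2 h1⟩]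
        · rw [if_neg h1, ind_of_notMem (I := P) fun h' => h1 (h'.2.trans_le (min_le_right _ _))]
      · rw [ind_of_notMem (I := J) hx, ite_self, ind_of_notMem (I := P) fun h' => hx
          ⟨h'.1, h'.2.trans_le (min_le_left _ _)⟩]
    · left
      intro x
      simp only
      split_ifs with h1
      · exact ind_of_notMem fun h' => h (h'.1.trans_lt h1)
      · rfl
  · by_cases h : I.right < J.right
    · right
      let P : Itv := ⟨max J.left I.right, J.right, max_lt J.lt h⟩
      refine ⟨P,
        Set.Ico_subset_Ico_left (le_max_left _ _), le_max_right _ _, funext fun x => ?_⟩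
      by_cases hx : x ∈ J.toSet
      · by_cases h1 : I.right ≤ x
        · rw [if_pos h1, ind_of_mem (I := J) hx, ind_of_mem (I := P) ⟨max_le hx.1 h1, hx.2⟩]
        · rw [if_neg h1, ind_of_notMem (I := P) fun h' => h1 ((le_max_right _ _).trans h'.1)]
      · rw [ind_of_notMem (I := J) hx, ite_self, ind_of_notMem (I := P) fun h' => hx
          ⟨(le_max_left _ _).trans h'.1, h'.2⟩]
    · left
      intro x
      simp only
      split_ifs with h1
      · exact ind_of_notMem fun h' => h (h1.trans_lt h'.2)
      · rfl

omit [IsLocallyFiniteMeasure w] in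
/-- The testing condition without division. If `σ I = 0`, finiteness of the testing constant makes
the left side vanish, since `0⁻¹ = ∞` in its definition. -/
lemma setLIntegral_hilbert_le (hT : testingSq σ w ≠ ∞) (hα : 0 < α) (hβ : α < β) (I : Itv) :
    ∫⁻ x in I.toSet, ENNReal.ofReal (hilbert α β σ I.ind x ^ 2) ∂w ≤
      testingSq σ w * σ I.toSet := by
  have h : (σ I.toSet)⁻¹ * ∫⁻ x in I.toSet, ENNReal.ofReal (hilbert α β σ I.ind x ^ 2) ∂w ≤
      testingSq σ w :=
    le_iSup_of_le α (le_iSup_of_le β (le_iSup_of_le hα (le_iSup_of_le hβ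
      (le_iSup (fun I : Itv => (σ I.toSet)⁻¹ *
        ∫⁻ x in I.toSet, ENNReal.ofReal (hilbert α β σ I.ind x ^ 2) ∂w) I))))
  by_cases h0 : σ I.toSet = 0
  · rw [h0, ENNReal.inv_zero] at h
    by_contra hne
    have : ∫⁻ x in I.toSet, ENNReal.ofReal (hilbert α β σ I.ind x ^ 2) ∂w ≠ 0 := fun h' =>
      hne (by rw [h']; exact zero_le)
    rw [ENNReal.top_mul this] at h
    exact hT (top_le_iff.1 h)
  · rw [← ENNReal.div_le_iff h0 (I.measure_lt_top σ).ne, ENNReal.div_eq_inv_mul]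
    exact h

/-- The diagonal part of the form on two intervals is controlled by testing. -/
lemma enorm_bform_sharp_mul_ind_le (hA : A2 σ w ≠ ∞) (hT : testingSq σ w ≠ ∞) (hα : 0 < α)
    (hβ : α < β) (I J : Itv) :
    ENNReal.ofReal |bform (fun x y => sharpKernel α β (x - y)) σ w I.ind
        (fun x => J.ind x * I.ind x)| ≤
      testingSq σ w ^ (1 / 2 : ℝ) * (σ I.toSet ^ (1 / 2 : ℝ) * w J.toSet ^ (1 / 2 : ℝ)) := by
  have hH := measurable_hilbert (σ := σ) α β I.measurable_ind
  rw [← pair_hilbert hA hα hβ (memLp_ind I) (memLp_mul_ind (memLp_ind J) I), ← Real.norm_eq_abs,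
    ofReal_norm]
  refine (enorm_integral_le_lintegral_enorm _).trans ?_
  have hcs := lintegral_mul_le_sqrt_mul_sqrt w
    (f := fun x => ‖hilbert α β σ I.ind x * I.ind x‖ₑ) (g := fun x => ‖J.ind x‖ₑ)
    (hH.mul I.measurable_ind).enorm.aemeasurable J.measurable_ind.enorm.aemeasurable
  calc _ = ∫⁻ x, ‖hilbert α β σ I.ind x * I.ind x‖ₑ * ‖J.ind x‖ₑ ∂w := by
        congr 1; ext x
        rw [← enorm_mul]; congr 1; ring
    _ ≤ _ := hcs
    _ ≤ (testingSq σ w * σ I.toSet) ^ (1 / 2 : ℝ) * w J.toSet ^ (1 / 2 : ℝ) := by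
        gcongr
        · refine le_trans (le_of_eq ?_) (setLIntegral_hilbert_le hT hα hβ I)
          rw [← lintegral_indicator I.measurableSet_toSet]
          congr 1; ext x
          by_cases hx : x ∈ I.toSet
          · rw [Set.indicator_of_mem hx, ind_of_mem hx, mul_one, ← ofReal_norm,
              ← ENNReal.ofReal_pow (norm_nonneg _), Real.norm_eq_abs, sq_abs]
          · simp [ind_of_notMem hx, Set.indicator_of_notMem hx]
        · rw [← lintegral_indicator_one J.measurableSet_toSet]
          refine lintegral_mono fun x => ?_
          by_cases hx : x ∈ J.toSet
          · simp [ind_of_mem hx, Set.indicator_of_mem hx]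
          · simp [ind_of_notMem hx]
    _ = _ := by rw [ENNReal.mul_rpow_of_nonneg _ _ (by norm_num), mul_assoc]

/-- Testing and `A₂` control the form on all pairs of intervals, so the weak boundedness constant
is bounded uniformly in the truncation. -/
lemma weakBdd_le (hA : A2 σ w ≠ ∞) (hT : testingSq σ w ≠ ∞) (hα : 0 < α) (hβ : α < β) (r : ℕ) :
    weakBdd r α β σ w ≤ testingSq σ w ^ (1 / 2 : ℝ) + 36 * A2 σ w ^ (1 / 2 : ℝ) := by
  refine sInf_le fun I J _ _ => ?_
  have hK := poissonDominated_sharp hα hβ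
  rw [pair_hilbert hA hα hβ (memLp_ind I) (memLp_ind J)]
  obtain ⟨l, m, h1, h2, h3⟩ := ind_eq_add I J
  have side : ∀ l : ℝ → ℝ, ((∀ x, l x = 0) ∨ ∃ P : Itv, P.toSet ⊆ J.toSet ∧
      (P.right ≤ I.left ∨ I.right ≤ P.left) ∧ l = P.ind) → MemLp l 2 w ∧
      ENNReal.ofReal |bform (fun x y => sharpKernel α β (x - y)) σ w I.ind l| ≤
      18 * A2 σ w ^ (1 / 2 : ℝ) * (σ I.toSet ^ (1 / 2 : ℝ) * w J.toSet ^ (1 / 2 : ℝ)) := by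
    rintro l (h | ⟨P, hP1, hP2, rfl⟩)
    · have : l = fun _ => 0 := funext h
      subst this
      refine ⟨MemLp.zero', ?_⟩
      simp [bform]
    · refine ⟨memLp_ind P, (enorm_bform_sharp_of_disjoint_le α β hP2).trans ?_⟩
      gcongr
  obtain ⟨hl, hl'⟩ := side l (h2.imp id fun ⟨P, a, b, c⟩ => ⟨P, a, Or.inl b, c⟩)
  obtain ⟨hm, hm'⟩ := side m (h3.imp id fun ⟨P, a, b, c⟩ => ⟨P, a, Or.inr b, c⟩)
  have hJI := memLp_mul_ind (memLp_ind (μ := w) J) I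
  have e : bform (fun x y => sharpKernel α β (x - y)) σ w I.ind J.ind =
      bform (fun x y => sharpKernel α β (x - y)) σ w I.ind (fun x => J.ind x * I.ind x) +
      (bform (fun x y => sharpKernel α β (x - y)) σ w I.ind l +
      bform (fun x y => sharpKernel α β (x - y)) σ w I.ind m) := by
    have hI : MemLp I.ind 2 σ := memLp_ind I
    rw [← hK.bform_add_right hA hI hl hm, ← hK.bform_add_right hA hI hJI
      (show MemLp (fun y => l y + m y) 2 w from hl.add hm)]
    exact congrArg _ (funext h1)
  rw [e]
  calc _ ≤ ENNReal.ofReal (|bform (fun x y => sharpKernel α β (x - y)) σ w I.ind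
        (fun x => J.ind x * I.ind x)| +
      (|bform (fun x y => sharpKernel α β (x - y)) σ w I.ind l| +
      |bform (fun x y => sharpKernel α β (x - y)) σ w I.ind m|)) :=
        ENNReal.ofReal_le_ofReal ((abs_add_le _ _).trans (by gcongr; exact abs_add_le _ _))
    _ ≤ _ := by
        rw [ENNReal.ofReal_add (abs_nonneg _) (by positivity),
          ENNReal.ofReal_add (abs_nonneg _) (abs_nonneg _)]
        refine (add_le_add (enorm_bform_sharp_mul_ind_le hA hT hα hβ I J)
          (add_le_add hl' hm')).trans_eq (by ring)

lemma weakBdd_ne_top (hA : A2 σ w ≠ ∞) (hT : testingSq σ w ≠ ∞) (hα : 0 < α) (hβ : α < β)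
    (r : ℕ) : weakBdd r α β σ w ≠ ∞ := by
  refine ne_top_of_le_ne_top ?_ (weakBdd_le hA hT hα hβ r)
  exact ENNReal.add_ne_top.2 ⟨ENNReal.rpow_ne_top_of_nonneg (by norm_num) hT,
    ENNReal.mul_ne_top (by norm_num) (ENNReal.rpow_ne_top_of_nonneg (by norm_num) hA)⟩

/-- The infimum in the definition of the weak boundedness constant is attained. -/
lemma abs_bform_sharp_ind_le (hA : A2 σ w ≠ ∞) (hT : testingSq σ w ≠ ∞) (hα : 0 < α) (hβ : α < β)
    {I J : Itv} (h1 : J.len ≤ 2 ^ r * I.len) (h2 : I.len ≤ 2 ^ r * J.len) :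
    |bform (fun x y => sharpKernel α β (x - y)) σ w I.ind J.ind| ≤
      (weakBdd r α β σ w).toReal * (√(σ.real I.toSet) * √(w.real J.toSet)) := by
  have hfin := weakBdd_ne_top hA hT hα hβ r
  rw [← pair_hilbert hA hα hβ (memLp_ind I) (memLp_ind J)]
  set X := ENNReal.ofReal |pair w (hilbert α β σ I.ind) J.ind| with hX
  have hroot : ∀ (μ : Measure ℝ) [IsLocallyFiniteMeasure μ] (K : Itv),
      μ K.toSet ^ (1 / 2 : ℝ) = ENNReal.ofReal (√(μ.real K.toSet)) := by
    intro μ _ K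
    rw [Real.sqrt_eq_rpow, ← ENNReal.ofReal_rpow_of_nonneg measureReal_nonneg (by norm_num),
      ofReal_measureReal (K.measure_lt_top μ).ne]
  set c := σ I.toSet ^ (1 / 2 : ℝ) * w J.toSet ^ (1 / 2 : ℝ) with hc
  have hc' : c = ENNReal.ofReal (√(σ.real I.toSet) * √(w.real J.toSet)) := by
    rw [hc, hroot σ I, hroot w J, ENNReal.ofReal_mul (Real.sqrt_nonneg _)]
  have key : X ≤ weakBdd r α β σ w * c := by
    have hmem : ∀ W ∈ {W : ℝ≥0∞ | ∀ I J : Itv, J.len ≤ 2 ^ r * I.len → I.len ≤ 2 ^ r * J.len →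
        ENNReal.ofReal |pair w (hilbert α β σ I.ind) J.ind| ≤
          W * (σ I.toSet) ^ (1 / 2 : ℝ) * (w J.toSet) ^ (1 / 2 : ℝ)}, X ≤ W * c := fun W hW => by
      rw [hc, ← mul_assoc]; exact hW I J h1 h2
    -- for `c = 0` the bound holds with any constant, so `∞` is tested, with `∞ * 0 = 0`
    by_cases h0 : c = 0
    · have : X ≤ ∞ * c := hmem ∞ fun I J _ _ => by
        have := hX
        rcases eq_or_ne (σ I.toSet) 0 with hs | hs
        · have h' : hilbert α β σ I.ind = fun _ => 0 := by
            ext x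
            rw [hilbert_eq]
            refine integral_eq_zero_of_ae ?_
            filter_upwards [measure_eq_zero_iff_ae_notMem.1 hs] with y hy
            rw [ind_of_notMem hy, mul_zero]; rfl
          rw [h']; simp [pair]
        · rcases eq_or_ne (w J.toSet) 0 with hw | hw
          · have h' : pair w (hilbert α β σ I.ind) J.ind = 0 := by
              refine integral_eq_zero_of_ae ?_
              filter_upwards [measure_eq_zero_iff_ae_notMem.1 hw] with y hy
              rw [ind_of_notMem hy, mul_zero]; rfl
            rw [h']; simp
          · rw [ENNReal.top_mul, ENNReal.top_mul]
            · exact le_top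
            · simpa using hw
            · simpa using hs
      rwa [h0, mul_zero] at this ⊢
    · rw [← ENNReal.div_le_iff h0 (by rw [hc']; exact ENNReal.ofReal_ne_top)]
      refine le_sInf fun W hW => ?_
      rw [ENNReal.div_le_iff h0 (by rw [hc']; exact ENNReal.ofReal_ne_top)]
      exact hmem W hW
  rw [hc', ← ENNReal.ofReal_toReal hfin, ← ENNReal.ofReal_mul ENNReal.toReal_nonneg,
    ENNReal.ofReal_le_ofReal_iff (by positivity)] at key
  exact key

end

/-! ### Summability from bilinear bounds -/

/-- A double series whose finite sections, with arbitrary signs, are bounded by `ℓ²` norms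
converges absolutely row by row and then over the rows; its square sections converge to the
iterated sum. -/
lemma summable_of_bilinear_bound {ι κ : Type*} {T : ι → κ → ℝ} {x : ι → ℝ} {y : κ → ℝ} {C : ℝ}
    (hC : 0 ≤ C) (hx : Summable fun i => x i ^ 2) (hy : Summable fun j => y j ^ 2)
    (hT : ∀ (F : Finset ι) (G : Finset κ) (s : ι → ℝ) (t : κ → ℝ), (∀ i, |s i| ≤ 1) →
      (∀ j, |t j| ≤ 1) → |∑ i ∈ F, ∑ j ∈ G, s i * (t j * T i j)| ≤
        C * (√(∑ i ∈ F, x i ^ 2) * √(∑ j ∈ G, y j ^ 2))) :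
    (∀ i, Summable (T i)) ∧ (Summable fun i => ∑' j, T i j) ∧
    Tendsto (fun p : Finset ι × Finset κ => ∑ i ∈ p.1, ∑ j ∈ p.2, T i j) (atTop ×ˢ atTop)
      (𝓝 (∑' i, ∑' j, T i j)) := by
  classical
  set X := √(∑' i, x i ^ 2) with hX
  set Y := √(∑' j, y j ^ 2) with hY
  have hFX : ∀ F : Finset ι, √(∑ i ∈ F, x i ^ 2) ≤ X := fun F =>
    Real.sqrt_le_sqrt (hx.sum_le_tsum F fun i _ => sq_nonneg _)
  have hGY : ∀ G : Finset κ, √(∑ j ∈ G, y j ^ 2) ≤ Y := fun G =>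
    Real.sqrt_le_sqrt (hy.sum_le_tsum G fun i _ => sq_nonneg _)
  have hX0 : 0 ≤ X := Real.sqrt_nonneg _
  have hY0 : 0 ≤ Y := Real.sqrt_nonneg _
  let sg : ℝ → ℝ := fun a => if 0 ≤ a then 1 else -1
  have hsg : ∀ a, |sg a| ≤ 1 := fun a => by
    simp only [sg]; split_ifs <;> simp
  have hsg' : ∀ a, sg a * a = |a| := fun a => by
    simp only [sg]; split_ifs with h
    · rw [abs_of_nonneg h, one_mul]
    · rw [abs_of_neg (not_le.1 h), neg_one_mul]
  have hrow : ∀ i, Summable (T i) := by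
    intro i
    refine Summable.of_abs (summable_of_sum_le (c := C * (X * Y)) (fun j => abs_nonneg _) fun G => ?_)
    have h := hT {i} G (fun _ => 1) (fun j => sg (T i j)) (fun _ => by simp) (fun j => hsg _)
    simp only [Finset.sum_singleton, one_mul, hsg'] at h
    have h1 := hFX {i}
    rw [Finset.sum_singleton] at h1
    refine (le_abs_self _).trans (h.trans ?_)
    gcongr
    exact hGY G
  set b := fun i => ∑' j, T i j with hb
  have hlim : ∀ (F : Finset ι) (s : ι → ℝ), Tendsto (fun G : Finset κ => ∑ i ∈ F, ∑ j ∈ G, s i * T i j)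
      atTop (𝓝 (∑ i ∈ F, s i * b i)) := fun F s => by
    simp_rw [← Finset.mul_sum]
    exact tendsto_finsetSum _ fun i _ => ((hrow i).hasSum).const_mul _
  have hout : Summable b := by
    refine Summable.of_abs (summable_of_sum_le (c := C * (X * Y)) (fun j => abs_nonneg _) fun F => ?_)
    simp_rw [← hsg']
    refine le_of_tendsto (hlim F fun i => sg (b i)) (Eventually.of_forall fun G => ?_)
    have h := hT F G (fun i => sg (b i)) (fun _ => 1) (fun _ => hsg _) (fun j => by simp)
    simp only [one_mul] at h
    refine (le_abs_self _).trans (h.trans ?_)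
    gcongr
    exacts [hFX F, hGY G]
  refine ⟨hrow, hout, ?_⟩
  -- the error is bounded by a tail in `j` that is uniform in `F`
  have htail : ∀ (F : Finset ι) (G : Finset κ), |∑ i ∈ F, ∑ j ∈ G, T i j - ∑ i ∈ F, b i| ≤
      C * (X * √(∑' j, y j ^ 2 - ∑ j ∈ G, y j ^ 2)) := by
    intro F G
    have h1 : Tendsto (fun G' : Finset κ => |∑ i ∈ F, ∑ j ∈ G, T i j - ∑ i ∈ F, ∑ j ∈ G', T i j|)
        atTop (𝓝 |∑ i ∈ F, ∑ j ∈ G, T i j - ∑ i ∈ F, b i|) := by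
      have := hlim F fun _ => 1
      simp only [one_mul] at this
      exact (tendsto_const_nhds.sub this).abs
    refine le_of_tendsto h1 ((eventually_ge_atTop G).mono fun G' hG => ?_)
    have e : ∑ i ∈ F, ∑ j ∈ G', T i j =
        ∑ i ∈ F, ∑ j ∈ G' \ G, T i j + ∑ i ∈ F, ∑ j ∈ G, T i j := by
      rw [← Finset.sum_add_distrib]
      exact Finset.sum_congr rfl fun i _ => (Finset.sum_sdiff hG).symm
    have h := hT F (G' \ G) (fun _ => 1) (fun _ => 1) (fun _ => by simp) (fun j => by simp)
    simp only [one_mul] at h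
    rw [e, sub_add_cancel_right, abs_neg]
    refine h.trans ?_
    gcongr
    · exact hFX F
    · have h2 := Finset.sum_sdiff (f := fun j => y j ^ 2) hG
      have h3 := hy.sum_le_tsum G' fun i _ => sq_nonneg (y i)
      linarith
  have hzero : Tendsto (fun G : Finset κ => C * (X * √(∑' j, y j ^ 2 - ∑ j ∈ G, y j ^ 2))) atTop
      (𝓝 0) := by
    have h1 : Tendsto (fun G : Finset κ => ∑' j, y j ^ 2 - ∑ j ∈ G, y j ^ 2) atTop (𝓝 0) := by
      have := (tendsto_const_nhds (x := ∑' j, y j ^ 2)).sub hy.hasSum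
      rwa [sub_self] at this
    have h2 := ((Real.continuous_sqrt.tendsto 0).comp h1).const_mul X |>.const_mul C
    simpa using h2
  have hA : Tendsto (fun p : Finset ι × Finset κ => ∑ i ∈ p.1, ∑ j ∈ p.2, T i j - ∑ i ∈ p.1, b i)
      (atTop ×ˢ atTop) (𝓝 0) :=
    squeeze_zero_norm (fun p => by rw [Real.norm_eq_abs]; exact htail p.1 p.2)
      (hzero.comp tendsto_snd)
  have hB : Tendsto (fun p : Finset ι × Finset κ => ∑ i ∈ p.1, b i) (atTop ×ˢ atTop)
      (𝓝 (∑' i, b i)) := Tendsto.comp (g := fun F : Finset ι => ∑ i ∈ F, b i) hout.hasSum tendsto_fst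
  have := hA.add hB
  simp only [sub_add_cancel, zero_add] at this
  exact this

/-! ### Good functions -/

section

variable {D : Set Itv} {σ w : Measure ℝ} [IsLocallyFiniteMeasure σ]
  [IsLocallyFiniteMeasure w] {ε : ℝ} {r : ℕ} {f φ : ℝ → ℝ}

omit [IsLocallyFiniteMeasure σ] in
lemma integrable_mul_of_memLp {g h : ℝ → ℝ} (hg : MemLp g 2 σ) (hh : MemLp h 2 σ) :
    Integrable (fun x => g x * h x) σ :=
  hg.integrable_mul hh

omit [IsLocallyFiniteMeasure σ] in
/-- The Cauchy-Schwarz inequality. -/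
lemma abs_integral_mul_le {g h : ℝ → ℝ} (hg : MemLp g 2 σ) (hh : MemLp h 2 σ) :
    |∫ x, g x * h x ∂σ| ≤ l2 σ g * l2 σ h := by
  have h1 := lintegral_mul_le_sqrt_mul_sqrt σ hg.1.enorm hh.1.enorm
  rw [lintegral_enorm_sq_eq hg, lintegral_enorm_sq_eq hh, ← ENNReal.ofReal_mul (l2_nonneg _ _)] at h1
  have h2 : ‖∫ x, g x * h x ∂σ‖ₑ ≤ ENNReal.ofReal (l2 σ g * l2 σ h) := by
    refine (enorm_integral_le_lintegral_enorm _).trans ?_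
    simp_rw [enorm_mul]
    exact h1
  rw [← ofReal_norm, ENNReal.ofReal_le_ofReal_iff
    (mul_nonneg (l2_nonneg _ _) (l2_nonneg _ _))] at h2
  exact h2

/-- Bessel's inequality. -/
lemma fam_mdiff_le (hD : IsDyadicGrid D) (hf : MemLp f 2 σ) {F : Finset Itv}
    (hF : ∀ I ∈ F, I ∈ D) : fam σ F (fun I => mdiff σ I f) ≤ l2 σ f := by
  have hu : ∀ I ∈ F, HaarStep σ I (mdiff σ I f) := fun I _ => haarStep_mdiff σ I f
  have hterm : ∀ I : Itv, ∫ x, f x * mdiff σ I f x ∂σ = l2 σ (mdiff σ I f) ^ 2 := by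
    intro I
    have e1 : l2 σ (mdiff σ I f) = |pair σ f (haar σ I)| * l2 σ (haar σ I) := l2_const_mul _ _
    have e2 : ∫ x, f x * mdiff σ I f x ∂σ = pair σ f (haar σ I) * pair σ f (haar σ I) := by
      have e3 : ∀ x, f x * mdiff σ I f x = pair σ f (haar σ I) * (f x * haar σ I x) := fun x => by
        unfold mdiff; ring
      simp_rw [e3]
      rw [integral_const_mul]
      rfl
    rw [e1, e2]
    rcases l2_haar_eq_one_or_eq_zero σ I with h | h
    · rw [h, mul_one, sq_abs, sq]
    · have : pair σ f (haar σ I) = 0 := by simp [pair, h]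
      rw [this]; simp
  have h1 : ∫ x, f x * (∑ I ∈ F, mdiff σ I f x) ∂σ = fam σ F (fun I => mdiff σ I f) ^ 2 := by
    simp_rw [Finset.mul_sum]
    rw [integral_finsetSum _ fun I hI => integrable_mul_of_memLp hf (hu I hI).memLp, fam_sq]
    exact Finset.sum_congr rfl fun I _ => hterm I
  have h2 := abs_integral_mul_le hf (memLp_sum hu)
  rw [h1, l2_sum_eq_fam hD hF hu] at h2
  have h3 := (le_abs_self _).trans h2
  have h4 := fam_nonneg σ F fun I => mdiff σ I f
  rcases h4.eq_or_lt with h | h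
  · rw [← h]; exact l2_nonneg _ _
  · rw [sq] at h3
    exact le_of_mul_le_mul_right h3 h

open Classical in
/-- Partial sums over finite sets of intervals converge to a good function. -/
lemma IsGoodFun.tendsto_l2 (hf : IsGoodFun D ε r σ f) :
    Tendsto (fun F : Finset Itv => l2 σ fun x =>
      f x - ∑ I ∈ F with I ∈ D ∧ IsGood D ε r I, mdiff σ I f x) atTop (𝓝 0) := by
  have h1 : Tendsto (fun F : Finset Itv => F.subtype fun I => I ∈ D ∧ IsGood D ε r I) atTop
      atTop := by
    refine tendsto_atTop_atTop.2 fun S => ⟨S.map (Function.Embedding.subtype _), fun F hF => ?_⟩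
    intro I hI
    rw [Finset.mem_subtype]
    exact hF (Finset.mem_map.2 ⟨I, hI, rfl⟩)
  have h2 := (ENNReal.tendsto_toReal ENNReal.zero_ne_top).comp (hf.2.comp h1)
  rw [ENNReal.toReal_zero] at h2
  refine h2.congr fun F => ?_
  simp only [Function.comp_apply]
  have e : (fun x => f x - ∑ I ∈ F.subtype (fun I => I ∈ D ∧ IsGood D ε r I), mdiff σ I.1 f x) =
      fun x => f x - ∑ I ∈ F with I ∈ D ∧ IsGood D ε r I, mdiff σ I f x := by
    ext x
    rw [Finset.sum_subtype_eq_sum_filter (f := fun I => mdiff σ I f x)]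
  have hS : MemLp (fun x => f x - ∑ I ∈ F with I ∈ D ∧ IsGood D ε r I, mdiff σ I f x) 2 σ :=
    hf.1.sub (memLp_sum fun I _ => haarStep_mdiff σ I f)
  rw [e, eLpNorm_two_eq hS,
    ENNReal.toReal_ofReal (l2_nonneg _ _)]

/-- The differences of a good function over intervals that are not good vanish. -/
lemma IsGoodFun.mdiff_eq_zero (hD : IsDyadicGrid D) (hf : IsGoodFun D ε r σ f) {I : Itv}
    (hI : I ∈ D) (hn : ¬ IsGood D ε r I) (x : ℝ) : mdiff σ I f x = 0 := by
  classical
  have hh := haarStep_haar σ I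
  have h1 : ∀ F : Finset Itv, pair σ f (haar σ I) = ∫ x, (f x -
      ∑ J ∈ F with J ∈ D ∧ IsGood D ε r J, mdiff σ J f x) * haar σ I x ∂σ := by
    intro F
    have hS : MemLp (fun x => ∑ J ∈ F with J ∈ D ∧ IsGood D ε r J, mdiff σ J f x) 2 σ :=
      memLp_sum fun J _ => haarStep_mdiff σ J f
    simp_rw [sub_mul]
    rw [integral_sub (integrable_mul_of_memLp hf.1 hh.memLp) (integrable_mul_of_memLp hS hh.memLp)]
    simp_rw [Finset.sum_mul]
    rw [integral_finsetSum _ fun J _ =>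
      integrable_mul_of_memLp (haarStep_mdiff σ J f).memLp hh.memLp,
      Finset.sum_eq_zero, sub_zero]
    · rfl
    · intro J hJ
      obtain ⟨-, hJD, hJg⟩ := Finset.mem_filter.1 hJ
      exact (haarStep_mdiff σ J f).integral_mul_eq_zero hD hh hJD hI fun h => hn (h ▸ hJg)
  have h2 : |pair σ f (haar σ I)| ≤ 0 := by
    have h3 := hf.tendsto_l2.mul_const (l2 σ (haar σ I))
    rw [zero_mul] at h3
    refine ge_of_tendsto h3 (Eventually.of_forall fun F => ?_)
    rw [h1 F]
    exact abs_integral_mul_le (hf.1.sub (memLp_sum fun J _ => haarStep_mdiff σ J f)) hh.memLp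
  unfold mdiff
  rw [abs_nonpos_iff.1 h2, zero_mul]

end

/-! ### Passage to the limit -/

section

variable {D : Set Itv} {σ w : Measure ℝ} [IsLocallyFiniteMeasure σ]
  [IsLocallyFiniteMeasure w] {ε : ℝ} {r : ℕ} {f φ : ℝ → ℝ} {k : ℝ → ℝ → ℝ} {a c : ℝ}

omit [IsLocallyFiniteMeasure σ] [IsLocallyFiniteMeasure w] in
/-- Changes of sign of the Haar differences move to the inside terms. -/
lemma insideTerm_mul (k : ℝ → ℝ → ℝ) (u v : Itv → ℝ → ℝ) (s t : Itv → ℝ) (I J : Itv) :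
    insideTerm k σ w (fun I x => s I * u I x) (fun J x => t J * v J x) I J =
      s I * (t J * insideTerm k σ w u v I J) := by
  have h : av σ (fun x => s I * u I x) (I.childAt J) = s I * av σ (u I) (I.childAt J) := by
    unfold av
    rw [setAverage_eq, setAverage_eq, integral_const_mul, smul_eq_mul, smul_eq_mul]; ring
  unfold insideTerm
  rw [h, bform_const_mul_right]; ring

omit [IsLocallyFiniteMeasure σ] [IsLocallyFiniteMeasure w] in
lemma insideTerm_const_mul_kernel (k : ℝ → ℝ → ℝ) (u v : Itv → ℝ → ℝ) (c : ℝ) (I J : Itv) :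
    insideTerm (fun x y => c * k x y) σ w u v I J = c * insideTerm k σ w u v I J := by
  unfold insideTerm bform
  simp_rw [mul_assoc c]
  rw [integral_const_mul]; ring

omit [IsLocallyFiniteMeasure σ] in
lemma fam_mul_le (u : Itv → ℝ → ℝ) {s : Itv → ℝ} (hs : ∀ I, |s I| ≤ 1) (F : Finset Itv) :
    fam σ F (fun I x => s I * u I x) ≤ fam σ F u := by
  unfold fam
  refine Real.sqrt_le_sqrt (Finset.sum_le_sum fun I _ => ?_)
  rw [l2_const_mul]
  have := l2_nonneg σ (u I)
  gcongr
  exact mul_le_of_le_one_left this (hs I)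

open Classical in
/-- The inside sums of good functions converge, and are limits of finite sums. -/
lemma insideSum_tendsto (hA : A2 σ w ≠ ∞) (hk : LocalKernel k a) (hD : IsDyadicGrid D)
    (hε' : ε ≤ 1) (hf : IsGoodFun D ε r σ f) (hφ : IsGoodFun D ε r w φ) {t : Itv → Itv → ℝ}
    (ht : ∀ I J, t I J =
      c * insideTerm k σ w (fun I => mdiff σ I f) (fun J => mdiff w J φ) I J) :
    InsideSummable D r t ∧
    Tendsto (fun p : Finset Itv × Finset Itv => ∑ I ∈ p.1 with I ∈ D ∧ IsGood D ε r I,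
      ∑ J ∈ p.2 with J ∈ D ∧ IsGood D ε r J, if J.Inside r I then t I J else 0)
      (atTop ×ˢ atTop) (𝓝 (insideSum D r t)) := by
  set P : Itv → Prop := fun I => I ∈ D ∧ IsGood D ε r I with hP
  set u : Itv → ℝ → ℝ := fun I => mdiff σ I f
  set v : Itv → ℝ → ℝ := fun J => mdiff w J φ
  set T : Itv → Itv → ℝ := fun I J => if (P I ∧ P J) ∧ J.Inside r I then t I J else 0 with hTdef
  have hbessel : ∀ (μ : Measure ℝ) [IsLocallyFiniteMeasure μ] (g : ℝ → ℝ), MemLp g 2 μ →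
      (∀ F : Finset Itv, ∑ I ∈ F, (if P I then l2 μ (mdiff μ I g) else 0) ^ 2 =
        fam μ (F.filter P) (fun I => mdiff μ I g) ^ 2) ∧
      Summable fun I => (if P I then l2 μ (mdiff μ I g) else 0) ^ 2 := by
    intro μ _ g hg
    have h1 : ∀ F : Finset Itv, ∑ I ∈ F, (if P I then l2 μ (mdiff μ I g) else 0) ^ 2 =
        fam μ (F.filter P) (fun I => mdiff μ I g) ^ 2 := by
      intro F
      rw [fam_sq, Finset.sum_filter]
      refine Finset.sum_congr rfl fun I _ => ?_
      split_ifs <;> simp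
    refine ⟨h1, summable_of_sum_le (c := l2 μ g ^ 2) (fun I => sq_nonneg _) fun F => ?_⟩
    rw [h1]
    have := fam_nonneg μ (F.filter P) fun I => mdiff μ I g
    gcongr
    exact fam_mdiff_le hD hg fun I hI => (Finset.mem_filter.1 hI).2.1
  obtain ⟨hxF, hx⟩ := hbessel σ f hf.1
  obtain ⟨hyG, hy⟩ := hbessel w φ hφ.1
  have hconst : 0 ≤ |c| * (insideConst r * rootA2 σ w) := by
    have := rootA2_nonneg σ w
    unfold insideConst; positivity
  have hsum : ∀ (F G : Finset Itv) (s s' : Itv → ℝ), ∑ I ∈ F, ∑ J ∈ G, s I * (s' J * T I J) =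
      ∑ I ∈ F with P I, ∑ J ∈ G with P J, if J.Inside r I then s I * (s' J * t I J) else 0 := by
    intro F G s s'
    rw [Finset.sum_filter]
    refine Finset.sum_congr rfl fun I _ => ?_
    split_ifs with h1
    · rw [Finset.sum_filter]
      refine Finset.sum_congr rfl fun J _ => ?_
      by_cases h2 : P J <;> by_cases h3 : J.Inside r I <;> simp [hTdef, h1, h2, h3]
    · exact Finset.sum_eq_zero fun J _ => by simp [hTdef, h1]
  have hT : ∀ (F G : Finset Itv) (s s' : Itv → ℝ), (∀ i, |s i| ≤ 1) → (∀ j, |s' j| ≤ 1) →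
      |∑ I ∈ F, ∑ J ∈ G, s I * (s' J * T I J)| ≤ |c| * (insideConst r * rootA2 σ w) *
        (√(∑ I ∈ F, (if P I then l2 σ (mdiff σ I f) else 0) ^ 2) *
          √(∑ J ∈ G, (if P J then l2 w (mdiff w J φ) else 0) ^ 2)) := by
    intro F G s s' hs hs'
    rw [hxF, hyG, Real.sqrt_sq (fam_nonneg _ _ _), Real.sqrt_sq (fam_nonneg _ _ _), hsum]
    have h := abs_sum_inside_le (r := r) hA hk hD hε' (F := F.filter P) (G := G.filter P)
      (u := fun I x => s I * u I x) (v := fun J x => s' J * v J x)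
      (fun I hI => (Finset.mem_filter.1 hI).2.1)
      (fun I _ => (haarStep_mdiff σ I f).const_mul _) (fun J hJ => (Finset.mem_filter.1 hJ).2)
      (fun J _ => (haarStep_mdiff w J φ).const_mul _)
    have e : ∑ I ∈ F with P I, ∑ J ∈ G with P J,
        (if J.Inside r I then s I * (s' J * t I J) else 0) =
        c * ∑ I ∈ F with P I, ∑ J ∈ G with P J, (if J.Inside r I then
          insideTerm k σ w (fun I x => s I * u I x) (fun J x => s' J * v J x) I J else 0) := by
      simp_rw [Finset.mul_sum]
      refine Finset.sum_congr rfl fun I _ => Finset.sum_congr rfl fun J _ => ?_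
      split_ifs
      · rw [insideTerm_mul, ht]; ring
      · rw [mul_zero]
    rw [e, abs_mul, mul_assoc]
    refine mul_le_mul_of_nonneg_left (h.trans ?_) (abs_nonneg _)
    have h0 : 0 ≤ insideConst r * rootA2 σ w := by
      have := rootA2_nonneg σ w
      unfold insideConst; positivity
    refine mul_le_mul_of_nonneg_left ?_ h0
    exact mul_le_mul (fam_mul_le u hs _) (fam_mul_le v hs' _) (fam_nonneg _ _ _) (fam_nonneg _ _ _)
  obtain ⟨hrow, hout, hlim⟩ := summable_of_bilinear_bound hconst hx hy hT
  -- goodness of `f` and `φ` removes the restriction to good intervals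
  have hzero : ∀ I ∈ D, ∀ J ∈ D, ¬ (P I ∧ P J) → t I J = 0 := by
    intro I hI J hJ hn
    rw [ht, insideTerm]
    by_cases h1 : IsGood D ε r I
    · have h2 : ¬ IsGood D ε r J := fun h2 => hn ⟨⟨hI, h1⟩, hJ, h2⟩
      have : v J = fun _ => 0 := funext (hφ.mdiff_eq_zero hD hJ h2)
      simp [this, bform]
    · have : u I = fun _ => 0 := funext (hf.mdiff_eq_zero hD hI h1)
      simp [this, av]
  have hcongr : ∀ I ∈ D, ∀ J : {J : Itv // J ∈ D ∧ J.Inside r I}, T I J.1 = t I J.1 := by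
    intro I hI J
    simp only [hTdef]
    split_ifs with h
    · rfl
    · exact (hzero I hI J.1 J.2.1 fun h' => h ⟨h', J.2.2⟩).symm
  have hinner : ∀ I ∈ D, ∑' J : {J : Itv // J ∈ D ∧ J.Inside r I}, t I J.1 = ∑' J, T I J := by
    intro I hI
    rw [← tsum_congr (hcongr I hI)]
    refine tsum_subtype_eq_of_support_subset (s := {J : Itv | J ∈ D ∧ J.Inside r I}) fun J hJ => ?_
    by_contra hn
    apply hJ
    simp only [hTdef]
    rw [if_neg]
    exact fun h => hn ⟨h.1.2.1, h.2⟩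
  have houter : insideSum D r t = ∑' I, ∑' J, T I J := by
    unfold insideSum
    rw [tsum_congr fun I : {I : Itv // I ∈ D} => hinner I.1 I.2]
    refine tsum_subtype_eq_of_support_subset (s := D) (f := fun I => ∑' J, T I J) fun I hI => ?_
    by_contra hn
    apply hI
    have : ∀ J, T I J = 0 := fun J => by
      simp only [hTdef]
      exact if_neg fun h => hn h.1.1.1
    simp [this]
  refine ⟨⟨fun I hI => ?_, ?_⟩, ?_⟩
  · refine ((hrow I).subtype {J : Itv | J ∈ D ∧ J.Inside r I}).congr fun J => ?_
    exact (hcongr I hI J)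
  · refine (hout.subtype D).congr fun I => ?_
    exact (hinner I.1 I.2).symm
  · rw [houter]
    refine hlim.congr fun p => ?_
    have := hsum p.1 p.2 (fun _ => 1) (fun _ => 1)
    simp only [one_mul] at this
    rw [this]

open Classical in
/-- The form is continuous on `L²(σ) × L²(w)`, so it is the limit of its values on partial sums. -/
lemma PoissonDominated.tendsto_bform (hA : A2 σ w ≠ ∞) {M τ : ℝ} (hk : PoissonDominated k M τ)
    (hD : IsDyadicGrid D) (hf : IsGoodFun D ε r σ f) (hφ : IsGoodFun D ε r w φ) :
    Tendsto (fun p : Finset Itv × Finset Itv => bform k σ w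
      (fun y => ∑ I ∈ p.1 with I ∈ D ∧ IsGood D ε r I, mdiff σ I f y)
      (fun x => ∑ J ∈ p.2 with J ∈ D ∧ IsGood D ε r J, mdiff w J φ x))
      (atTop ×ˢ atTop) (𝓝 (bform k σ w f φ)) := by
  have hR := rootA2_nonneg σ w
  have hM := hk.nonneg
  rw [tendsto_iff_norm_sub_tendsto_zero]
  have hbound : Tendsto (fun p : Finset Itv × Finset Itv =>
      M * (30 * rootA2 σ w) * ((l2 σ fun x => f x -
        ∑ I ∈ p.1 with I ∈ D ∧ IsGood D ε r I, mdiff σ I f x) * l2 w φ) +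
      M * (30 * rootA2 σ w) * (l2 σ f * (l2 w fun x => φ x -
        ∑ J ∈ p.2 with J ∈ D ∧ IsGood D ε r J, mdiff w J φ x))) (atTop ×ˢ atTop) (𝓝 0) := by
    have h1 := ((hf.tendsto_l2.comp
      (tendsto_fst (f := atTop) (g := (atTop : Filter (Finset Itv))))).mul_const (l2 w φ)).const_mul
      (M * (30 * rootA2 σ w))
    have h2 := ((hφ.tendsto_l2.comp
      (tendsto_snd (f := (atTop : Filter (Finset Itv))) (g := atTop))).const_mul (l2 σ f)).const_mul
      (M * (30 * rootA2 σ w))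
    have h3 := h1.add h2
    rw [zero_mul, mul_zero, mul_zero, mul_zero, add_zero] at h3
    exact h3
  refine squeeze_zero (fun p => norm_nonneg _) (fun p => ?_) hbound
  have hF : MemLp (fun y => ∑ I ∈ p.1 with I ∈ D ∧ IsGood D ε r I, mdiff σ I f y) 2 σ :=
    memLp_sum fun I _ => haarStep_mdiff σ I f
  have hG : MemLp (fun y => ∑ J ∈ p.2 with J ∈ D ∧ IsGood D ε r J, mdiff w J φ y) 2 w :=
    memLp_sum fun J _ => haarStep_mdiff w J φ
  have hfF : MemLp (fun y => f y -
      ∑ I ∈ p.1 with I ∈ D ∧ IsGood D ε r I, mdiff σ I f y) 2 σ := hf.1.sub hF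
  have hφG : MemLp (fun y => φ y -
      ∑ J ∈ p.2 with J ∈ D ∧ IsGood D ε r J, mdiff w J φ y) 2 w := hφ.1.sub hG
  have e1 := hk.bform_sub_left hA hf.1 hF hφ.1
  have e2 := hk.bform_sub_right hA hF hφ.1 hG
  have b1 := hk.abs_bform_le hA hfF hφ.1
  have b2 := hk.abs_bform_le hA hF hφG
  have hFl : l2 σ (fun y => ∑ I ∈ p.1 with I ∈ D ∧ IsGood D ε r I, mdiff σ I f y) ≤ l2 σ f := by
    rw [l2_sum_eq_fam hD (fun I hI => (Finset.mem_filter.1 hI).2.1) fun I _ =>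
      haarStep_mdiff σ I f]
    exact fam_mdiff_le hD hf.1 fun I hI => (Finset.mem_filter.1 hI).2.1
  rw [Real.norm_eq_abs, abs_sub_comm, ← sub_add_sub_cancel _ (bform k σ w (fun y =>
    ∑ I ∈ p.1 with I ∈ D ∧ IsGood D ε r I, mdiff σ I f y) φ), ← e1, ← e2]
  refine (abs_add_le _ _).trans (add_le_add b1 (b2.trans ?_))
  have := l2_nonneg w (fun y => φ y - ∑ J ∈ p.2 with J ∈ D ∧ IsGood D ε r J, mdiff w J φ y)
  gcongr

lemma belowTerm_eq (hA : A2 σ w ≠ ∞) {α β : ℝ} (hα : 0 < α) (hβ : α < β) (f φ : ℝ → ℝ)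
    (I J : Itv) : belowTerm α β σ w f φ I J =
      insideTerm (fun x y => sharpKernel α β (x - y)) σ w (fun I => mdiff σ I f)
        (fun J => mdiff w J φ) I J := by
  unfold belowTerm
  rw [pair_hilbert hA hα hβ (memLp_ind _) (haarStep_mdiff w J φ).memLp]
  rfl

lemma aboveTerm_eq (hA : A2 σ w ≠ ∞) {α β : ℝ} (hα : 0 < α) (hβ : α < β) (f φ : ℝ → ℝ)
    (J I : Itv) : aboveTerm α β σ w f φ J I =
      insideTerm (fun x y => sharpKernel α β (y - x)) w σ (fun J => mdiff w J φ)
        (fun I => mdiff σ I f) J I := by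
  unfold aboveTerm
  rw [pair_hilbert hA hα hβ (haarStep_mdiff σ I f).memLp (memLp_ind _), ← bform_flip]
  rfl

/-- Convergence of the inside sums of good functions, and the bound for the difference of the
forms. -/
theorem forms_of_isGoodFun (hA : A2 σ w ≠ ∞) (hT : testingSq σ w ≠ ∞) (hD : IsDyadicGrid D)
    (hε : 0 < ε) (hε' : ε < 1 / 2) (hr : 1 ≤ r) {α β : ℝ} (hα : 0 < α) (hβ : α < β)
    (hf : IsGoodFun D ε r σ f) (hφ : IsGoodFun D ε r w φ) :
    InsideSummable D r (belowTerm α β σ w f φ) ∧ InsideSummable D r (aboveTerm α β σ w f φ) ∧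
    |formB α β σ w f φ - (formBelow D r α β σ w f φ + formAbove D r α β σ w f φ)| ≤
      finiteConst ε r * (rootA2 σ w + (weakBdd r α β σ w).toReal) * (l2 σ f * l2 w φ) := by
  classical
  have hA' : A2 w σ ≠ ∞ := by rwa [A2_comm]
  have hβ0 := hα.trans hβ
  -- the constant `β / α` of this majorant enters only the convergence, not the estimate
  have hL := localKernel_sharp hα hβ
  have hK := poissonDominated_sharp hα hβ
  have hc : β / α * (α / β) = 1 := by field_simp
  obtain ⟨s1, l1⟩ := insideSum_tendsto (c := β / α) hA hL hD (by linarith) hf hφ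
    (t := belowTerm α β σ w f φ) (fun I J => by
      rw [insideTerm_const_mul_kernel, ← mul_assoc, hc, one_mul, belowTerm_eq hA hα hβ])
  obtain ⟨s2, l2'⟩ := insideSum_tendsto (c := β / α) hA' hL.flip hD (by linarith) hφ hf
    (t := aboveTerm α β σ w f φ) (fun J I => by
      rw [insideTerm_const_mul_kernel (fun x y => sharpKernel α β (y - x)), ← mul_assoc, hc,
        one_mul, aboveTerm_eq hA hα hβ])
  refine ⟨s1, s2, ?_⟩
  have l2 := l2'.comp (tendsto_snd.prodMk tendsto_fst :
    Tendsto (fun p : Finset Itv × Finset Itv => (p.2, p.1)) (atTop ×ˢ atTop) (atTop ×ˢ atTop))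
  have l3 := hK.tendsto_bform hA hD hf hφ
  have lim := (l3.sub (l1.add l2)).abs
  have hB : formB α β σ w f φ = bform (fun x y => sharpKernel α β (x - y)) σ w f φ :=
    pair_hilbert hA hα hβ hf.1 hφ.1
  rw [← hB] at lim
  refine le_of_tendsto lim (Eventually.of_forall fun p => ?_)
  set F := p.1.filter fun I => I ∈ D ∧ IsGood D ε r I
  set G := p.2.filter fun J => J ∈ D ∧ IsGood D ε r J
  have hF : ∀ I ∈ F, I ∈ D ∧ IsGood D ε r I := fun I hI => (Finset.mem_filter.1 hI).2
  have hG : ∀ J ∈ G, J ∈ D ∧ IsGood D ε r J := fun J hJ => (Finset.mem_filter.1 hJ).2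
  have hu : ∀ I ∈ F, HaarStep σ I (mdiff σ I f) := fun I _ => haarStep_mdiff σ I f
  have hv : ∀ J ∈ G, HaarStep w J (mdiff w J φ) := fun J _ => haarStep_mdiff w J φ
  have main := abs_sum_residue_sharp_le hA hD hα hβ hε.le hε' hr
    (W := (weakBdd r α β σ w).toReal) ENNReal.toReal_nonneg
    (fun K L h1 h2 => abs_bform_sharp_ind_le hA hT hα hβ h1 h2) hF hu hG hv
  have hR := rootA2_nonneg σ w
  have hC := finiteConst_nonneg (r := r) hε'
  have hW : 0 ≤ (weakBdd r α β σ w).toReal := ENNReal.toReal_nonneg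
  refine le_trans (le_of_eq ?_) (main.trans ?_)
  · congr 1
    unfold residue
    simp_rw [Finset.sum_sub_distrib]
    rw [hK.bform_sum_left hA F (fun I hI => (hu I hI).memLp) (memLp_sum hv),
      Finset.sum_congr rfl fun I hI =>
        hK.bform_sum_right hA G (hu I hI).memLp fun J hJ => (hv J hJ).memLp]
    simp only [Function.comp_apply, belowTerm_eq hA hα hβ, aboveTerm_eq hA hα hβ]
    rw [Finset.sum_comm (s := G) (t := F)]
    ring
  · have h1 := fam_mdiff_le hD hf.1 fun I hI => (hF I hI).1
    have h2 := fam_mdiff_le hD hφ.1 fun J hJ => (hG J hJ).1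
    refine mul_le_mul_of_nonneg_left ?_ (by positivity)
    exact mul_le_mul h1 h2 (fam_nonneg _ _ _) (l2_nonneg _ _)

omit [IsLocallyFiniteMeasure σ] [IsLocallyFiniteMeasure w] in
/-- Forms that differ by a bounded amount are bounded together. -/
lemma UnifBounded.of_sub {B B' : ℝ → ℝ → (ℝ → ℝ) → (ℝ → ℝ) → ℝ} {L : ℝ≥0∞} (hL : L ≠ ∞)
    (h : ∀ α β : ℝ, 0 < α → α < β → ∀ f φ : ℝ → ℝ, IsGoodFun D ε r σ f → IsGoodFun D ε r w φ →
      ENNReal.ofReal |B α β f φ - B' α β f φ| ≤ L * eLpNorm f 2 σ * eLpNorm φ 2 w)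
    (hB : UnifBounded D ε r σ w B) : UnifBounded D ε r σ w B' := by
  obtain ⟨K, hK⟩ := hB
  refine ⟨K + L.toNNReal, fun α β hα hβ f φ hf hφ => ?_⟩
  have h1 : |B' α β f φ| ≤ |B α β f φ| + |B α β f φ - B' α β f φ| := by
    have := abs_sub_abs_le_abs_sub (B' α β f φ) (B α β f φ)
    rw [abs_sub_comm] at this; linarith
  refine (ENNReal.ofReal_le_ofReal h1).trans ?_
  rw [ENNReal.ofReal_add (abs_nonneg _) (abs_nonneg _)]
  refine (add_le_add (hK α β hα hβ f φ hf hφ) (h α β hα hβ f φ hf hφ)).trans_eq ?_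
  rw [ENNReal.coe_add, ENNReal.coe_toNNReal hL]; ring

end

end TwoWeight

open TwoWeight in
theorem theorem3p1 (ε : ℝ) (hε : 0 < ε) (hε' : ε < 1 / 2) (r : ℕ) (hr : 2 ≤ r) :
    ∃ C : ℝ≥0, ∀ (D : Set Itv) (σ w : Measure ℝ)
      [IsLocallyFiniteMeasure σ] [IsLocallyFiniteMeasure w],
      IsDyadicGrid D → NoEndpointMass D σ → NoEndpointMass D w →
      A2 σ w ≠ ∞ → testingSq σ w ≠ ∞ → testingSq w σ ≠ ∞ →
      (∀ α β : ℝ, 0 < α → α < β → ∀ f φ : ℝ → ℝ,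
        IsGoodFun D ε r σ f → IsGoodFun D ε r w φ →
        Integrable (fun x => hilbert α β σ f x * φ x) w ∧
        InsideSummable D r (belowTerm α β σ w f φ) ∧
        InsideSummable D r (aboveTerm α β σ w f φ) ∧
        ENNReal.ofReal |formB α β σ w f φ -
            (formBelow D r α β σ w f φ + formAbove D r α β σ w f φ)| ≤
          C * (A2 σ w ^ (1 / 2 : ℝ) + weakBdd r α β σ w) * eLpNorm f 2 σ * eLpNorm φ 2 w) ∧
      (UnifBounded D ε r σ w (fun α β f φ => formB α β σ w f φ) ↔
        UnifBounded D ε r σ w (fun α β f φ =>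
          formBelow D r α β σ w f φ + formAbove D r α β σ w f φ)) := by
  refine ⟨(finiteConst ε r).toNNReal, fun D σ w _ _ hD _ _ hA hT _ => ?_⟩
  have hbound : ∀ α β : ℝ, 0 < α → α < β → ∀ f φ : ℝ → ℝ,
      IsGoodFun D ε r σ f → IsGoodFun D ε r w φ →
      ENNReal.ofReal |formB α β σ w f φ -
        (formBelow D r α β σ w f φ + formAbove D r α β σ w f φ)| ≤
      ENNReal.ofReal (finiteConst ε r) *
        (A2 σ w ^ (1 / 2 : ℝ) + weakBdd r α β σ w) * eLpNorm f 2 σ * eLpNorm φ 2 w := by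
    intro α β hα hβ f φ hf hφ
    have h := (forms_of_isGoodFun hA hT hD hε hε' (by omega) hα hβ hf hφ).2.2
    have hR := rootA2_nonneg σ w
    have hC := finiteConst_nonneg (r := r) hε'
    refine (ENNReal.ofReal_le_ofReal h).trans_eq ?_
    rw [ENNReal.ofReal_mul (by positivity), ENNReal.ofReal_mul hC,
      ENNReal.ofReal_add hR ENNReal.toReal_nonneg, ofReal_rootA2 hA,
      ENNReal.ofReal_toReal (weakBdd_ne_top hA hT hα hβ r), ENNReal.ofReal_mul (l2_nonneg _ _),
      ← eLpNorm_two_eq hf.1, ← eLpNorm_two_eq hφ.1]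
    ring
  refine ⟨fun α β hα hβ f φ hf hφ => ?_, ?_⟩
  · obtain ⟨h1, h2, -⟩ := forms_of_isGoodFun hA hT hD hε hε' (by omega) hα hβ hf hφ
    exact ⟨integrable_hilbert_mul hA hα hβ hf.1 hφ.1, h1, h2, hbound α β hα hβ f φ hf hφ⟩
  · -- the weak boundedness constant is bounded uniformly in the truncation
    have hroot : ∀ {m : ℝ≥0∞}, m ≠ ∞ → m ^ (1 / 2 : ℝ) ≠ ∞ := fun h =>
      ENNReal.rpow_ne_top_of_nonneg (by norm_num) h
    have hL : ENNReal.ofReal (finiteConst ε r) *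
        (A2 σ w ^ (1 / 2 : ℝ) + (testingSq σ w ^ (1 / 2 : ℝ) + 36 * A2 σ w ^ (1 / 2 : ℝ))) ≠ ∞ :=
      ENNReal.mul_ne_top ENNReal.ofReal_ne_top (ENNReal.add_ne_top.2 ⟨hroot hA,
        ENNReal.add_ne_top.2 ⟨hroot hT, ENNReal.mul_ne_top (by norm_num) (hroot hA)⟩⟩)
    have hdiff : ∀ α β : ℝ, 0 < α → α < β → ∀ f φ : ℝ → ℝ,
        IsGoodFun D ε r σ f → IsGoodFun D ε r w φ →
        ENNReal.ofReal |formB α β σ w f φ -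
          (formBelow D r α β σ w f φ + formAbove D r α β σ w f φ)| ≤
        ENNReal.ofReal (finiteConst ε r) *
          (A2 σ w ^ (1 / 2 : ℝ) + (testingSq σ w ^ (1 / 2 : ℝ) + 36 * A2 σ w ^ (1 / 2 : ℝ))) *
          eLpNorm f 2 σ * eLpNorm φ 2 w := by
      intro α β hα hβ f φ hf hφ
      refine (hbound α β hα hβ f φ hf hφ).trans ?_
      gcongr
      exact weakBdd_le hA hT hα hβ r
    exact ⟨UnifBounded.of_sub hL hdiff, UnifBounded.of_sub hL fun α β hα hβ f φ hf hφ => by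
      rw [abs_sub_comm]; exact hdiff α β hα hβ f φ hf hφ⟩
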